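/- Let $\mathbb T^2=\mathbb R^2/\mathbb Z^2$, $e_m(x)=e^{2\pi i m\cdot x}$ for $m\in\mathbb Z^2$, and for $s\in\mathbb R$ let $\mathcal H^{s}$ be the Sobolev space of distributions $f$ on $\mathbb T^2$ with $\|f\|_{\mathcal H^s}^2=\sum_{m\in\mathbb Z^2}(1+4\pi^2|m|^2)^{s}|\hat f(m)|^2<\infty$. Let $X$ be a massive Gaussian free field on $\mathbb T^2$, that is, a random real distribution such that $(\langle X,\varphi\rangle)_{\varphi\in C^\infty(\mathbb T^2;\mathbb R)}$ is a centered Gaussian family with $$\mathbb E[\langle X,\varphi\rangle\langle X,\psi\rangle]=\int_{\mathbb T^2}\int_{\mathbb T^2}\mathcal G(x,y)\varphi(x)\psi(y)\,dx\,dy,\qquad \mathcal G(x,y)=\frac12\sum_{m\in\mathbb Z^2}\frac{e_m(x)\overline{e_m(y)}}{1+4\pi^2|m|^2},$$ where the series converges in $L^2$. Let $0<|\gamma|<\sqrt{8\pi}$ and $\beta\in\left(\frac{\gamma^2}{8\pi},1\right)$. Put $X_n=\sum_{|m|\le n}\hat X(m)e_m$ and $\mathcal R_n=\mathbb E[X_n(x)^2]$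 (which does not depend on $x$). Then $e^{\gamma X_n-\frac{\gamma^2}{2}\mathcal R_n}$ converges in $L^2(\mathbb P;\mathcal H^{-\beta})$ as $n\to\infty$, and its limit $:\!e^{\gamma X}\!:$, the Gaussian multiplicative chaos, satisfies $$\operatorname{Supp}\{\operatorname{Law}(:\!e^{\gamma X}\!:)\}=\{f\in\mathcal H^{-\beta} : f\ge 0\},$$ where the support of a measure $\mu$ on $\mathcal H^{-\beta}$ is the set of all $f$ such that $\mu(U)>0$ for every neighborhood $U$ of $f$, and $f\ge0$ means $\langle f,\varphi\rangle\ge0$ for every nonnegative $\varphi\in C^\infty(\mathbb T^2)$. -/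

import Mathlib

open MeasureTheory ProbabilityTheory Filter UnitAddTorus
open scoped Topology ENNReal ComplexOrder

noncomputable section

namespace TorusGMC

/-! ## The torus, its characters, test functions and distributions -/

/-- The two-dimensional torus `ℝ² / ℤ²`. -/
abbrev T2 : Type := UnitAddTorus (Fin 2)

/-- The index set `ℤ²` of the characters `e_m(x) = exp(2 π i m · x)`, which are
`UnitAddTorus.mFourier m` in Mathlib. -/
abbrev Freq : Type := Fin 2 → ℤ

/-- Lebesgue (Haar probability) measure on the torus. -/
abbrev torusMeasure : Measure T2 := Measure.pi fun _ => AddCircle.haarAddCircle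

/-- A function on the torus, seen as a `ℤ²`-periodic function on the plane. -/
def lift (φ : C(T2, ℂ)) : (Fin 2 → ℝ) → ℂ := fun x => φ fun i => (x i : UnitAddCircle)

lemma lift_add (φ ψ : C(T2, ℂ)) : lift (φ + ψ) = lift φ + lift ψ := rfl

lemma lift_smul (c : ℂ) (φ : C(T2, ℂ)) : lift (c • φ) = c • lift φ := rfl

/-- The space `C^∞(T²)` of (complex-valued) test functions. -/
def TestFunction : Submodule ℂ C(T2, ℂ) where
  carrier := {φ | ContDiff ℝ (⊤ : ℕ∞) (lift φ)}
  add_mem' := by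
    intro φ ψ hφ hψ
    simp only [Set.mem_ofPred_eq, lift_add] at *
    exact hφ.add hψ
  zero_mem' := by
    change ContDiff ℝ (⊤ : ℕ∞) (fun _ => (0 : ℂ))
    exact contDiff_const
  smul_mem' := by
    intro c φ hφ
    simp only [Set.mem_ofPred_eq, lift_smul] at *
    exact contDiff_const.smul hφ

/-- The space `D'(T²)` of distributions: linear functionals on `C^∞(T²)` that are continuous for
the Fréchet topology, i.e. bounded by a `C^k` norm: if all derivatives of `φ` up to order `k` are
at most `B` in norm, then `|u(φ)| ≤ C B`. -/
def Distr : Submodule ℂ (TestFunction →ₗ[ℂ] ℂ) where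
  carrier := {u | ∃ (k : ℕ) (C : ℝ), ∀ (φ : TestFunction) (B : ℝ),
    (∀ j ≤ k, ∀ x, ‖iteratedFDeriv ℝ j (lift φ) x‖ ≤ B) → ‖u φ‖ ≤ C * B}
  add_mem' := by
    rintro u v ⟨k, C, hu⟩ ⟨l, D, hv⟩
    refine ⟨max k l, C + D, fun φ B h => ?_⟩
    have h1 := hu φ B fun j hj => h j (hj.trans (le_max_left _ _))
    have h2 := hv φ B fun j hj => h j (hj.trans (le_max_right _ _))
    calc ‖(u + v) φ‖ ≤ ‖u φ‖ + ‖v φ‖ := norm_add_le _ _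
      _ ≤ (C + D) * B := by linarith
  zero_mem' := ⟨0, 0, fun φ B _ => by simp⟩
  smul_mem' := by
    rintro c u ⟨k, C, hu⟩
    refine ⟨k, ‖c‖ * C, fun φ B h => ?_⟩
    have h1 := hu φ B h
    calc ‖(c • u) φ‖ = ‖c‖ * ‖u φ‖ := by simp
      _ ≤ ‖c‖ * (C * B) := by gcongr
      _ = ‖c‖ * C * B := by ring

/-- The pairing `φ ↦ ∫ f φ dx` of a continuous function `f` with test functions. -/
def ofContinuous (f : C(T2, ℂ)) : Distr :=
  ⟨{ toFun := fun φ => ∫ x, f x * (φ : C(T2, ℂ)) x ∂torusMeasure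
     map_add' := by
      intro φ ψ
      rw [← integral_add]
      · refine integral_congr_ae (.of_forall fun x => ?_)
        simp [mul_add]
      · exact ((f * (φ : C(T2, ℂ))).continuous.integrable_of_hasCompactSupport
          (HasCompactSupport.of_compactSpace _))
      · exact ((f * (ψ : C(T2, ℂ))).continuous.integrable_of_hasCompactSupport
          (HasCompactSupport.of_compactSpace _))
     map_smul' := by
      intro c φ
      simp only [RingHom.id_apply, smul_eq_mul]
      rw [← integral_const_mul]
      refine integral_congr_ae (.of_forall fun x => ?_)
      simp only [Submodule.coe_smul, ContinuousMap.coe_smul, Pi.smul_apply, smul_eq_mul]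
      ring },
   by
    refine ⟨0, ‖f‖, fun φ B h => ?_⟩
    have hB : ∀ x : T2, ‖(φ : C(T2, ℂ)) x‖ ≤ B := by
      intro x
      choose y hy using fun i => QuotientAddGroup.mk_surjective (x i)
      have h0 := h 0 le_rfl y
      rw [norm_iteratedFDeriv_zero] at h0
      have hx : (fun i => ((y i : ℝ) : UnitAddCircle)) = x := funext hy
      simpa [lift, hx] using h0
    have := norm_integral_le_of_norm_le_const (μ := torusMeasure) (C := ‖f‖ * B)
      (f := fun x => f x * (φ : C(T2, ℂ)) x) (.of_forall fun x => by
        rw [norm_mul]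
        exact mul_le_mul (f.norm_coe_le_norm x) (hB x) (norm_nonneg _) (norm_nonneg _))
    simpa using this⟩

/-- The character `e_m` as a test function. -/
def char (m : Freq) : TestFunction :=
  ⟨mFourier m, by
    have h : lift (mFourier m) =
        fun x => ∏ i, Complex.exp (2 * Real.pi * Complex.I * (m i : ℂ) * (x i : ℂ)) := by
      funext x
      simp only [lift, mFourier, ContinuousMap.coe_mk]
      refine Finset.prod_congr rfl fun i _ => ?_
      rw [fourier_coe_apply]
      congr 1
      push_cast
      ring
    change ContDiff ℝ (⊤ : ℕ∞) (lift (mFourier m))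
    rw [h]
    refine contDiff_prod fun i _ => ContDiff.cexp (contDiff_const.mul ?_)
    exact Complex.ofRealCLM.contDiff.comp (contDiff_apply ℝ ℝ i)⟩

/-- The Fourier coefficient `û(m) = u(e_{-m})`, i.e. `∫ f(x) exp(-2 π i m · x) dx` for a
function `f`. -/
def fourierCoeff (u : Distr) (m : Freq) : ℂ := (u : TestFunction →ₗ[ℂ] ℂ) (char (-m))

/-- A distribution is nonnegative if it is nonnegative (in particular real) on nonnegative test
functions. -/
def IsNonneg (u : Distr) : Prop :=
  ∀ φ : TestFunction, (∀ x, 0 ≤ (φ : C(T2, ℂ)) x) → 0 ≤ (u : TestFunction →ₗ[ℂ] ℂ) φ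

/-! ## Sobolev spaces -/

/-- The squared Euclidean norm `|m|²`. -/
def freqSq (m : Freq) : ℤ := m 0 ^ 2 + m 1 ^ 2

/-- The eigenvalue `1 + 4 π² |m|²` of `1 - Δ` at `e_m`. -/
def eigen (m : Freq) : ℝ := 1 + 4 * Real.pi ^ 2 * (freqSq m : ℝ)

lemma one_le_eigen (m : Freq) : 1 ≤ eigen m := by
  have : (0 : ℝ) ≤ (freqSq m : ℝ) := by
    unfold freqSq; push_cast; positivity
  unfold eigen
  have := mul_nonneg (by positivity : (0 : ℝ) ≤ 4 * Real.pi ^ 2) this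
  linarith

/-- The sequence `(1 + 4 π² |m|²)^{s/2} û(m)`. -/
def weightedCoeff (s : ℝ) (u : Distr) (m : Freq) : ℂ :=
  ((eigen m ^ (s / 2) : ℝ) : ℂ) * fourierCoeff u m

lemma weightedCoeff_add (s : ℝ) (u v : Distr) :
    weightedCoeff s (u + v) = weightedCoeff s u + weightedCoeff s v := by
  funext m
  simp [weightedCoeff, fourierCoeff, mul_add]

lemma weightedCoeff_smul (s : ℝ) (c : ℂ) (u : Distr) :
    weightedCoeff s (c • u) = c • weightedCoeff s u := by
  funext m
  simp [weightedCoeff, fourierCoeff]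
  ring

/-- The Sobolev space `H^s(T²)`: the distributions `u` with
`∑_m (1 + 4 π² |m|²)^s |û(m)|² < ∞`. -/
def Sobolev (s : ℝ) : Submodule ℂ Distr where
  carrier := {u | Memℓp (weightedCoeff s u) 2}
  add_mem' := by
    intro u v hu hv
    simp only [Set.mem_ofPred_eq, weightedCoeff_add] at *
    exact hu.add hv
  zero_mem' := by
    have h : weightedCoeff s 0 = 0 := by
      funext m
      simp [weightedCoeff, fourierCoeff]
    simp only [Set.mem_ofPred_eq, h]
    exact zero_memℓp
  smul_mem' := by
    intro c u hu
    simp only [Set.mem_ofPred_eq, weightedCoeff_smul] at *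
    exact hu.const_smul c

/-- The linear map `u ↦ ((1 + 4 π² |m|²)^{s/2} û(m))_m` from `H^s` to `ℓ²(ℤ²)`. -/
def Sobolev.toEll2 (s : ℝ) : Sobolev s →ₗ[ℂ] lp (fun _ : Freq => ℂ) 2 where
  toFun u := ⟨weightedCoeff s u, u.2⟩
  map_add' u v := Subtype.ext (weightedCoeff_add s u v)
  map_smul' c u := Subtype.ext (weightedCoeff_smul s c u)

/-- The norm of `H^s`: `‖u‖² = ∑_m (1 + 4 π² |m|²)^s |û(m)|²`. -/
instance Sobolev.instSeminormedAddCommGroup (s : ℝ) : SeminormedAddCommGroup (Sobolev s) :=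
  SeminormedAddCommGroup.induced (Sobolev s) (lp (fun _ : Freq => ℂ) 2) (Sobolev.toEll2 s)

/-- `H^s` carries its Borel σ-algebra. -/
instance Sobolev.instMeasurableSpace (s : ℝ) : MeasurableSpace (Sobolev s) := borel _

instance Sobolev.instBorelSpace (s : ℝ) : BorelSpace (Sobolev s) := ⟨rfl⟩

/-! ## The massive Gaussian free field -/

lemma sq_norm_le_eigen (m : Freq) : ‖m‖ ^ 2 ≤ 2 * eigen m := by
  have h : ∀ i, (m i : ℝ) ^ 2 ≤ (m 0 : ℝ) ^ 2 + (m 1 : ℝ) ^ 2 := by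
    intro i
    fin_cases i
    · simpa using sq_nonneg (m 1 : ℝ)
    · simpa using sq_nonneg (m 0 : ℝ)
  have h1 : ‖m‖ ≤ Real.sqrt ((m 0 : ℝ) ^ 2 + (m 1 : ℝ) ^ 2) := by
    refine (pi_norm_le_iff_of_nonneg (Real.sqrt_nonneg _)).2 fun i => ?_
    rw [Int.norm_eq_abs]
    exact Real.abs_le_sqrt (h i)
  have h2 : ‖m‖ ^ 2 ≤ (m 0 : ℝ) ^ 2 + (m 1 : ℝ) ^ 2 :=
    (Real.le_sqrt (norm_nonneg _) (by positivity)).1 h1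
  have h3 : eigen m = 1 + 4 * Real.pi ^ 2 * ((m 0 : ℝ) ^ 2 + (m 1 : ℝ) ^ 2) := by
    simp [eigen, freqSq]
  have h4 : (9 : ℝ) ≤ Real.pi ^ 2 := by nlinarith [Real.pi_gt_three]
  rw [h3]
  nlinarith [mul_nonneg (sub_nonneg.2 h4)
    (by positivity : (0 : ℝ) ≤ (m 0 : ℝ) ^ 2 + (m 1 : ℝ) ^ 2),
    (by positivity : (0 : ℝ) ≤ (m 0 : ℝ) ^ 2 + (m 1 : ℝ) ^ 2)]

lemma memℓp_green : Memℓp (fun m : Freq => ((1 / (2 * eigen m) : ℝ) : ℂ)) 2 := by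
  refine memℓp_gen ?_
  have hs := EisensteinSeries.summable_one_div_norm_rpow (k := 4) (by norm_num)
  refine hs.of_norm_bounded_eventually ?_
  have h0 : ∀ᶠ m : Freq in cofinite, m ≠ 0 := (Set.finite_singleton (0 : Freq)).compl_mem_cofinite
  filter_upwards [h0] with m hm
  have hpos : 0 < ‖m‖ := norm_pos_iff.2 hm
  have he : 0 < eigen m := lt_of_lt_of_le one_pos (one_le_eigen m)
  have h1 : (1 / (2 * eigen m)) ≤ (‖m‖ ^ 2)⁻¹ := by
    rw [one_div]
    exact inv_anti₀ (by positivity) (sq_norm_le_eigen m)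
  have h2 : ‖m‖ ^ (-4 : ℝ) = ((‖m‖ ^ 2)⁻¹) ^ 2 := by
    rw [Real.rpow_neg hpos.le, inv_pow, ← pow_mul, ← Real.rpow_natCast]
    norm_num
  have h3 : ‖‖((1 / (2 * eigen m) : ℝ) : ℂ)‖ ^ (2 : ℝ≥0∞).toReal‖ = (1 / (2 * eigen m)) ^ 2 := by
    rw [Complex.norm_real, Real.norm_of_nonneg (by positivity), ENNReal.toReal_ofNat,
      Real.rpow_two, Real.norm_of_nonneg (by positivity)]
  rw [h2, h3]
  gcongr

/-- The function `x ↦ ½ ∑_m e_m(x) / (1 + 4 π² |m|²)` in `L²(T²)`, the series being convergent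
in `L²`. -/
def greenFunction : Lp ℂ 2 torusMeasure :=
  (mFourierBasis (d := Fin 2)).repr.symm ⟨_, memℓp_green⟩

/-- The Green's function
`𝒢(x, y) = ½ ∑_m e_m(x) conj(e_m(y)) / (1 + 4 π² |m|²) = ½ ∑_m e_m(x - y) / (1 + 4 π² |m|²)`. -/
def greenKernel (x y : T2) : ℂ := greenFunction (x - y)

/-- The real-valued test functions. -/
abbrev RealTestFunction : Type :=
  {φ : TestFunction // ∀ x, ((φ : C(T2, ℂ)) x).im = 0}

variable {Ω : Type*} [MeasurableSpace Ω]

/-- `X` is a massive Gaussian free field on the torus: a random real distribution such that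
`(⟨X, φ⟩)_φ`, `φ` ranging over the real test functions, is a centered Gaussian family with
`𝔼[⟨X, φ⟩ ⟨X, ψ⟩] = ∫∫ 𝒢(x, y) φ(x) ψ(y) dx dy`. -/
structure IsMassiveGFF (X : Ω → Distr) (P : Measure Ω) : Prop where
  isReal : ∀ φ : RealTestFunction, ∀ᵐ ω ∂P, ((X ω : TestFunction →ₗ[ℂ] ℂ) φ).im = 0
  gaussian : IsGaussianProcess
    (fun (φ : RealTestFunction) ω => ((X ω : TestFunction →ₗ[ℂ] ℂ) φ).re) P
  centered : ∀ φ : RealTestFunction, ∫ ω, ((X ω : TestFunction →ₗ[ℂ] ℂ) φ).re ∂P = 0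
  covariance : ∀ φ ψ : RealTestFunction,
    ((∫ ω, ((X ω : TestFunction →ₗ[ℂ] ℂ) φ).re * ((X ω : TestFunction →ₗ[ℂ] ℂ) ψ).re ∂P : ℝ) : ℂ) =
      ∫ x, ∫ y, greenKernel x y * (φ.1 : C(T2, ℂ)) x * (ψ.1 : C(T2, ℂ)) y
        ∂torusMeasure ∂torusMeasure

/-! ## The Gaussian multiplicative chaos -/

/-- The frequencies `m` with `|m| ≤ n`. -/
def freqBall (n : ℕ) : Finset Freq :=
  (Fintype.piFinset fun _ : Fin 2 => Finset.Icc (-(n : ℤ)) n).filter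
    fun m => freqSq m ≤ (n : ℤ) ^ 2

/-- The truncation `Π_n u = ∑_{|m| ≤ n} û(m) e_m`. -/
def truncate (n : ℕ) (u : Distr) : C(T2, ℂ) :=
  ∑ m ∈ freqBall n, fourierCoeff u m • mFourier m

/-- The variance `ℛ_n = 𝔼[X_n(x)²]` of `X_n = Π_n X`. For the massive Gaussian free field it does
not depend on the point `x`, which is taken to be `0` here. -/
def truncVariance (X : Ω → Distr) (P : Measure Ω) (n : ℕ) : ℂ :=
  ∫ ω, (truncate n (X ω) 0) ^ 2 ∂P

/-- The truncated Wick exponential `exp(γ X_n - (γ² / 2) ℛ_n)`, a function on the torus. -/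
def wickExp (X : Ω → Distr) (P : Measure Ω) (γ : ℝ) (n : ℕ) (ω : Ω) : C(T2, ℂ) where
  toFun x := Complex.exp (γ * truncate n (X ω) x - γ ^ 2 / 2 * truncVariance X P n)
  continuous_toFun := by fun_prop

/-- `M` is the Gaussian multiplicative chaos `:e^{γX}:`, i.e. the limit in `L²(P; H^s)` of the
truncated Wick exponentials. -/
def IsGMC (X : Ω → Distr) (P : Measure Ω) (γ s : ℝ) (M : Ω → Sobolev s) : Prop :=
  MemLp M 2 P ∧
  ∃ W : ℕ → Ω → Sobolev s,
    (∀ n ω, (W n ω : Distr) = ofContinuous (wickExp X P γ n ω)) ∧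
    (∀ n, MemLp (W n) 2 P) ∧
    Tendsto (fun n => eLpNorm (W n - M) 2 P) atTop (𝓝 0)

end TorusGMC

end

/-!
Let `F` be a finite symmetric set of frequencies, `X_F` the truncation of the field to `F` and
`G_F (x - y) = 𝔼[X_F(x) X_F(y)]`.

*Existence.* The second moment of the `m`-th Fourier coefficient of the Wick exponential of
`γ X_F` is the `m`-th Fourier coefficient of `exp (γ² G_F)`. Since `G_F` has nonnegative Fourier
coefficients, and this is preserved by products, positive combinations and hence by `exp`, these
second moments increase with `F`, and they are controlled by replacing `G_F` with the
heat-regularised Green function. The functional equation of the Jacobi theta function bounds the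
exponential of the latter by a product of singularities `|x_i| ^ (-a)` with
`γ² / (8π) < a < β`. Writing `(1 + 4π²|m|²) ^ (-β)` as a Gamma integral over heat
kernels bounds the second moments in `𝓗^{-β}` uniformly in `F`, and a bounded monotone family of
this kind converges in `L²`.

*Support.* The Wick exponentials are nonnegative functions and the cone of nonnegative
distributions is closed, which is one inclusion. For the other, the chaos is a finite product of
low frequencies, whose Gaussian coefficients come close to any prescribed values with positive
probability, times an independent chaos of high frequencies, which is close to `1` in `𝓗^{-β}`
with probability at least `1/2`. Hence the support contains every exponential of a real
trigonometric polynomial, and by Fejér means and the Stone–Weierstrass theorem these are dense in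
the cone.
-/

open scoped fwdDiff

noncomputable section

namespace TorusGMC

/-! ## Fourier coefficients on the torus -/

section Torus

variable {d : Type*}

/-- The projection `ℝᵈ → 𝕋ᵈ`, so that `lift φ = φ ∘ toTorus`. -/
def toTorus (y : d → ℝ) : UnitAddTorus d := fun i => (y i : UnitAddCircle)

lemma toTorus_surjective : Function.Surjective (toTorus (d := d)) := fun x => by
  choose y hy using fun i => QuotientAddGroup.mk_surjective (x i)
  exact ⟨y, funext hy⟩

lemma toTorus_add (y z : d → ℝ) : toTorus (y + z) = toTorus y + toTorus z := rfl

lemma fwdDiff_iterate_toTorus (w : d → ℝ) (k : ℕ) (f : UnitAddTorus d → ℂ) (y : d → ℝ) :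
    (Δ_[w])^[k] (f ∘ toTorus) y = (Δ_[toTorus w])^[k] f (toTorus y) := by
  induction k generalizing f with
  | zero => rfl
  | succ _ ih => exact ih (Δ_[toTorus w] f)

variable [Fintype d]

/-- The Haar probability measure on the torus `𝕋ᵈ`, of which `torusMeasure` is the case `d = 2`. -/
abbrev haarTorus (d : Type*) [Fintype d] : Measure (UnitAddTorus d) :=
  Measure.pi fun _ => AddCircle.haarAddCircle

lemma mFourier_toTorus (m : d → ℤ) (y : d → ℝ) :
    mFourier m (toTorus y) =
      Complex.exp (2 * Real.pi * Complex.I * (∑ i, m i * y i : ℝ)) := by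
  simp only [mFourier, ContinuousMap.coe_mk, toTorus, fourier_coe_apply, ← Complex.exp_sum]
  push_cast
  rw [Finset.mul_sum]
  congr 1
  exact Finset.sum_congr rfl fun i _ => by ring

lemma mFourier_apply_add (m : d → ℤ) (x y : UnitAddTorus d) :
    mFourier m (x + y) = mFourier m x * mFourier m y := by
  simp only [mFourier, ContinuousMap.coe_mk, Pi.add_apply, fourier_apply, smul_add,
    AddCircle.toCircle_add, Circle.coe_mul, Finset.prod_mul_distrib]

lemma mFourier_apply_neg (m : d → ℤ) (x : UnitAddTorus d) :
    mFourier m (-x) = mFourier (-m) x := by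
  simp [mFourier, fourier_apply]

lemma norm_mFourier_apply (m : d → ℤ) (x : UnitAddTorus d) : ‖mFourier m x‖ = 1 := by
  simp only [mFourier, fourier_apply, ContinuousMap.coe_mk, norm_prod, Circle.norm_coe,
    Finset.prod_const_one]

lemma integrable_haarTorus (f : C(UnitAddTorus d, ℂ)) : Integrable f (haarTorus d) :=
  f.continuous.integrable_of_hasCompactSupport (HasCompactSupport.of_compactSpace _)

lemma mFourierCoeff_eq_integral_mul (f : UnitAddTorus d → ℂ) (m : d → ℤ) :
    mFourierCoeff f m = ∫ x, f x * mFourier (-m) x ∂haarTorus d := by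
  simp only [mFourierCoeff, smul_eq_mul, mul_comm]
  rfl

lemma integrable_mul_mFourier {f : UnitAddTorus d → ℂ} (hf : Integrable f (haarTorus d))
    (m : d → ℤ) : Integrable (fun x => f x * mFourier m x) (haarTorus d) :=
  hf.mul_bdd (mFourier m).continuous.aestronglyMeasurable
    (.of_forall fun x => (norm_mFourier_apply m x).le)

lemma norm_mFourierCoeff_le {f : UnitAddTorus d → ℂ} {B : ℝ} (h : ∀ x, ‖f x‖ ≤ B) (m : d → ℤ) :
    ‖mFourierCoeff f m‖ ≤ B := by
  rw [mFourierCoeff_eq_integral_mul]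
  simpa only [probReal_univ, mul_one] using
    norm_integral_le_of_norm_le_const (μ := haarTorus d) (.of_forall fun x => by
      rw [norm_mul, norm_mFourier_apply, mul_one]
      exact h x)

/-- The `m`-th Fourier coefficient, as a continuous linear functional on `C(𝕋ᵈ)`. -/
def mFourierCoeffCLM (m : d → ℤ) : C(UnitAddTorus d, ℂ) →L[ℂ] ℂ :=
  LinearMap.mkContinuous
    { toFun f := mFourierCoeff f m
      map_add' f g := by
        simp only [mFourierCoeff_eq_integral_mul, ContinuousMap.add_apply, add_mul]
        exact integral_add (integrable_mul_mFourier (integrable_haarTorus f) _)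
          (integrable_mul_mFourier (integrable_haarTorus g) _)
      map_smul' c f := by
        simp only [mFourierCoeff_eq_integral_mul, ContinuousMap.smul_apply, smul_eq_mul, mul_assoc,
          RingHom.id_apply]
        exact integral_const_mul _ _ } 1
    fun f => by simpa using! norm_mFourierCoeff_le f.norm_coe_le_norm m

lemma mFourierCoeffCLM_apply (m : d → ℤ) (f : C(UnitAddTorus d, ℂ)) :
    mFourierCoeffCLM m f = mFourierCoeff f m := rfl

lemma mFourierCoeff_add (f g : C(UnitAddTorus d, ℂ)) (m : d → ℤ) :
    mFourierCoeff (f + g : C(UnitAddTorus d, ℂ)) m = mFourierCoeff f m + mFourierCoeff g m :=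
  map_add (mFourierCoeffCLM m) f g

lemma mFourierCoeff_sub (f g : C(UnitAddTorus d, ℂ)) (m : d → ℤ) :
    mFourierCoeff (f - g : C(UnitAddTorus d, ℂ)) m = mFourierCoeff f m - mFourierCoeff g m :=
  map_sub (mFourierCoeffCLM m) f g

lemma mFourierCoeff_smul (c : ℂ) (f : C(UnitAddTorus d, ℂ)) (m : d → ℤ) :
    mFourierCoeff (c • f : C(UnitAddTorus d, ℂ)) m = c * mFourierCoeff f m :=
  map_smul (mFourierCoeffCLM m) c f

lemma mFourierCoeff_mFourier_mul (l : d → ℤ) (f : C(UnitAddTorus d, ℂ)) (m : d → ℤ) :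
    mFourierCoeff (mFourier l * f : C(UnitAddTorus d, ℂ)) m = mFourierCoeff f (m - l) := by
  simp only [mFourierCoeff_eq_integral_mul, ContinuousMap.mul_apply, neg_sub, sub_eq_add_neg l m,
    mFourier_add]
  exact integral_congr_ae (.of_forall fun x => by ring)

lemma mFourierCoeff_comp_add_right (f : UnitAddTorus d → ℂ) (τ : UnitAddTorus d) (m : d → ℤ) :
    mFourierCoeff (fun x => f (x + τ)) m = mFourier m τ * mFourierCoeff f m := by
  have hτ : mFourier m τ * mFourier (-m) τ = 1 := by
    rw [← mFourier_add, add_neg_cancel, mFourier_zero, ContinuousMap.one_apply]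
  have hshift : ∀ x, f (x + τ) * mFourier (-m) x =
      mFourier m τ * (f (x + τ) * mFourier (-m) (x + τ)) := fun x => by
    rw [mFourier_apply_add]
    linear_combination (-(f (x + τ) * mFourier (-m) x)) * hτ
  simp only [mFourierCoeff_eq_integral_mul, hshift]
  rw [integral_const_mul,
    integral_add_right_eq_self (μ := haarTorus d) (fun x => f x * mFourier (-m) x) τ]

/-- The translation of `𝕋ᵈ` in direction `i` by half a period of `e_m`. -/
def halfPeriod [DecidableEq d] (m : d → ℤ) (i : d) : d → ℝ := Pi.single i (1 / (2 * (m i : ℝ)))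

lemma norm_halfPeriod [DecidableEq d] (m : d → ℤ) (i : d) :
    ‖halfPeriod m i‖ = 1 / (2 * ‖m i‖) := by
  rw [halfPeriod, Pi.norm_single, norm_div, norm_mul, norm_one, Real.norm_two, Int.norm_eq_abs,
    Real.norm_eq_abs]

lemma mFourier_halfPeriod [DecidableEq d] (m : d → ℤ) (i : d) (h : m i ≠ 0) :
    mFourier m (toTorus (halfPeriod m i)) = -1 := by
  have hhalf : ∑ j, (m j : ℝ) * halfPeriod m i j = 1 / 2 := by
    have h' : (m i : ℝ) ≠ 0 := Int.cast_ne_zero.2 h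
    rw [Finset.sum_eq_single i (fun j _ hj => by simp [halfPeriod, hj]) (by simp), halfPeriod,
      Pi.single_eq_same]
    field_simp
  rw [mFourier_toTorus, hhalf, ← Complex.exp_pi_mul_I]
  congr 1
  push_cast
  ring

lemma integral_mFourier (m : d → ℤ) :
    ∫ x, mFourier m x ∂haarTorus d = if m = 0 then 1 else 0 := by
  classical
  split_ifs with h
  · subst h
    simp [mFourier_zero]
  · obtain ⟨i, hi⟩ := Function.ne_iff.1 h
    have hinv := mFourierCoeff_comp_add_right 1 (toTorus (halfPeriod (-m) i)) (-m)
    rw [mFourier_halfPeriod (-m) i (by simpa using hi)] at hinv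
    simp only [mFourierCoeff_eq_integral_mul, Pi.one_apply, neg_neg, one_mul] at hinv
    exact self_eq_neg.1 (by linear_combination hinv)

lemma mFourierCoeff_mFourier (l m : d → ℤ) :
    mFourierCoeff (mFourier l) m = if l = m then 1 else 0 := by
  simp only [mFourierCoeff_eq_integral_mul, ← mFourier_add, integral_mFourier, ← sub_eq_add_neg,
    sub_eq_zero]

lemma mFourierCoeff_fwdDiff_iterate (τ : UnitAddTorus d) (m : d → ℤ) (k : ℕ)
    {f : UnitAddTorus d → ℂ} (hf : Integrable f (haarTorus d)) :
    mFourierCoeff ((Δ_[τ])^[k] f) m = (mFourier m τ - 1) ^ k * mFourierCoeff f m := by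
  induction k generalizing f with
  | zero => simp
  | succ k ih =>
    have hτ : Integrable (fun x => f (x + τ)) (haarTorus d) := hf.comp_add_right τ
    have hsub : mFourierCoeff (Δ_[τ] f) m =
        mFourierCoeff (fun x => f (x + τ)) m - mFourierCoeff f m := by
      simp only [mFourierCoeff_eq_integral_mul, fwdDiff, sub_mul]
      exact integral_sub (integrable_mul_mFourier hτ _) (integrable_mul_mFourier hf _)
    rw [Function.iterate_succ_apply, ih (f := Δ_[τ] f) (hτ.sub hf), hsub,
      mFourierCoeff_comp_add_right]
    ring

end Torus

/-! ## Decay of the Fourier coefficients of smooth functions -/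

lemma norm_fwdDiff_iterate_le {E F : Type*} [NormedAddCommGroup E] [NormedSpace ℝ E]
    [NormedAddCommGroup F] [NormedSpace ℝ F] {k : ℕ} {f : E → F} (hf : ContDiff ℝ k f) {B : ℝ}
    (hB : ∀ y, ‖iteratedFDeriv ℝ k f y‖ ≤ B) (w y : E) : ‖(Δ_[w])^[k] f y‖ ≤ ‖w‖ ^ k * B := by
  induction k generalizing f B with
  | zero => simpa using hB y
  | succ k ih =>
    have hf' : ContDiff ℝ k f := hf.of_le (by exact_mod_cast Nat.le_succ k)
    have hshift : ContDiff ℝ k fun y => f (y + w) := hf'.comp (contDiff_id.add contDiff_const)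
    rw [Function.iterate_succ_apply, pow_succ, mul_assoc]
    refine ih (f := Δ_[w] f) (hshift.sub hf') fun z => ?_
    have hsub : iteratedFDeriv ℝ k (Δ_[w] f) z =
        iteratedFDeriv ℝ k f (z + w) - iteratedFDeriv ℝ k f z := by
      have := iteratedFDeriv_sub_apply (x := z) hshift.contDiffAt hf'.contDiffAt
      rwa [iteratedFDeriv_comp_add_right] at this
    have hmean := convex_univ.norm_image_sub_le_of_norm_fderiv_le
      (fun x _ => hf.differentiable_iteratedFDeriv (by exact_mod_cast Nat.lt_succ_self k) x)
      (fun x _ => by rw [norm_fderiv_iteratedFDeriv]; exact hB x)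
      (Set.mem_univ z) (Set.mem_univ (z + w))
    rw [hsub, mul_comm]
    simpa using hmean

section Decay

variable {d : Type*} [Fintype d]

-- Replaces `k` integrations by parts: differencing `k` times with step half a period of `e_m`
-- multiplies the `m`-th Fourier coefficient by `(-2) ^ k` and the function by `O(‖m‖ ^ (-k))`.
lemma pow_mul_norm_mFourierCoeff_le {f : C(UnitAddTorus d, ℂ)} {k : ℕ}
    (hf : ContDiff ℝ k (f ∘ toTorus)) {B : ℝ}
    (hB : ∀ x, ‖iteratedFDeriv ℝ k (f ∘ toTorus) x‖ ≤ B) (m : d → ℤ) :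
    ‖m‖ ^ k * ‖mFourierCoeff f m‖ ≤ B := by
  classical
  have bound_of_zero : ∀ l : d → ℤ, ‖l‖ ^ k = 0 → ‖l‖ ^ k * ‖mFourierCoeff f l‖ ≤ B := fun l hl =>
    by simpa [hl] using (norm_nonneg _).trans (hB 0)
  rcases eq_or_ne k 0 with rfl | hk
  · rw [pow_zero, one_mul]
    refine norm_mFourierCoeff_le (toTorus_surjective.forall.2 fun y => ?_) m
    simpa using hB y
  rcases isEmpty_or_nonempty d with hd | hd
  · exact bound_of_zero m (by rw [Subsingleton.elim m 0, norm_zero, zero_pow hk])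
  obtain ⟨i, hmax⟩ := Finite.exists_max fun i => ‖m i‖
  have hi : ‖m‖ = ‖m i‖ :=
    le_antisymm ((pi_norm_le_iff_of_nonneg (norm_nonneg _)).2 hmax) (norm_le_pi_norm m i)
  rcases eq_or_ne (m i) 0 with hmi | hmi
  · exact bound_of_zero m (by rw [hi, hmi, norm_zero, zero_pow hk])
  have := norm_pos_iff.2 hmi
  have hdiff := norm_mFourierCoeff_le (f := (Δ_[toTorus (halfPeriod m i)])^[k] f)
    (toTorus_surjective.forall.2 fun y => by
      rw [← fwdDiff_iterate_toTorus]
      exact norm_fwdDiff_iterate_le hf hB (halfPeriod m i) y) m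
  rw [mFourierCoeff_fwdDiff_iterate _ _ _ (integrable_haarTorus f), mFourier_halfPeriod m i hmi,
    norm_mul, norm_pow, show ‖(-1 - 1 : ℂ)‖ = 2 by norm_num, norm_halfPeriod, div_pow, one_pow,
    div_mul_eq_mul_div, one_mul, le_div_iff₀ (by positivity), mul_pow] at hdiff
  have hone : (1 : ℝ) ≤ 2 ^ k * 2 ^ k := one_le_mul_of_one_le_of_one_le
    (one_le_pow₀ one_le_two) (one_le_pow₀ one_le_two)
  calc ‖m‖ ^ k * ‖mFourierCoeff f m‖
      ≤ (2 ^ k * 2 ^ k) * (‖m‖ ^ k * ‖mFourierCoeff f m‖) :=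
        le_mul_of_one_le_left (by positivity) hone
    _ ≤ B := by rw [hi]; linarith

lemma norm_mFourierCoeff_le_inv_pow {f : C(UnitAddTorus d, ℂ)} {k : ℕ}
    (hf : ContDiff ℝ k (f ∘ toTorus)) {B : ℝ}
    (hB : ∀ j ≤ k, ∀ x, ‖iteratedFDeriv ℝ j (f ∘ toTorus) x‖ ≤ B) (m : d → ℤ) :
    ‖mFourierCoeff f m‖ ≤ 2 ^ (k + 1) * B * ((1 + ‖m‖) ^ k)⁻¹ := by
  have h₀ : ‖mFourierCoeff f m‖ ≤ B := by
    simpa using pow_mul_norm_mFourierCoeff_le (hf.of_le (by simp)) (hB 0 k.zero_le) m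
  have hk : ‖m‖ ^ k * ‖mFourierCoeff f m‖ ≤ B := pow_mul_norm_mFourierCoeff_le hf (hB k le_rfl) m
  have hpow : (1 + ‖m‖) ^ k ≤ 2 ^ k * (1 + ‖m‖ ^ k) := by
    refine (add_pow_le (zero_le_one (α := ℝ)) (norm_nonneg m) k).trans ?_
    rw [one_pow]
    gcongr
    exacts [one_le_two, Nat.sub_le k 1]
  rw [← div_eq_mul_inv, le_div_iff₀ (by positivity)]
  calc ‖mFourierCoeff f m‖ * (1 + ‖m‖) ^ k
      ≤ ‖mFourierCoeff f m‖ * (2 ^ k * (1 + ‖m‖ ^ k)) := by gcongr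
    _ = 2 ^ k * (‖mFourierCoeff f m‖ + ‖m‖ ^ k * ‖mFourierCoeff f m‖) := by ring
    _ ≤ 2 ^ k * (B + B) := by gcongr
    _ = 2 ^ (k + 1) * B := by ring

lemma exists_norm_iteratedFDeriv_le {E : Type*} [NormedAddCommGroup E] [NormedSpace ℝ E]
    {f : UnitAddTorus d → E} {k : ℕ} (hf : ContDiff ℝ k (f ∘ toTorus)) :
    ∃ B, ∀ x, ‖iteratedFDeriv ℝ k (f ∘ toTorus) x‖ ≤ B := by
  obtain ⟨B, hB⟩ := (isCompact_Icc (a := (0 : d → ℝ)) (b := 1)).exists_bound_of_continuousOn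
    (hf.continuous_iteratedFDeriv le_rfl).continuousOn
  refine ⟨B, fun x => ?_⟩
  let n : d → ℝ := fun i => -(⌊x i⌋ : ℝ)
  have hn : toTorus n = 0 := funext fun i =>
    (AddCircle.coe_eq_zero_iff (1 : ℝ)).2 ⟨-⌊x i⌋, by simp [n]⟩
  have hperiodic : (fun z => (f ∘ toTorus) (z + n)) = f ∘ toTorus :=
    funext fun z => by rw [Function.comp_apply, toTorus_add, hn, add_zero, Function.comp_apply]
  rw [← hperiodic, iteratedFDeriv_comp_add_right]
  exact hB _ ⟨fun i => by simpa [n] using Int.floor_le (x i),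
    fun i => neg_add_le_iff_le_add.2 (Int.lt_floor_add_one (x i)).le |> (add_comm _ _).trans_le⟩

lemma exists_forall_norm_iteratedFDeriv_le {E : Type*} [NormedAddCommGroup E] [NormedSpace ℝ E]
    {f : UnitAddTorus d → E} {k : ℕ} (hf : ContDiff ℝ k (f ∘ toTorus)) :
    ∃ B, ∀ j ≤ k, ∀ x, ‖iteratedFDeriv ℝ j (f ∘ toTorus) x‖ ≤ B := by
  choose! B hB using fun j (hj : j ≤ k) =>
    exists_norm_iteratedFDeriv_le (hf.of_le (by exact_mod_cast hj))
  refine ⟨∑ j ∈ Finset.range (k + 1), |B j|, fun j hj x => (hB j hj x).trans ?_⟩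
  exact (le_abs_self _).trans (Finset.single_le_sum (f := fun j => |B j|)
    (fun i _ => abs_nonneg _) (Finset.mem_range.2 (Nat.lt_succ_of_le hj)))

lemma norm_iteratedFDeriv_mFourier_le (m : d → ℤ) (j : ℕ) (x : d → ℝ) :
    ‖iteratedFDeriv ℝ j (mFourier m ∘ toTorus) x‖ ≤
      (2 * Real.pi * (Fintype.card d * ‖m‖)) ^ j := by
  let L : (d → ℝ) →L[ℝ] ℝ := ∑ i, (m i : ℝ) • ContinuousLinearMap.proj i
  let e : ℝ → ℂ := fun z => Complex.exp (2 * Real.pi * Complex.I * z)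
  have hL : ‖L‖ ≤ Fintype.card d * ‖m‖ := by
    refine L.opNorm_le_bound (by positivity) fun y => ?_
    calc ‖L y‖ = ‖∑ i, (m i : ℝ) * y i‖ := by simp [L]
      _ ≤ ∑ _i : d, ‖m‖ * ‖y‖ := norm_sum_le_of_le _ fun i _ => by
        rw [norm_mul]
        exact mul_le_mul (norm_le_pi_norm m i) (norm_le_pi_norm y i) (norm_nonneg _) (norm_nonneg _)
      _ = Fintype.card d * ‖m‖ * ‖y‖ := by simp [mul_assoc]
  have he : ∀ n z, iteratedDeriv n e z = (2 * Real.pi * Complex.I) ^ n * e z := fun n => by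
    induction n with
    | zero => simp
    | succ n ih =>
      intro z
      have hz : HasDerivAt (fun z : ℝ => 2 * Real.pi * Complex.I * (z : ℂ))
          (2 * Real.pi * Complex.I) z := by
        simpa using (Complex.ofRealCLM.hasDerivAt (x := z)).const_mul (2 * Real.pi * Complex.I)
      rw [iteratedDeriv_succ, funext ih, ((hz.cexp).const_mul _).deriv]
      ring
  have hcont : ContDiff ℝ j e := (contDiff_const.mul Complex.ofRealCLM.contDiff).cexp
  have hcomp : mFourier m ∘ toTorus = e ∘ L :=
    funext fun y => by simp [mFourier_toTorus, e, L]
  rw [hcomp, L.iteratedFDeriv_comp_right hcont x le_rfl]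
  calc _ ≤ ‖iteratedFDeriv ℝ j e (L x)‖ * ∏ _i : Fin j, ‖L‖ :=
        ContinuousMultilinearMap.norm_compContinuousLinearMap_le _ _
    _ = (2 * Real.pi * ‖L‖) ^ j := by
      have hnorm : ‖e (L x)‖ = 1 := by simp [e, Complex.norm_exp]
      rw [norm_iteratedFDeriv_eq_norm_iteratedDeriv, he, norm_mul, hnorm]
      simp [abs_of_pos Real.pi_pos, mul_pow]
    _ ≤ _ := by gcongr

end Decay

/-! ## Fourier series of test functions -/

-- The remainder is itself a series of smooth functions, namely the one over the complement of `s`.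
lemma norm_iteratedFDeriv_tsum_sub_sum_le {ι E F : Type*} [NormedAddCommGroup E] [NormedSpace ℝ E]
    [NormedAddCommGroup F] [NormedSpace ℝ F] [CompleteSpace F] {f : ι → E → F} {v : ι → ℝ} {k : ℕ}
    (hf : ∀ i, ContDiff ℝ k (f i)) (hv : Summable v)
    (hfv : ∀ j ≤ k, ∀ i x, ‖iteratedFDeriv ℝ j (f i) x‖ ≤ v i) (s : Finset ι) {j : ℕ} (hj : j ≤ k)
    (x : E) :
    ‖iteratedFDeriv ℝ j (fun y => ∑' i, f i y - ∑ i ∈ s, f i y) x‖ ≤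
      ∑' i : {i // i ∉ s}, v i := by
  have hcompl : (fun y => ∑' i, f i y - ∑ i ∈ s, f i y) = fun y => ∑' i : {i // i ∉ s}, f i y := by
    funext y
    have hy : Summable fun i => f i y :=
      .of_norm_bounded hv fun i => by simpa using hfv 0 k.zero_le i y
    exact sub_eq_of_eq_add' (hy.sum_add_tsum_subtype_compl s).symm
  rw [hcompl, iteratedFDeriv_tsum_apply (f := fun (i : {i // i ∉ s}) y => f i y) (N := k)
    (v := fun _ i => v i) (fun i => hf i) (fun _ _ => hv.subtype _)
    (fun l i y hl => hfv l (by exact_mod_cast hl) i y) (by exact_mod_cast hj) x]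
  exact tsum_of_norm_bounded (hv.subtype _).hasSum fun i => hfv j hj i x

lemma contDiff_lift (φ : TestFunction) (k : ℕ) : ContDiff ℝ k (lift φ) :=
  (show ContDiff ℝ (⊤ : ℕ∞) (lift φ) from φ.2).of_le (by exact_mod_cast le_top)

lemma hasSum_distr_apply (u : Distr) {ι : Type*} {ψ : ι → TestFunction} {φ : TestFunction}
    (hψ : ∀ k : ℕ, ∃ v : ι → ℝ, Summable v ∧
      ∀ j ≤ k, ∀ i x, ‖iteratedFDeriv ℝ j (lift (ψ i)) x‖ ≤ v i)
    (hφ : ∀ x, HasSum (fun i => (ψ i : C(T2, ℂ)) x) ((φ : C(T2, ℂ)) x)) :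
    HasSum (fun i => u.1 (ψ i)) (u.1 φ) := by
  obtain ⟨k, C, hu⟩ := u.2
  obtain ⟨v, hv, hbound⟩ := hψ k
  have hremainder : ∀ s : Finset ι,
      ‖u.1 (φ - ∑ i ∈ s, ψ i)‖ ≤ C * ∑' i : {i // i ∉ s}, v i := fun s => by
    refine hu _ _ fun j hj x => ?_
    have hlift : lift (φ - ∑ i ∈ s, ψ i : TestFunction) =
        fun y => ∑' i, lift (ψ i) y - ∑ i ∈ s, lift (ψ i) y := by
      funext y
      rw [(show HasSum (fun i => lift (ψ i) y) (lift φ y) from hφ (toTorus y)).tsum_eq]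
      simp [lift]
    rw [hlift]
    exact norm_iteratedFDeriv_tsum_sub_sum_le (fun i => contDiff_lift (ψ i) k) hv hbound s hj x
  have htail : Tendsto (fun s : Finset ι => C * ∑' i : {i // i ∉ s}, v i) atTop (𝓝 0) := by
    simpa using (tendsto_tsum_compl_atTop_zero v).const_mul C
  rw [HasSum, SummationFilter.unconditional_filter, tendsto_iff_norm_sub_tendsto_zero]
  refine squeeze_zero (fun _ => norm_nonneg _) (fun s => ?_) htail
  rw [norm_sub_rev, ← map_sum, ← map_sub]
  exact hremainder s

lemma summable_inv_one_add_norm : Summable fun m : Freq => ((1 + ‖m‖) ^ 3)⁻¹ := by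
  refine (EisensteinSeries.summable_one_div_norm_rpow (k := 3)
    (by norm_num)).of_norm_bounded_eventually ?_
  have hne : ∀ᶠ m : Freq in cofinite, m ≠ 0 := (Set.finite_singleton 0).compl_mem_cofinite
  filter_upwards [hne] with m hm
  have : 0 < ‖m‖ := norm_pos_iff.2 hm
  rw [Real.norm_of_nonneg (by positivity), Real.rpow_neg (norm_nonneg m),
    ← Nat.cast_ofNat (R := ℝ), Real.rpow_natCast]
  gcongr
  exact le_add_of_nonneg_left zero_le_one

lemma norm_iteratedFDeriv_char_le (m : Freq) {j k : ℕ} (hj : j ≤ k) (x : Fin 2 → ℝ) :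
    ‖iteratedFDeriv ℝ j (lift (char m)) x‖ ≤ (4 * Real.pi * (1 + ‖m‖)) ^ k := by
  have hpi := Real.pi_gt_three
  have hone : 1 ≤ 4 * Real.pi * (1 + ‖m‖) :=
    one_le_mul_of_one_le_of_one_le (by linarith) (by linarith [norm_nonneg m])
  refine ((norm_iteratedFDeriv_mFourier_le m j x).trans ?_).trans (pow_le_pow_right₀ hone hj)
  refine pow_le_pow_left₀ (by positivity) ?_ j
  rw [Fintype.card_fin]
  calc 2 * Real.pi * ((2 : ℕ) * ‖m‖) = 4 * Real.pi * ‖m‖ := by push_cast; ring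
    _ ≤ 4 * Real.pi * (1 + ‖m‖) := by gcongr; linarith

lemma norm_mul_mFourierCoeff_le {a : Freq → ℂ} {C : ℝ} {k : ℕ}
    (ha : ∀ m, ‖a m‖ ≤ C * (1 + ‖m‖) ^ k) {φ : TestFunction} {B : ℝ}
    (hB : ∀ j ≤ k + 3, ∀ x, ‖iteratedFDeriv ℝ j (lift φ) x‖ ≤ B) (m : Freq) :
    ‖a m * mFourierCoeff (φ : C(T2, ℂ)) (-m)‖ ≤
      C * (2 ^ (k + 4) * B) * ((1 + ‖m‖) ^ 3)⁻¹ := by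
  have hC : 0 ≤ C := by simpa using (norm_nonneg _).trans (ha 0)
  have hφ := norm_mFourierCoeff_le_inv_pow (contDiff_lift φ (k + 3)) hB (-m)
  rw [norm_neg] at hφ
  rw [norm_mul]
  calc ‖a m‖ * ‖mFourierCoeff (φ : C(T2, ℂ)) (-m)‖
      ≤ C * (1 + ‖m‖) ^ k * (2 ^ (k + 4) * B * ((1 + ‖m‖) ^ (k + 3))⁻¹) := by
        gcongr
        exact ha m
    _ = C * (2 ^ (k + 4) * B) * ((1 + ‖m‖) ^ 3)⁻¹ := by
        rw [pow_add (1 + ‖m‖)]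
        field_simp

lemma summable_mul_mFourierCoeff {a : Freq → ℂ} (ha : ∃ C, ∃ k : ℕ, ∀ m, ‖a m‖ ≤ C * (1 + ‖m‖) ^ k)
    (φ : TestFunction) : Summable fun m => a m * mFourierCoeff (φ : C(T2, ℂ)) (-m) := by
  obtain ⟨C, k, hak⟩ := ha
  obtain ⟨B, hB⟩ := exists_forall_norm_iteratedFDeriv_le (contDiff_lift φ (k + 3))
  exact .of_norm_bounded (summable_inv_one_add_norm.mul_left _) (norm_mul_mFourierCoeff_le hak hB)

lemma norm_tsum_mul_mFourierCoeff_le {a : Freq → ℂ} {C : ℝ} {k : ℕ}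
    (ha : ∀ m, ‖a m‖ ≤ C * (1 + ‖m‖) ^ k) {φ : TestFunction} {B : ℝ}
    (hB : ∀ j ≤ k + 3, ∀ x, ‖iteratedFDeriv ℝ j (lift φ) x‖ ≤ B) :
    ‖∑' m, a m * mFourierCoeff (φ : C(T2, ℂ)) (-m)‖ ≤
      C * (2 ^ (k + 4) * B) * ∑' m : Freq, ((1 + ‖m‖) ^ 3)⁻¹ := by
  rw [← tsum_mul_left]
  exact tsum_of_norm_bounded (summable_inv_one_add_norm.mul_left _).hasSum
    (norm_mul_mFourierCoeff_le ha hB)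

lemma hasSum_mFourierCoeff_mul (u : Distr) (φ : TestFunction) :
    HasSum (fun m => mFourierCoeff (φ : C(T2, ℂ)) m * u.1 (char m)) (u.1 φ) := by
  have hsum : Summable (mFourierCoeff (φ : C(T2, ℂ))) := by
    have := summable_mul_mFourierCoeff (a := fun _ => 1) ⟨1, 0, by simp⟩ φ
    simpa [Function.comp_def] using (Equiv.neg Freq).summable_iff.2 this
  have hseries := hasSum_distr_apply u (ψ := fun m => mFourierCoeff (φ : C(T2, ℂ)) m • char m)
    (φ := φ) (fun k => ?_) (hasSum_mFourier_series_apply_of_summable hsum)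
  · simpa using hseries
  obtain ⟨B, hB⟩ := exists_forall_norm_iteratedFDeriv_le (contDiff_lift φ (k + 3))
  have hterm (m : Freq) : (4 * Real.pi * (1 + ‖m‖)) ^ k * ‖mFourierCoeff (φ : C(T2, ℂ)) m‖ ≤
      (4 * Real.pi) ^ k * (2 ^ (k + 4) * B) * ((1 + ‖m‖) ^ 3)⁻¹ := by
    have hnorm (l : Freq) : ‖(((4 * Real.pi * (1 + ‖l‖)) ^ k : ℝ) : ℂ)‖ =
        (4 * Real.pi * (1 + ‖l‖)) ^ k := by
      rw [Complex.norm_real, Real.norm_of_nonneg (by positivity)]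
    simpa only [neg_neg, norm_neg, norm_mul, hnorm] using norm_mul_mFourierCoeff_le
      (a := fun l => ((4 * Real.pi * (1 + ‖l‖)) ^ k : ℝ))
      (fun l => ((hnorm l).trans (mul_pow _ _ k)).le) hB (-m)
  refine ⟨_, summable_inv_one_add_norm.mul_left ((4 * Real.pi) ^ k * (2 ^ (k + 4) * B)),
    fun j hj m x => ?_⟩
  have hsmul : ‖iteratedFDeriv ℝ j (lift (mFourierCoeff (φ : C(T2, ℂ)) m • char m :)) x‖ =
      ‖iteratedFDeriv ℝ j (lift (char m)) x‖ * ‖mFourierCoeff (φ : C(T2, ℂ)) m‖ := by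
    rw [Submodule.coe_smul, lift_smul,
      iteratedFDeriv_const_smul_apply (contDiff_lift (char m) j).contDiffAt, norm_smul, mul_comm]
  rw [hsmul]
  exact (mul_le_mul_of_nonneg_right (norm_iteratedFDeriv_char_le m hj x) (norm_nonneg _)).trans
    (hterm m)

lemma hasSum_fourierCoeff_mul (u : Distr) (φ : TestFunction) :
    HasSum (fun m => fourierCoeff u m * mFourierCoeff (φ : C(T2, ℂ)) (-m)) (u.1 φ) := by
  simpa only [Function.comp_def, Equiv.neg_apply, mul_comm, fourierCoeff] using!
    (Equiv.neg Freq).hasSum_iff.2 (hasSum_mFourierCoeff_mul u φ)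

/-- The distribution whose Fourier coefficients are a given sequence of polynomial growth. -/
def ofFourierCoeff (a : Freq → ℂ) (ha : ∃ C, ∃ k : ℕ, ∀ m, ‖a m‖ ≤ C * (1 + ‖m‖) ^ k) : Distr :=
  ⟨{ toFun φ := ∑' m, a m * mFourierCoeff (φ : C(T2, ℂ)) (-m)
     map_add' φ ψ := by
      rw [← (summable_mul_mFourierCoeff ha φ).tsum_add (summable_mul_mFourierCoeff ha ψ)]
      exact tsum_congr fun m => by rw [Submodule.coe_add, mFourierCoeff_add, mul_add]
     map_smul' c φ := by
      rw [RingHom.id_apply, smul_eq_mul, ← tsum_mul_left]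
      exact tsum_congr fun m => by rw [Submodule.coe_smul, mFourierCoeff_smul, mul_left_comm] },
   by
    obtain ⟨C, k, hak⟩ := ha
    refine ⟨k + 3, C * 2 ^ (k + 4) * ∑' m : Freq, ((1 + ‖m‖) ^ 3)⁻¹, fun φ B hB => ?_⟩
    exact (norm_tsum_mul_mFourierCoeff_le hak hB).trans_eq (by ring)⟩

lemma fourierCoeff_ofFourierCoeff (a : Freq → ℂ)
    (ha : ∃ C, ∃ k : ℕ, ∀ m, ‖a m‖ ≤ C * (1 + ‖m‖) ^ k) (m : Freq) :
    fourierCoeff (ofFourierCoeff a ha) m = a m := by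
  change ∑' l, a l * mFourierCoeff (mFourier (-m)) (-l) = a m
  have hne (l : Freq) (hl : l ≠ m) : a l * mFourierCoeff (mFourier (-m)) (-l) = 0 := by
    rw [mFourierCoeff_mFourier, if_neg fun h => hl (neg_injective h).symm, mul_zero]
  rw [tsum_eq_single m hne, mFourierCoeff_mFourier, if_pos rfl, mul_one]

/-! ## Sobolev spaces -/

lemma eigen_pos (m : Freq) : 0 < eigen m := one_pos.trans_le (one_le_eigen m)

lemma eigen_neg (m : Freq) : eigen (-m) = eigen m := by simp [eigen, freqSq]

lemma eigen_le (m : Freq) : eigen m ≤ 80 * (1 + ‖m‖) ^ 2 := by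
  have hcoord (i : Fin 2) : (m i : ℝ) ^ 2 ≤ ‖m‖ ^ 2 :=
    sq_le_sq.2 ((norm_le_pi_norm m i).trans (le_abs_self _))
  have hpi : Real.pi ^ 2 ≤ 10 := by nlinarith [Real.pi_lt_d2, Real.pi_pos]
  calc eigen m = 1 + 4 * Real.pi ^ 2 * ((m 0 : ℝ) ^ 2 + (m 1 : ℝ) ^ 2) := by simp [eigen, freqSq]
    _ ≤ 1 + 4 * 10 * (‖m‖ ^ 2 + ‖m‖ ^ 2) := by
        refine add_le_add_right (mul_le_mul ?_ (add_le_add (hcoord 0) (hcoord 1)) ?_ ?_) 1 <;>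
          [linarith; positivity; norm_num]
    _ ≤ 80 * (1 + ‖m‖) ^ 2 := by nlinarith [norm_nonneg m]

lemma eigen_rpow_le (s : ℝ) (m : Freq) :
    eigen m ^ s ≤ 80 ^ ⌈s⌉₊ * (1 + ‖m‖) ^ (2 * ⌈s⌉₊) := by
  rw [pow_mul, ← mul_pow]
  calc eigen m ^ s ≤ eigen m ^ (⌈s⌉₊ : ℝ) :=
        Real.rpow_le_rpow_of_exponent_le (one_le_eigen m) (Nat.le_ceil s)
    _ = eigen m ^ ⌈s⌉₊ := Real.rpow_natCast _ _
    _ ≤ _ := pow_le_pow_left₀ (eigen_pos m).le (eigen_le m) _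

/-- The Hilbert space `ℓ²(ℤ²)`. -/
abbrev Ell2 : Type := lp (fun _ : Freq => ℂ) 2

lemma hasSum_sq_norm_ell2 (b : Ell2) : HasSum (fun m => ‖b m‖ ^ 2) (‖b‖ ^ 2) := by
  simpa using lp.hasSum_norm (p := 2) (by norm_num) b

lemma norm_eigen_rpow_mul_le (s : ℝ) (b : Ell2) (m : Freq) :
    ‖((eigen m ^ s : ℝ) : ℂ) * b m‖ ≤ 80 ^ ⌈s⌉₊ * ‖b‖ * (1 + ‖m‖) ^ (2 * ⌈s⌉₊) := by
  rw [norm_mul, Complex.norm_real, Real.norm_of_nonneg (Real.rpow_nonneg (eigen_pos m).le s),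
    mul_right_comm]
  exact mul_le_mul (eigen_rpow_le s m) (lp.norm_apply_le_norm two_ne_zero b m) (norm_nonneg _)
    (by positivity)

lemma weightedCoeff_ofFourierCoeff (s : ℝ) (b : Ell2) :
    weightedCoeff s (ofFourierCoeff (fun m => ((eigen m ^ (-(s / 2)) : ℝ) : ℂ) * b m)
      ⟨_, _, norm_eigen_rpow_mul_le (-(s / 2)) b⟩) = b := by
  funext m
  rw [weightedCoeff, fourierCoeff_ofFourierCoeff, ← mul_assoc, ← Complex.ofReal_mul,
    ← Real.rpow_add (eigen_pos m), add_neg_cancel, Real.rpow_zero, Complex.ofReal_one, one_mul]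

/-- The element of `H^s` with Fourier coefficients `(1 + 4 π² |m|²)^{-s/2} b_m`, which inverts
`Sobolev.toEll2`. -/
def ofEll2 (s : ℝ) (b : Ell2) : Sobolev s :=
  ⟨ofFourierCoeff (fun m => ((eigen m ^ (-(s / 2)) : ℝ) : ℂ) * b m)
    ⟨_, _, norm_eigen_rpow_mul_le (-(s / 2)) b⟩, by
    change Memℓp (weightedCoeff s _) 2
    rw [weightedCoeff_ofFourierCoeff]
    exact b.2⟩

lemma toEll2_ofEll2 (s : ℝ) (b : Ell2) : Sobolev.toEll2 s (ofEll2 s b) = b :=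
  Subtype.ext (weightedCoeff_ofFourierCoeff s b)

lemma toEll2_apply {s : ℝ} (u : Sobolev s) (m : Freq) :
    Sobolev.toEll2 s u m = ((eigen m ^ (s / 2) : ℝ) : ℂ) * fourierCoeff u m := rfl

lemma fourierCoeff_eq_toEll2 {s : ℝ} (u : Sobolev s) (m : Freq) :
    fourierCoeff u m = ((eigen m ^ (-(s / 2)) : ℝ) : ℂ) * Sobolev.toEll2 s u m := by
  rw [toEll2_apply, ← mul_assoc, ← Complex.ofReal_mul, ← Real.rpow_add (eigen_pos m),
    neg_add_cancel, Real.rpow_zero, Complex.ofReal_one, one_mul]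

lemma norm_toEll2 {s : ℝ} (u : Sobolev s) : ‖Sobolev.toEll2 s u‖ = ‖u‖ := rfl

lemma norm_fourierCoeff_le {s : ℝ} (u : Sobolev s) (m : Freq) :
    ‖fourierCoeff u m‖ ≤
      80 ^ ⌈-(s / 2)⌉₊ * ‖u‖ * (1 + ‖m‖) ^ (2 * ⌈-(s / 2)⌉₊) := by
  rw [fourierCoeff_eq_toEll2, ← norm_toEll2]
  exact norm_eigen_rpow_mul_le _ _ m

lemma continuous_distr_apply (s : ℝ) (φ : TestFunction) :
    Continuous fun u : Sobolev s => u.1.1 φ := by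
  obtain ⟨B, hB⟩ :=
    exists_forall_norm_iteratedFDeriv_le (contDiff_lift φ (2 * ⌈-(s / 2)⌉₊ + 3))
  let eval : Sobolev s →+ ℂ := { toFun u := u.1.1 φ, map_zero' := rfl, map_add' _ _ := rfl }
  refine AddMonoidHomClass.continuous_of_bound eval (80 ^ ⌈-(s / 2)⌉₊ *
    (2 ^ (2 * ⌈-(s / 2)⌉₊ + 4) * B) * ∑' m : Freq, ((1 + ‖m‖) ^ 3)⁻¹) fun u => ?_
  change ‖u.1.1 φ‖ ≤ _
  rw [← (hasSum_fourierCoeff_mul u.1 φ).tsum_eq]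
  exact (norm_tsum_mul_mFourierCoeff_le (norm_fourierCoeff_le u) hB).trans_eq (by ring)

lemma isClosed_isNonneg (s : ℝ) : IsClosed {f : Sobolev s | IsNonneg f} := by
  simp only [IsNonneg, Set.ofPred_forall]
  exact isClosed_iInter fun φ => isClosed_iInter fun _ =>
    isClosed_le continuous_const (continuous_distr_apply s φ)

section Torus

variable {d : Type*} [Fintype d]

lemma hasSum_conj_mFourierCoeff_mul (f g : C(UnitAddTorus d, ℂ)) :
    HasSum (fun m => star (mFourierCoeff f m) * mFourierCoeff g m)
      (∫ x, star (f x) * g x ∂haarTorus d) := by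
  have hparseval := hasSum_prod_mFourierCoeff (f.toLp 2 (haarTorus d) ℂ) (g.toLp 2 (haarTorus d) ℂ)
  have hcoeff (w : C(UnitAddTorus d, ℂ)) (m : d → ℤ) :
      mFourierCoeff (w.toLp 2 (haarTorus d) ℂ) m = mFourierCoeff w m := mFourierCoeff_toLp w m
  simp only [hcoeff] at hparseval
  have hintegral : ∫ x, star (f x) * g x ∂haarTorus d =
      ∫ x, star (f.toLp 2 (haarTorus d) ℂ x) * g.toLp 2 (haarTorus d) ℂ x ∂haarTorus d := by
    refine integral_congr_ae ?_
    filter_upwards [f.coeFn_toLp (p := 2) (𝕜 := ℂ) (haarTorus d),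
      g.coeFn_toLp (p := 2) (𝕜 := ℂ) (haarTorus d)] with x hfx hgx
    rw [hfx, hgx]
  exact hintegral ▸ hparseval

lemma hasSum_sq_norm_mFourierCoeff (f : C(UnitAddTorus d, ℂ)) :
    HasSum (fun m => ‖mFourierCoeff f m‖ ^ 2) (∫ x, ‖f x‖ ^ 2 ∂haarTorus d) := by
  have hnorm (z : ℂ) : (star z * z).re = ‖z‖ ^ 2 := by
    rw [← starRingEnd_apply, Complex.conj_mul']
    exact_mod_cast Complex.ofReal_re _
  have hre := Complex.hasSum_re (hasSum_conj_mFourierCoeff_mul f f)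
  have hintegral : ∫ x, (star (f x) * f x).re ∂haarTorus d =
      (∫ x, star (f x) * f x ∂haarTorus d).re := integral_re (integrable_haarTorus (star f * f))
  simpa only [← hintegral, hnorm] using hre

lemma mFourierCoeff_star (f : C(UnitAddTorus d, ℂ)) (m : d → ℤ) :
    mFourierCoeff (star f : C(UnitAddTorus d, ℂ)) m = star (mFourierCoeff f (-m)) := by
  rw [mFourierCoeff_eq_integral_mul, mFourierCoeff_eq_integral_mul, ← starRingEnd_apply,
    ← integral_conj]
  simp only [map_mul, ← mFourier_neg, neg_neg]
  rfl

lemma hasSum_mFourierCoeff_mul_sub (f g : C(UnitAddTorus d, ℂ)) (m : d → ℤ) :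
    HasSum (fun l => mFourierCoeff f l * mFourierCoeff g (m - l))
      (mFourierCoeff (f * g : C(UnitAddTorus d, ℂ)) m) := by
  have hparseval := hasSum_conj_mFourierCoeff_mul (star f) (mFourier (-m) * g)
  simp only [mFourierCoeff_star, star_star, mFourierCoeff_mFourier_mul] at hparseval
  rw [← (Equiv.neg (d → ℤ)).hasSum_iff] at hparseval
  convert hparseval using 1
  · funext l
    simp [sub_eq_add_neg, add_comm]
  · rw [mFourierCoeff_eq_integral_mul]
    simp only [ContinuousMap.star_apply, star_star, ContinuousMap.mul_apply, mul_comm,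
      mul_left_comm]

end Torus

/-! ## Continuous functions in Sobolev spaces of negative order -/

instance Sobolev.instNormedSpace (s : ℝ) : NormedSpace ℂ (Sobolev s) :=
  NormedSpace.induced ℂ (Sobolev s) Ell2 (Sobolev.toEll2 s)

lemma fourierCoeff_ofContinuous (w : C(T2, ℂ)) (m : Freq) :
    fourierCoeff (ofContinuous w) m = mFourierCoeff w m :=
  (mFourierCoeff_eq_integral_mul w m).symm

lemma norm_weightedCoeff_ofContinuous_le {s : ℝ} (hs : s ≤ 0) (w : C(T2, ℂ)) (m : Freq) :
    ‖weightedCoeff s (ofContinuous w) m‖ ≤ ‖mFourierCoeff w m‖ := by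
  rw [weightedCoeff, fourierCoeff_ofContinuous, norm_mul, Complex.norm_real,
    Real.norm_of_nonneg (Real.rpow_nonneg (eigen_pos m).le _)]
  exact mul_le_of_le_one_left (norm_nonneg _)
    (Real.rpow_le_one_of_one_le_of_nonpos (one_le_eigen m) (by linarith))

lemma ofContinuous_mem_sobolev {s : ℝ} (hs : s ≤ 0) (w : C(T2, ℂ)) :
    ofContinuous w ∈ Sobolev s := by
  refine memℓp_gen <| (hasSum_sq_norm_mFourierCoeff w).summable.of_nonneg_of_le
    (fun m => by positivity) fun m => ?_
  simpa only [ENNReal.toReal_ofNat, Real.rpow_two] using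
    pow_le_pow_left₀ (norm_nonneg _) (norm_weightedCoeff_ofContinuous_le hs w m) 2

lemma norm_mk_ofContinuous_le {s : ℝ} (hs : s ≤ 0) (w : C(T2, ℂ)) :
    ‖(⟨ofContinuous w, ofContinuous_mem_sobolev hs w⟩ : Sobolev s)‖ ≤ ‖w‖ := by
  rw [← sq_le_sq₀ (norm_nonneg _) (norm_nonneg _)]
  have hnorm := hasSum_sq_norm_ell2
    (Sobolev.toEll2 s ⟨ofContinuous w, ofContinuous_mem_sobolev hs w⟩)
  rw [norm_toEll2] at hnorm
  calc ‖(⟨ofContinuous w, ofContinuous_mem_sobolev hs w⟩ : Sobolev s)‖ ^ 2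
      ≤ ∫ x, ‖w x‖ ^ 2 ∂torusMeasure :=
        hasSum_le (fun m => pow_le_pow_left₀ (norm_nonneg _)
          (norm_weightedCoeff_ofContinuous_le hs w m) 2) hnorm (hasSum_sq_norm_mFourierCoeff w)
    _ ≤ ∫ _ : T2, ‖w‖ ^ 2 ∂torusMeasure :=
        integral_mono_of_nonneg (.of_forall fun x => by positivity) (integrable_const _)
          (.of_forall fun x => pow_le_pow_left₀ (norm_nonneg _) (w.norm_coe_le_norm x) 2)
    _ = ‖w‖ ^ 2 := by simp

/-- The embedding of the continuous functions into `H^s`, `s ≤ 0`. -/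
def toSobolev {s : ℝ} (hs : s ≤ 0) : C(T2, ℂ) →L[ℂ] Sobolev s :=
  LinearMap.mkContinuous
    { toFun w := ⟨ofContinuous w, ofContinuous_mem_sobolev hs w⟩
      map_add' v w := by
        refine Subtype.ext <| Subtype.ext <| LinearMap.ext fun φ => ?_
        change ∫ x, (v x + w x) * (φ : C(T2, ℂ)) x ∂torusMeasure = _
        simp only [add_mul]
        exact integral_add (integrable_haarTorus (v * (φ : C(T2, ℂ))))
          (integrable_haarTorus (w * (φ : C(T2, ℂ))))
      map_smul' c w := by
        refine Subtype.ext <| Subtype.ext <| LinearMap.ext fun φ => ?_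
        change ∫ x, (c * w x) * (φ : C(T2, ℂ)) x ∂torusMeasure = _
        simp only [mul_assoc]
        exact integral_const_mul _ _ }
    1 fun w => (norm_mk_ofContinuous_le hs w).trans_eq (one_mul _).symm

lemma coe_toSobolev {s : ℝ} (hs : s ≤ 0) (w : C(T2, ℂ)) :
    (toSobolev hs w : Distr) = ofContinuous w := rfl

lemma toEll2_toSobolev_apply {s : ℝ} (hs : s ≤ 0) (w : C(T2, ℂ)) (m : Freq) :
    Sobolev.toEll2 s (toSobolev hs w) m = ((eigen m ^ (s / 2) : ℝ) : ℂ) * mFourierCoeff w m := by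
  rw [toEll2_apply, coe_toSobolev, fourierCoeff_ofContinuous]

lemma hasSum_norm_toSobolev_sq {s : ℝ} (hs : s ≤ 0) (w : C(T2, ℂ)) :
    HasSum (fun m => eigen m ^ s * ‖mFourierCoeff w m‖ ^ 2) (‖toSobolev hs w‖ ^ 2) := by
  rw [← norm_toEll2]
  convert hasSum_sq_norm_ell2 (Sobolev.toEll2 s (toSobolev hs w)) using 1
  funext m
  rw [toEll2_toSobolev_apply, norm_mul, Complex.norm_real,
    Real.norm_of_nonneg (Real.rpow_nonneg (eigen_pos m).le _), mul_pow,
    ← Real.rpow_mul_natCast (eigen_pos m).le, Nat.cast_ofNat, div_mul_cancel₀ _ two_ne_zero]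

lemma eigen_le_mul (m l : Freq) : eigen m ≤ 2 * eigen l * eigen (m + l) := by
  have hsq : (freqSq m : ℝ) ≤ 2 * freqSq (m + l) + 2 * freqSq l := by
    simp only [freqSq, Pi.add_apply]
    push_cast
    nlinarith [sq_nonneg ((m 0 : ℝ) + 2 * l 0), sq_nonneg ((m 1 : ℝ) + 2 * l 1)]
  have hnonneg (k : Freq) : (0 : ℝ) ≤ freqSq k := by unfold freqSq; push_cast; positivity
  have hpi : 0 < 4 * Real.pi ^ 2 := by positivity
  unfold eigen
  nlinarith [mul_le_mul_of_nonneg_left hsq hpi.le,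
    mul_nonneg (mul_nonneg hpi.le (hnonneg l)) (mul_nonneg hpi.le (hnonneg (m + l)))]

lemma eigen_add_rpow_le {s : ℝ} (hs : s ≤ 0) (m l : Freq) :
    eigen (m + l) ^ s ≤ (2 * eigen l) ^ (-s) * eigen m ^ s := by
  have hl := eigen_pos l
  calc eigen (m + l) ^ s = (2 * eigen l) ^ (-s) * (2 * eigen l * eigen (m + l)) ^ s := by
        rw [Real.mul_rpow (x := 2 * eigen l) (by positivity) (eigen_pos _).le, ← mul_assoc,
          ← Real.rpow_add (by positivity), neg_add_cancel, Real.rpow_zero, one_mul]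
    _ ≤ (2 * eigen l) ^ (-s) * eigen m ^ s := by
        exact mul_le_mul_of_nonneg_left
          (Real.rpow_le_rpow_of_nonpos (eigen_pos m) (eigen_le_mul m l) hs) (by positivity)

lemma norm_toSobolev_mFourier_mul_le {s : ℝ} (hs : s ≤ 0) (l : Freq) (w : C(T2, ℂ)) :
    ‖toSobolev hs (mFourier l * w)‖ ≤ (2 * eigen l) ^ (-s / 2) * ‖toSobolev hs w‖ := by
  have hl := eigen_pos l
  rw [← sq_le_sq₀ (norm_nonneg _) (by positivity), mul_pow, ← Real.rpow_mul_natCast (by positivity),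
    Nat.cast_ofNat, div_mul_cancel₀ _ two_ne_zero]
  have hshift := (Equiv.addRight l).hasSum_iff.2 (hasSum_norm_toSobolev_sq hs (mFourier l * w))
  refine hasSum_le (fun m => ?_) hshift ((hasSum_norm_toSobolev_sq hs w).mul_left _)
  rw [Function.comp_apply, Equiv.coe_addRight, mFourierCoeff_mFourier_mul, add_sub_cancel_right,
    ← mul_assoc]
  gcongr
  exact eigen_add_rpow_le hs m l

/-! ## Multiplication by exponentials -/

lemma hasSum_pow_div_factorial (K : ℝ) :
    HasSum (fun n : ℕ => K ^ n / n.factorial) (Real.exp K) :=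
  Real.exp_eq_exp_ℝ ▸ NormedSpace.expSeries_div_hasSum_exp K

lemma exp_apply {X : Type*} [TopologicalSpace X] [CompactSpace X] (g : C(X, ℂ)) (x : X) :
    NormedSpace.exp g x = Complex.exp (g x) := by
  rw [Complex.exp_eq_exp_ℂ]
  exact NormedSpace.map_exp (ContinuousMap.evalAlgHom ℂ ℂ x)
    (ContinuousEvalConst.continuous_eval_const x) g

section ExpMul

variable {A E : Type*} [NormedRing A] [NormedAlgebra ℂ A]
  [SeminormedAddCommGroup E] [NormedSpace ℂ E] (T : A →L[ℂ] E) {g : A} {K : ℝ}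

lemma norm_map_pow_mul_le (hK : 0 ≤ K) (hg : ∀ w, ‖T (g * w)‖ ≤ K * ‖T w‖) (n : ℕ) (w : A) :
    ‖T (g ^ n * w)‖ ≤ K ^ n * ‖T w‖ := by
  induction n with
  | zero => simp
  | succ n ih =>
    rw [pow_succ', mul_assoc, pow_succ', mul_assoc]
    exact (hg _).trans (mul_le_mul_of_nonneg_left ih hK)

lemma norm_inv_factorial_smul_map_pow_mul_le (hK : 0 ≤ K) (hg : ∀ w, ‖T (g * w)‖ ≤ K * ‖T w‖)
    (n : ℕ) (w : A) :
    ‖(n.factorial : ℂ)⁻¹ • T (g ^ n * w)‖ ≤ K ^ n / n.factorial * ‖T w‖ := by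
  rw [norm_smul, norm_inv, Complex.norm_natCast, div_mul_eq_mul_div, inv_mul_eq_div]
  gcongr
  exact norm_map_pow_mul_le T hK hg n w

variable [CompleteSpace A]

lemma hasSum_map_exp_mul (g w : A) :
    HasSum (fun n : ℕ => (n.factorial : ℂ)⁻¹ • T (g ^ n * w)) (T (NormedSpace.exp g * w)) := by
  let := NormedAlgebra.restrictScalars ℚ ℂ A
  simpa only [smul_mul_assoc, map_smul] using
    T.hasSum ((NormedSpace.exp_series_hasSum_exp' (𝕂 := ℂ) g).mul_right w)

lemma norm_map_exp_mul_le (hK : 0 ≤ K) (hg : ∀ w, ‖T (g * w)‖ ≤ K * ‖T w‖) (w : A) :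
    ‖T (NormedSpace.exp g * w)‖ ≤ Real.exp K * ‖T w‖ :=
  (hasSum_map_exp_mul T g w).norm_le_of_bounded ((hasSum_pow_div_factorial K).mul_right _)
    (norm_inv_factorial_smul_map_pow_mul_le T hK hg · w)

lemma norm_map_exp_sub_one_mul_le (hK : 0 ≤ K) (hg : ∀ w, ‖T (g * w)‖ ≤ K * ‖T w‖) (w : A) :
    ‖T ((NormedSpace.exp g - 1) * w)‖ ≤ (Real.exp K - 1) * ‖T w‖ := by
  have htail := (hasSum_nat_add_iff' 1).2 (hasSum_map_exp_mul T g w)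
  have htail_real := (hasSum_nat_add_iff' 1).2 (hasSum_pow_div_factorial K)
  simp only [Finset.range_one, Finset.sum_singleton, Nat.factorial_zero, Nat.cast_one, inv_one,
    pow_zero, one_mul, one_smul, div_one] at htail htail_real
  rw [sub_mul, one_mul, map_sub]
  exact htail.norm_le_of_bounded (htail_real.mul_right _)
    fun n => norm_inv_factorial_smul_map_pow_mul_le T hK hg (n + 1) w

end ExpMul

/-! ## Functions with nonnegative Fourier coefficients -/

section PosCone

/-- The subsemiring of the continuous functions on `𝕋ᵈ` with nonnegative Fourier coefficients. -/
def posCone (d : Type*) [Fintype d] : Subsemiring C(UnitAddTorus d, ℂ) where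
  carrier := {f | ∀ m, 0 ≤ mFourierCoeff f m}
  mul_mem' hf hg m :=
    (hasSum_mFourierCoeff_mul_sub _ _ m).nonneg fun l => mul_nonneg (hf l) (hg (m - l))
  one_mem' m := by
    rw [← mFourier_zero, mFourierCoeff_mFourier]
    split_ifs <;> simp
  add_mem' hf hg m := (add_nonneg (hf m) (hg m)).trans_eq (mFourierCoeff_add _ _ m).symm
  zero_mem' m := by simp [mFourierCoeff]

variable {d : Type*} [Fintype d]

lemma isClosed_posCone : IsClosed (posCone d : Set C(UnitAddTorus d, ℂ)) := by
  change IsClosed {f : C(UnitAddTorus d, ℂ) | ∀ m, 0 ≤ mFourierCoeff f m}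
  simp only [Set.ofPred_forall]
  exact isClosed_iInter fun m => isClosed_le continuous_const (mFourierCoeffCLM m).continuous

lemma smul_mem_posCone {r : ℝ} (hr : 0 ≤ r) {f : C(UnitAddTorus d, ℂ)} (hf : f ∈ posCone d) :
    (r : ℂ) • f ∈ posCone d := fun m =>
  (mul_nonneg (by exact_mod_cast hr) (hf m)).trans_eq (mFourierCoeff_smul _ f m).symm

lemma smul_mFourier_mem_posCone {r : ℝ} (hr : 0 ≤ r) (m : d → ℤ) :
    (r : ℂ) • mFourier m ∈ posCone d :=
  smul_mem_posCone hr fun l => by rw [mFourierCoeff_mFourier]; split_ifs <;> simp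

lemma hasSum_mem_posCone {ι : Type*} {f : ι → C(UnitAddTorus d, ℂ)} {g : C(UnitAddTorus d, ℂ)}
    (h : HasSum f g) (hf : ∀ i, f i ∈ posCone d) : g ∈ posCone d :=
  isClosed_posCone.mem_of_tendsto h (.of_forall fun _ => sum_mem fun i _ => hf i)

lemma inv_factorial_smul_pow_mem_posCone {f : C(UnitAddTorus d, ℂ)} (hf : f ∈ posCone d) (n : ℕ) :
    (n.factorial : ℂ)⁻¹ • f ^ n ∈ posCone d := by
  simpa using smul_mem_posCone (r := (n.factorial : ℝ)⁻¹) (by positivity) (pow_mem hf n)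

lemma exp_mem_posCone {f : C(UnitAddTorus d, ℂ)} (hf : f ∈ posCone d) :
    NormedSpace.exp f ∈ posCone d :=
  hasSum_mem_posCone (NormedSpace.exp_series_hasSum_exp' (𝕂 := ℂ) f)
    (inv_factorial_smul_pow_mem_posCone hf)

lemma exp_sub_one_mem_posCone {f : C(UnitAddTorus d, ℂ)} (hf : f ∈ posCone d) :
    NormedSpace.exp f - 1 ∈ posCone d := by
  have htail := (hasSum_nat_add_iff' 1).2 (NormedSpace.exp_series_hasSum_exp' (𝕂 := ℂ) f)
  simp only [Finset.range_one, Finset.sum_singleton, Nat.factorial_zero, Nat.cast_one, inv_one,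
    pow_zero, one_smul] at htail
  exact hasSum_mem_posCone htail fun n => inv_factorial_smul_pow_mem_posCone hf (n + 1)

lemma mFourierCoeff_exp_mono {f g : C(UnitAddTorus d, ℂ)} (hf : f ∈ posCone d)
    (hfg : g - f ∈ posCone d) (m : d → ℤ) :
    mFourierCoeff ⇑(NormedSpace.exp f) m ≤ mFourierCoeff ⇑(NormedSpace.exp g) m := by
  rw [← sub_nonneg, ← mFourierCoeff_sub]
  have hfactor : NormedSpace.exp g - NormedSpace.exp f =
      NormedSpace.exp f * (NormedSpace.exp (g - f) - 1) := by
    rw [mul_sub, mul_one, ← NormedSpace.exp_add, add_sub_cancel]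
  exact hfactor ▸ mul_mem (exp_mem_posCone hf) (exp_sub_one_mem_posCone hfg) m

lemma mFourierCoeff_exp_sub_one_le {f g : C(UnitAddTorus d, ℂ)} (hf : f ∈ posCone d)
    (hg : g ∈ posCone d) (m : d → ℤ) :
    mFourierCoeff ⇑(NormedSpace.exp g - 1) m ≤
      mFourierCoeff ⇑(NormedSpace.exp (f + g) - NormedSpace.exp f) m := by
  rw [← sub_nonneg, ← mFourierCoeff_sub]
  have hfactor : NormedSpace.exp (f + g) - NormedSpace.exp f - (NormedSpace.exp g - 1) =
      (NormedSpace.exp f - 1) * (NormedSpace.exp g - 1) := by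
    rw [NormedSpace.exp_add]; ring
  exact hfactor ▸ mul_mem (exp_sub_one_mem_posCone hf) (exp_sub_one_mem_posCone hg) m

end PosCone

/-! ## The heat kernel -/

/-- The heat kernel `∑_n exp(-4 π² n² t) e_n(x)` on the circle. -/
def circleHeat (t : ℝ) (x : UnitAddCircle) : ℂ :=
  ∑' n : ℤ, ((Real.exp (-(4 * Real.pi ^ 2 * (n : ℝ) ^ 2 * t)) : ℝ) : ℂ) * fourier n x

lemma circleHeat_term_eq_jacobiTheta₂_term (t x : ℝ) (n : ℤ) :
    ((Real.exp (-(4 * Real.pi ^ 2 * (n : ℝ) ^ 2 * t)) : ℝ) : ℂ) *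
      fourier n (x : UnitAddCircle) = jacobiTheta₂_term n x (4 * Real.pi * t * Complex.I) := by
  rw [fourier_coe_apply, jacobiTheta₂_term, Complex.ofReal_exp, ← Complex.exp_add]
  congr 1
  push_cast
  linear_combination (-(4 * (Real.pi : ℂ) ^ 2 * n ^ 2 * t)) * Complex.I_sq

lemma circleHeat_coe (t x : ℝ) :
    circleHeat t x = jacobiTheta₂ x (4 * Real.pi * t * Complex.I) :=
  tsum_congr fun n => circleHeat_term_eq_jacobiTheta₂_term t x n

lemma norm_circleHeat_term (t : ℝ) (n : ℤ) (x : UnitAddCircle) :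
    ‖((Real.exp (-(4 * Real.pi ^ 2 * (n : ℝ) ^ 2 * t)) : ℝ) : ℂ) * fourier n x‖ =
      Real.exp (-(4 * Real.pi ^ 2 * (n : ℝ) ^ 2 * t)) := by
  rw [norm_mul, Complex.norm_real, Real.norm_of_nonneg (Real.exp_pos _).le, fourier_apply,
    Circle.norm_coe, mul_one]

lemma four_pi_mul_I (t : ℝ) :
    (4 * Real.pi * t * Complex.I : ℂ) = ((4 * Real.pi * t : ℝ) : ℂ) * Complex.I := by
  push_cast; ring

lemma summable_exp_neg_sq {t : ℝ} (ht : 0 < t) :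
    Summable fun n : ℤ => Real.exp (-(4 * Real.pi ^ 2 * (n : ℝ) ^ 2 * t)) := by
  have hτ : 0 < (4 * Real.pi * t * Complex.I : ℂ).im := by
    rw [four_pi_mul_I, Complex.im_ofReal_mul, Complex.I_im]
    positivity
  refine (hasSum_jacobiTheta₂_term (0 : ℝ) hτ).summable.norm.congr fun n => ?_
  rw [← circleHeat_term_eq_jacobiTheta₂_term, norm_circleHeat_term]

/-- `∑_{n ≠ 0} 16 / n²`; the term `n = 0` vanishes by the convention `1 / 0 = 0`. -/
def heatConst : ℝ := ∑' n : ℤ, 16 * (1 / (n : ℝ) ^ 2)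

lemma heatConst_nonneg : 0 ≤ heatConst := tsum_nonneg fun n => by positivity

/-- The Gaussian upper bound of the heat kernel on the circle at distance `r` from the origin. -/
def heatBound (t r : ℝ) : ℝ :=
  (4 * Real.pi * t) ^ (-(1 / 2) : ℝ) * Real.exp (-(r ^ 2 / (4 * t))) + heatConst * t ^ (1 / 2 : ℝ)

lemma heatBound_abs (t r : ℝ) : heatBound t |r| = heatBound t r := by
  simp [heatBound]

lemma heatBound_nonneg {t : ℝ} (ht : 0 ≤ t) (r : ℝ) : 0 ≤ heatBound t r := by
  have := heatConst_nonneg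
  have := Real.pi_pos
  unfold heatBound
  positivity

lemma norm_exp_mul_jacobiTheta₂_term {t : ℝ} (ht : t ≠ 0) (x : ℝ) (n : ℤ) :
    ‖Complex.exp (-Real.pi * Complex.I * (x : ℂ) ^ 2 / (4 * Real.pi * t * Complex.I)) *
      jacobiTheta₂_term n (x / (4 * Real.pi * t * Complex.I))
        (-1 / (4 * Real.pi * t * Complex.I))‖ = Real.exp (-((n - x) ^ 2 / (4 * t))) := by
  have hpi : (Real.pi : ℂ) ≠ 0 := by exact_mod_cast Real.pi_ne_zero
  have ht' : (t : ℂ) ≠ 0 := by exact_mod_cast ht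
  rw [jacobiTheta₂_term, ← Complex.exp_add,
    show -Real.pi * Complex.I * (x : ℂ) ^ 2 / (4 * Real.pi * t * Complex.I) +
      (2 * Real.pi * Complex.I * n * (x / (4 * Real.pi * t * Complex.I)) +
        Real.pi * Complex.I * n ^ 2 * (-1 / (4 * Real.pi * t * Complex.I))) =
      ((-((n - x) ^ 2 / (4 * t)) : ℝ) : ℂ) by
        push_cast
        field_simp
        ring, Complex.norm_exp_ofReal]

lemma exp_neg_sq_div_le {t x : ℝ} (ht : 0 < t) (hx : |x| ≤ 1 / 2) {n : ℤ} (hn : n ≠ 0) :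
    Real.exp (-((n - x) ^ 2 / (4 * t))) ≤ 16 * (1 / (n : ℝ) ^ 2) * t := by
  have hn1 : (1 : ℝ) ≤ |(n : ℝ)| := by exact_mod_cast Int.one_le_abs hn
  have hn2 : 0 < (n : ℝ) ^ 2 := by positivity
  have hdist : |(n : ℝ)| / 2 ≤ |n - x| := by linarith [abs_sub_abs_le_abs_sub (n : ℝ) x]
  have hsq : (n : ℝ) ^ 2 / 4 ≤ (n - x) ^ 2 := by
    rw [← sq_abs (n : ℝ), ← sq_abs ((n : ℝ) - x)]
    nlinarith
  have hpos : 0 < (n - x) ^ 2 / (4 * t) := div_pos (by linarith) (by positivity)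
  have hexp := Real.add_one_le_exp (((n : ℝ) - x) ^ 2 / (4 * t))
  calc Real.exp (-((n - x) ^ 2 / (4 * t))) = (Real.exp ((n - x) ^ 2 / (4 * t)))⁻¹ :=
        Real.exp_neg _
    _ ≤ ((n - x) ^ 2 / (4 * t))⁻¹ := inv_anti₀ hpos (by linarith)
    _ ≤ ((n : ℝ) ^ 2 / 4 / (4 * t))⁻¹ := inv_anti₀ (by positivity) (by gcongr)
    _ = 16 * (1 / (n : ℝ) ^ 2) * t := by field_simp; norm_num

lemma norm_exp_mul_jacobiTheta₂_le {t x : ℝ} (ht : 0 < t) (hx : |x| ≤ 1 / 2) :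
    ‖Complex.exp (-Real.pi * Complex.I * (x : ℂ) ^ 2 / (4 * Real.pi * t * Complex.I)) *
      jacobiTheta₂ (x / (4 * Real.pi * t * Complex.I)) (-1 / (4 * Real.pi * t * Complex.I))‖ ≤
      Real.exp (-(x ^ 2 / (4 * t))) + heatConst * t := by
  have hτ : 0 < (-1 / (4 * Real.pi * t * Complex.I) : ℂ).im := by
    rw [show (-1 / (4 * Real.pi * t * Complex.I) : ℂ) =
        ((1 / (4 * Real.pi * t) : ℝ) : ℂ) * Complex.I by
      rw [four_pi_mul_I, ← div_div, Complex.div_I]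
      push_cast
      ring, Complex.im_ofReal_mul, Complex.I_im]
    positivity
  have hsummable : Summable fun n : ℤ => 16 * (1 / (n : ℝ) ^ 2) :=
    (Real.summable_one_div_int_pow.2 one_lt_two).mul_left _
  refine ((hasSum_jacobiTheta₂_term _ hτ).mul_left _).norm_le_of_bounded
    ((hasSum_ite_eq (0 : ℤ) _).add (hsummable.hasSum.mul_right t)) fun n => ?_
  rw [norm_exp_mul_jacobiTheta₂_term ht.ne']
  split_ifs with hn
  · simp [hn]
  · simpa using exp_neg_sq_div_le ht hx hn

lemma norm_one_div_cpow_half {t : ℝ} (ht : 0 ≤ t) :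
    ‖(1 : ℂ) / (-Complex.I * (4 * Real.pi * t * Complex.I)) ^ (1 / 2 : ℂ)‖ =
      (4 * Real.pi * t) ^ (-(1 / 2) : ℝ) := by
  have hpos : 0 ≤ 4 * Real.pi * t := by positivity
  rw [show -Complex.I * (4 * Real.pi * t * Complex.I) = ((4 * Real.pi * t : ℝ) : ℂ) by
      push_cast
      linear_combination (-(4 * Real.pi * t : ℂ)) * Complex.I_sq,
    show (1 / 2 : ℂ) = ((1 / 2 : ℝ) : ℂ) by norm_num, ← Complex.ofReal_cpow hpos, norm_div,
    norm_one, Complex.norm_real, Real.norm_of_nonneg (by positivity), Real.rpow_neg hpos, one_div]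

lemma norm_circleHeat_coe_le {t x : ℝ} (ht : 0 < t) (hx : |x| ≤ 1 / 2) :
    ‖circleHeat t x‖ ≤ heatBound t x := by
  have hprefactor : (4 * Real.pi * t) ^ (-(1 / 2) : ℝ) * t ≤ t ^ (1 / 2 : ℝ) := by
    have hscale : (4 * Real.pi * t) ^ (-(1 / 2) : ℝ) ≤ t ^ (-(1 / 2) : ℝ) :=
      Real.rpow_le_rpow_of_nonpos ht (by nlinarith [Real.pi_gt_three]) (by norm_num)
    calc (4 * Real.pi * t) ^ (-(1 / 2) : ℝ) * t ≤ t ^ (-(1 / 2) : ℝ) * t := by gcongr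
      _ = t ^ (1 / 2 : ℝ) := by rw [← Real.rpow_add_one ht.ne']; norm_num
  -- For small `t` only the terms of the dual theta series are small.
  rw [circleHeat_coe, jacobiTheta₂_functional_equation, mul_assoc, norm_mul,
    norm_one_div_cpow_half ht.le, heatBound]
  calc _ ≤ (4 * Real.pi * t) ^ (-(1 / 2) : ℝ) *
          (Real.exp (-(x ^ 2 / (4 * t))) + heatConst * t) :=
        mul_le_mul_of_nonneg_left (norm_exp_mul_jacobiTheta₂_le ht hx) (by positivity)
    _ = (4 * Real.pi * t) ^ (-(1 / 2) : ℝ) * Real.exp (-(x ^ 2 / (4 * t))) +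
          heatConst * ((4 * Real.pi * t) ^ (-(1 / 2) : ℝ) * t) := by ring
    _ ≤ _ := by grw [hprefactor]; exact heatConst_nonneg

lemma exists_coe_eq_abs_eq_norm (x : UnitAddCircle) :
    ∃ y : ℝ, (y : UnitAddCircle) = x ∧ |y| = ‖x‖ ∧ |y| ≤ 1 / 2 := by
  obtain ⟨z, rfl⟩ := QuotientAddGroup.mk_surjective x
  refine ⟨z - round z, ?_, (UnitAddCircle.norm_eq (x := z)).symm, abs_sub_round z⟩
  have hround : (((round z : ℤ) : ℝ) : UnitAddCircle) = 0 :=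
    (AddCircle.coe_eq_zero_iff (p := (1 : ℝ))).2 ⟨round z, by simp⟩
  rw [AddCircle.coe_sub, hround, sub_zero]

lemma norm_circleHeat_le {t : ℝ} (ht : 0 < t) (x : UnitAddCircle) :
    ‖circleHeat t x‖ ≤ heatBound t ‖x‖ := by
  obtain ⟨y, rfl, hnorm, hy⟩ := exists_coe_eq_abs_eq_norm x
  rw [← hnorm, heatBound_abs]
  exact norm_circleHeat_coe_le ht hy

lemma exp_neg_mul_eigen (t : ℝ) (m : Freq) : Real.exp (-(t * eigen m)) = Real.exp (-t) *
    (Real.exp (-(4 * Real.pi ^ 2 * (m 0 : ℝ) ^ 2 * t)) *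
      Real.exp (-(4 * Real.pi ^ 2 * (m 1 : ℝ) ^ 2 * t))) := by
  rw [← Real.exp_add, ← Real.exp_add]
  congr 1
  simp only [eigen, freqSq]
  push_cast
  ring

lemma summable_exp_neg_mul_eigen {t : ℝ} (ht : 0 < t) :
    Summable fun m : Freq => Real.exp (-(t * eigen m)) := by
  simp only [exp_neg_mul_eigen]
  refine Summable.mul_left _ ?_
  rw [← (finTwoArrowEquiv ℤ).symm.summable_iff]
  exact (summable_exp_neg_sq ht).mul_of_nonneg (summable_exp_neg_sq ht)
    (fun _ => (Real.exp_pos _).le) (fun _ => (Real.exp_pos _).le)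

section FourierSeries

variable {d : Type*} [Fintype d]

/-- The continuous function on `𝕋ᵈ` with given Fourier coefficients; junk unless they are
summable. -/
def fourierSeries (c : (d → ℤ) → ℝ) : C(UnitAddTorus d, ℂ) := ∑' m, (c m : ℂ) • mFourier m

lemma hasSum_fourierSeries {c : (d → ℤ) → ℝ} (hc : Summable c) :
    HasSum (fun m => (c m : ℂ) • mFourier m) (fourierSeries c) := by
  refine Summable.hasSum (.of_norm_bounded hc.norm fun m => ?_)
  rw [norm_smul, mFourier_norm, mul_one, Complex.norm_real]

lemma hasSum_fourierSeries_apply {c : (d → ℤ) → ℝ} (hc : Summable c) (x : UnitAddTorus d) :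
    HasSum (fun m => (c m : ℂ) * mFourier m x) (fourierSeries c x) := by
  simpa using (ContinuousMap.evalCLM ℂ x).hasSum (hasSum_fourierSeries hc)

lemma fourierSeries_mem_posCone {c : (d → ℤ) → ℝ} (hc : Summable c) (h : ∀ m, 0 ≤ c m) :
    fourierSeries c ∈ posCone d :=
  hasSum_mem_posCone (hasSum_fourierSeries hc) fun m => smul_mFourier_mem_posCone (h m) m

end FourierSeries

/-- The kernel `∑_m exp(-t (1 + 4 π² |m|²)) e_m` of `exp(-t (1 - Δ))`. -/
def heat (t : ℝ) : C(T2, ℂ) := fourierSeries fun m => Real.exp (-(t * eigen m))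

lemma heat_apply {t : ℝ} (ht : 0 < t) (x : T2) :
    heat t x = (Real.exp (-t) : ℝ) * (circleHeat t (x 0) * circleHeat t (x 1)) := by
  have hsummable (i : Fin 2) := (summable_exp_neg_sq ht).congr fun n =>
    (norm_circleHeat_term t n (x i)).symm
  rw [heat, ← (hasSum_fourierSeries_apply (summable_exp_neg_mul_eigen ht) x).tsum_eq, circleHeat,
    circleHeat, tsum_mul_tsum_of_summable_norm (hsummable 0) (hsummable 1), ← tsum_mul_left,
    ← (finTwoArrowEquiv ℤ).tsum_eq]
  refine tsum_congr fun m => ?_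
  have hfst : (finTwoArrowEquiv ℤ m).1 = m 0 := rfl
  have hsnd : (finTwoArrowEquiv ℤ m).2 = m 1 := rfl
  simp only [hfst, hsnd, exp_neg_mul_eigen, mFourier, ContinuousMap.coe_mk,
    Fin.prod_univ_two]
  push_cast
  ring

lemma norm_heat_le {t : ℝ} (ht : 0 < t) (x : T2) :
    ‖heat t x‖ ≤ Real.exp (-t) * (heatBound t ‖x 0‖ * heatBound t ‖x 1‖) := by
  rw [heat_apply ht, norm_mul, norm_mul, Complex.norm_real, Real.norm_of_nonneg (Real.exp_pos _).le]
  gcongr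
  · exact heatBound_nonneg ht.le _
  · exact norm_circleHeat_le ht _
  · exact norm_circleHeat_le ht _

/-! ## Integrals of the heat kernel bound -/

lemma haarAddCircle_eq_map : (AddCircle.haarAddCircle : Measure UnitAddCircle) =
    (volume.restrict (Set.Ioc (-(1 / 2) : ℝ) (1 / 2))).map (fun x : ℝ => (x : UnitAddCircle)) := by
  have hmap := (AddCircle.measurePreserving_mk (1 : ℝ) (-(1 / 2))).map_eq
  rw [AddCircle.volume_eq_smul_haarAddCircle, ENNReal.ofReal_one, one_smul] at hmap
  rw [← hmap]
  norm_num

lemma norm_coe_circle {x : ℝ} (hx : x ∈ Set.Ioc (-(1 / 2) : ℝ) (1 / 2)) :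
    ‖(x : UnitAddCircle)‖ = |x| :=
  (AddCircle.norm_coe_eq_abs_iff (1 : ℝ) one_ne_zero).2
    (by rw [abs_one, abs_le]; exact ⟨hx.1.le, hx.2⟩)

lemma map_norm_haarAddCircle : (AddCircle.haarAddCircle : Measure UnitAddCircle).map norm =
    (volume.restrict (Set.Ioc (-(1 / 2) : ℝ) (1 / 2))).map abs := by
  rw [haarAddCircle_eq_map, Measure.map_map measurable_norm AddCircle.measurable_mk']
  refine Measure.map_congr ?_
  filter_upwards [ae_restrict_mem measurableSet_Ioc] with x hx using norm_coe_circle hx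

lemma integrable_comp_norm_circle_iff {f : ℝ → ℝ} (hf : Measurable f) :
    Integrable (fun y : UnitAddCircle => f ‖y‖) AddCircle.haarAddCircle ↔
      IntegrableOn (fun x : ℝ => f |x|) (Set.Ioc (-(1 / 2)) (1 / 2)) := by
  have hcircle := integrable_map_measure (μ := (AddCircle.haarAddCircle : Measure UnitAddCircle))
    hf.aestronglyMeasurable measurable_norm.aemeasurable
  rw [map_norm_haarAddCircle, integrable_map_measure hf.aestronglyMeasurable
    measurable_abs.aemeasurable] at hcircle
  exact hcircle.symm

lemma integral_comp_norm_circle {f : ℝ → ℝ} (hf : Measurable f) :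
    ∫ y : UnitAddCircle, f ‖y‖ ∂AddCircle.haarAddCircle =
      ∫ x in Set.Ioc (-(1 / 2) : ℝ) (1 / 2), f |x| := by
  rw [← integral_map measurable_norm.aemeasurable hf.aestronglyMeasurable, map_norm_haarAddCircle,
    integral_map measurable_abs.aemeasurable hf.aestronglyMeasurable]

lemma ae_circle_ne_zero : ∀ᵐ y : UnitAddCircle ∂AddCircle.haarAddCircle, y ≠ 0 := by
  have hnorm : ∀ᵐ r ∂(AddCircle.haarAddCircle : Measure UnitAddCircle).map norm, r ≠ 0 := by
    rw [map_norm_haarAddCircle]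
    refine (ae_map_iff (p := (· ≠ 0)) measurable_abs.aemeasurable
      (measurableSet_singleton (0 : ℝ)).compl).2 ?_
    filter_upwards [ae_restrict_of_ae (Measure.ae_ne volume (0 : ℝ))] with x hx
      using abs_ne_zero.2 hx
  filter_upwards [ae_of_ae_map measurable_norm.aemeasurable hnorm] with y hy
    using norm_ne_zero_iff.1 hy

lemma ae_torus_ne_zero (d : Type*) [Fintype d] : ∀ᵐ x ∂haarTorus d, ∀ i, x i ≠ 0 :=
  ae_all_iff.2 fun i => (Measure.quasiMeasurePreserving_eval
    (fun _ : d => AddCircle.haarAddCircle) i).ae ae_circle_ne_zero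

/-- The Gaussian `exp(-b x²)` with the singular weight `x⁻ᵃ`. -/
def powGauss (a b x : ℝ) : ℝ := x ^ (-a) * Real.exp (-b * x ^ (2 : ℝ))

lemma powGauss_nonneg {x : ℝ} (hx : 0 ≤ x) (a b : ℝ) : 0 ≤ powGauss a b x := by
  unfold powGauss
  positivity

lemma integral_powGauss {a b : ℝ} (ha : a < 1) (hb : 0 < b) :
    ∫ x : ℝ, powGauss a b |x| = b ^ (-((1 - a) / 2)) * Real.Gamma ((1 - a) / 2) := by
  rw [integral_comp_abs]
  unfold powGauss
  rw [integral_rpow_mul_exp_neg_mul_rpow (by norm_num) (by linarith) hb,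
    show -(-a + 1) / 2 = -((1 - a) / 2) by ring, show (-a + 1) / 2 = (1 - a) / 2 by ring]
  ring

lemma integrable_powGauss {a b : ℝ} (ha : a < 1) (hb : 0 < b) :
    Integrable fun x : ℝ => powGauss a b |x| := by
  refine Integrable.of_integral_ne_zero ?_
  rw [integral_powGauss ha hb]
  have := Real.Gamma_pos_of_pos (s := (1 - a) / 2) (by linarith)
  positivity

/-- A majorant on `[0, 1 / 2]` of `heatBound t r * r ^ (-a)` that is integrable on the whole
line. -/
def heatMajorant (a t r : ℝ) : ℝ :=
  (4 * Real.pi * t) ^ (-(1 / 2) : ℝ) * powGauss a (1 / (4 * t)) r +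
    heatConst * t ^ (1 / 2 : ℝ) * Real.exp 1 * powGauss a 1 r

lemma heatBound_mul_rpow_le {a t r : ℝ} (ht : 0 ≤ t) (hr : 0 ≤ r) (hr1 : r ≤ 1) :
    heatBound t r * r ^ (-a) ≤ heatMajorant a t r := by
  have hC := heatConst_nonneg
  have hone : 1 ≤ Real.exp 1 * Real.exp (-1 * r ^ (2 : ℝ)) := by
    rw [← Real.exp_add, Real.rpow_two]
    exact Real.one_le_exp (by nlinarith)
  have hexp : Real.exp (-(r ^ 2 / (4 * t))) = Real.exp (-(1 / (4 * t)) * r ^ (2 : ℝ)) := by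
    rw [Real.rpow_two]
    ring_nf
  unfold heatBound heatMajorant powGauss
  rw [hexp, add_mul]
  refine add_le_add (le_of_eq (by ring)) ?_
  calc heatConst * t ^ (1 / 2 : ℝ) * r ^ (-a)
      ≤ (heatConst * t ^ (1 / 2 : ℝ) * r ^ (-a)) * (Real.exp 1 * Real.exp (-1 * r ^ (2 : ℝ))) :=
        le_mul_of_one_le_right (by positivity) hone
    _ = _ := by ring

lemma heatMajorant_nonneg {t r : ℝ} (ht : 0 ≤ t) (hr : 0 ≤ r) (a : ℝ) :
    0 ≤ heatMajorant a t r := by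
  have hC := heatConst_nonneg
  have h₁ := powGauss_nonneg hr a (1 / (4 * t))
  have h₂ := powGauss_nonneg hr a 1
  unfold heatMajorant
  positivity

lemma integrable_heatMajorant {a t : ℝ} (ha : a < 1) (ht : 0 < t) :
    Integrable fun x : ℝ => heatMajorant a t |x| :=
  ((integrable_powGauss ha (by positivity)).const_mul _).add
    ((integrable_powGauss ha one_pos).const_mul _)

lemma integral_heatMajorant {a t : ℝ} (ha : a < 1) (ht : 0 < t) :
    ∫ x, heatMajorant a t |x| = Real.Gamma ((1 - a) / 2) *
      ((4 * Real.pi * t) ^ (-(1 / 2) : ℝ) * (1 / (4 * t)) ^ (-((1 - a) / 2)) +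
        heatConst * Real.exp 1 * t ^ (1 / 2 : ℝ)) := by
  unfold heatMajorant
  rw [integral_add ((integrable_powGauss ha (by positivity)).const_mul _)
    ((integrable_powGauss ha one_pos).const_mul _), integral_const_mul, integral_const_mul,
    integral_powGauss ha (by positivity), integral_powGauss ha one_pos, Real.one_rpow]
  ring

lemma rpow_mul_rpow_inv_le {a t : ℝ} (ha : 0 ≤ a) (ht : 0 < t) :
    (4 * Real.pi * t) ^ (-(1 / 2) : ℝ) * (1 / (4 * t)) ^ (-((1 - a) / 2)) ≤ t ^ (-(a / 2)) := by
  have hpi : (4 * Real.pi * t) ^ (-(1 / 2) : ℝ) ≤ (4 * t) ^ (-(1 / 2) : ℝ) :=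
    Real.rpow_le_rpow_of_nonpos (by positivity) (by nlinarith [Real.pi_gt_three]) (by norm_num)
  rw [one_div (4 * t), Real.inv_rpow (by positivity), ← Real.rpow_neg (by positivity), neg_neg]
  calc (4 * Real.pi * t) ^ (-(1 / 2) : ℝ) * (4 * t) ^ ((1 - a) / 2)
      ≤ (4 * t) ^ (-(1 / 2) : ℝ) * (4 * t) ^ ((1 - a) / 2) := by gcongr
    _ = (4 * t) ^ (-(a / 2)) := by rw [← Real.rpow_add (by positivity)]; ring_nf
    _ ≤ t ^ (-(a / 2)) := Real.rpow_le_rpow_of_nonpos ht (by linarith) (by linarith)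

lemma measurable_heatBound_mul_rpow (a t : ℝ) :
    Measurable fun r : ℝ => heatBound t r * r ^ (-a) := by
  unfold heatBound
  fun_prop

lemma norm_heatBound_mul_rpow_le {a t x : ℝ} (ht : 0 ≤ t)
    (hx : x ∈ Set.Ioc (-(1 / 2) : ℝ) (1 / 2)) :
    ‖heatBound t |x| * |x| ^ (-a)‖ ≤ heatMajorant a t |x| := by
  rw [Real.norm_of_nonneg (mul_nonneg (heatBound_nonneg ht _) (by positivity))]
  exact heatBound_mul_rpow_le ht (abs_nonneg x)
    (abs_le.2 ⟨by linarith [hx.1], by linarith [hx.2]⟩)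

lemma integrable_circle_heatBound {a t : ℝ} (ha : a < 1) (ht : 0 < t) :
    Integrable (fun y : UnitAddCircle => heatBound t ‖y‖ * ‖y‖ ^ (-a)) AddCircle.haarAddCircle := by
  have hmeas := measurable_heatBound_mul_rpow a t
  refine (integrable_comp_norm_circle_iff hmeas).2 ((integrable_heatMajorant ha ht).restrict.mono'
    (hmeas.comp measurable_abs).aestronglyMeasurable ?_)
  filter_upwards [ae_restrict_mem measurableSet_Ioc] with x hx
    using norm_heatBound_mul_rpow_le ht.le hx

lemma exists_integral_circle_heatBound_le {a : ℝ} (ha0 : 0 ≤ a) (ha : a < 1) :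
    ∃ K, ∀ t, 0 < t →
      ∫ y : UnitAddCircle, heatBound t ‖y‖ * ‖y‖ ^ (-a) ∂AddCircle.haarAddCircle ≤
        K * (t ^ (-(a / 2)) + t ^ (1 / 2 : ℝ)) := by
  have hC := heatConst_nonneg
  have hΓ := Real.Gamma_pos_of_pos (s := (1 - a) / 2) (by linarith)
  refine ⟨Real.Gamma ((1 - a) / 2) * (1 + heatConst * Real.exp 1), fun t ht => ?_⟩
  have hmeas := measurable_heatBound_mul_rpow a t
  calc ∫ y : UnitAddCircle, heatBound t ‖y‖ * ‖y‖ ^ (-a) ∂AddCircle.haarAddCircle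
      = ∫ x in Set.Ioc (-(1 / 2) : ℝ) (1 / 2), heatBound t |x| * |x| ^ (-a) :=
        integral_comp_norm_circle hmeas
    _ ≤ ∫ x in Set.Ioc (-(1 / 2) : ℝ) (1 / 2), heatMajorant a t |x| :=
        setIntegral_mono_on ((integrable_comp_norm_circle_iff hmeas).1
          (integrable_circle_heatBound ha ht)) (integrable_heatMajorant ha ht).integrableOn
          measurableSet_Ioc fun x hx =>
            (Real.le_norm_self _).trans (norm_heatBound_mul_rpow_le ht.le hx)
    _ ≤ ∫ x, heatMajorant a t |x| :=
        setIntegral_le_integral (integrable_heatMajorant ha ht)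
          (.of_forall fun x => heatMajorant_nonneg ht.le (abs_nonneg x) a)
    _ ≤ Real.Gamma ((1 - a) / 2) *
          (t ^ (-(a / 2)) + heatConst * Real.exp 1 * t ^ (1 / 2 : ℝ)) := by
        rw [integral_heatMajorant ha ht]
        gcongr
        exact rpow_mul_rpow_inv_le ha0 ht
    _ ≤ _ := by
        rw [mul_assoc (Real.Gamma _) (1 + _)]
        refine mul_le_mul_of_nonneg_left ?_ hΓ.le
        have : 0 ≤ t ^ (1 / 2 : ℝ) + heatConst * Real.exp 1 * t ^ (-(a / 2)) := by positivity
        linarith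

/-- A majorant of `s⁻¹ exp(-r² / (2 s))` for `s ≤ 1` which vanishes for `s > 1`. -/
def truncInv (r s : ℝ) : ℝ :=
  (Set.Ioc 0 (r ^ 2)).indicator (fun _ => 2 / r ^ 2) s + (Set.Ioc (r ^ 2) 1).indicator (·⁻¹) s

lemma inv_mul_exp_le_of_le {r s : ℝ} (hr : 0 < r) (hs : 0 < s) :
    s⁻¹ * Real.exp (-(r ^ 2 / (2 * s))) ≤ 2 / r ^ 2 := by
  have hexp : Real.exp (-(r ^ 2 / (2 * s))) ≤ 2 * s / r ^ 2 := by
    rw [Real.exp_neg, ← inv_div (r ^ 2) (2 * s)]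
    exact inv_anti₀ (by positivity) (by linarith [Real.add_one_le_exp (r ^ 2 / (2 * s))])
  calc _ ≤ s⁻¹ * (2 * s / r ^ 2) := by gcongr
    _ = 2 / r ^ 2 := by field_simp

lemma inv_mul_exp_le_truncInv {r s : ℝ} (hr : 0 < r) (hs : 0 < s) (hs1 : s ≤ 1) :
    s⁻¹ * Real.exp (-(r ^ 2 / (2 * s))) ≤ truncInv r s := by
  unfold truncInv
  by_cases hsr : s ≤ r ^ 2
  · rw [Set.indicator_of_mem (Set.mem_Ioc.2 ⟨hs, hsr⟩),
      Set.indicator_of_notMem fun h => absurd h.1 hsr.not_gt, add_zero]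
    exact inv_mul_exp_le_of_le hr hs
  · rw [Set.indicator_of_notMem fun h => hsr h.2,
      Set.indicator_of_mem (Set.mem_Ioc.2 ⟨not_le.1 hsr, hs1⟩), zero_add]
    exact mul_le_of_le_one_right (by positivity) (Real.exp_le_one_iff.2 (by
      have : 0 ≤ r ^ 2 / (2 * s) := by positivity
      linarith))

lemma truncInv_nonneg {r s : ℝ} : 0 ≤ truncInv r s :=
  add_nonneg (Set.indicator_nonneg (fun _ _ => by positivity) _)
    (Set.indicator_nonneg (fun _ h => inv_nonneg.2 ((sq_nonneg r).trans h.1.le)) _)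

lemma exp_mul_inv_mul_exp_le {r s : ℝ} (hr : 0 < r) (hs : 0 < s) :
    Real.exp (-s) * (s⁻¹ * Real.exp (-(r ^ 2 / (2 * s)))) ≤ truncInv r s + Real.exp (-s) := by
  have hgauss : Real.exp (-(r ^ 2 / (2 * s))) ≤ 1 := Real.exp_le_one_iff.2 (by
    have : 0 ≤ r ^ 2 / (2 * s) := by positivity
    linarith)
  have hexp : 0 < Real.exp (-s) := Real.exp_pos _
  by_cases hs1 : s ≤ 1
  · calc _ ≤ s⁻¹ * Real.exp (-(r ^ 2 / (2 * s))) :=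
          mul_le_of_le_one_left (by positivity) (Real.exp_le_one_iff.2 (by linarith))
      _ ≤ truncInv r s + Real.exp (-s) := by linarith [inv_mul_exp_le_truncInv hr hs hs1]
  · calc _ ≤ Real.exp (-s) := mul_le_of_le_one_right hexp.le
          (mul_le_one₀ (inv_le_one_of_one_le₀ (not_le.1 hs1).le) (by positivity) hgauss)
      _ ≤ truncInv r s + Real.exp (-s) := le_add_of_nonneg_left truncInv_nonneg

/-- A majorant of `exp(-s) heatBound(s, r)²`, whose integral in `s` grows logarithmically as
`r → 0`. -/
def logMajorant (r s : ℝ) : ℝ :=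
  (4 * Real.pi)⁻¹ * truncInv r s +
    ((1 + 2 * heatConst) * Real.exp (-s) + heatConst ^ 2 * (Real.exp (-s) * s ^ ((2 : ℝ) - 1)))

lemma heatBound_sq_le {r s : ℝ} (hs : 0 < s) : heatBound s r ^ 2 ≤
    (4 * Real.pi)⁻¹ * (s⁻¹ * Real.exp (-(r ^ 2 / (2 * s)))) + 2 * heatConst +
      heatConst ^ 2 * s := by
  have hC := heatConst_nonneg
  have hA : ((4 * Real.pi * s) ^ (-(1 / 2) : ℝ)) ^ 2 = (4 * Real.pi)⁻¹ * s⁻¹ := by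
    rw [← Real.rpow_mul_natCast (by positivity), ← mul_inv]
    norm_num [Real.rpow_neg_one]
  have hE : Real.exp (-(r ^ 2 / (4 * s))) ^ 2 = Real.exp (-(r ^ 2 / (2 * s))) := by
    rw [← Real.exp_nat_mul]
    congr 1
    push_cast
    field_simp
    ring
  have hR : (s ^ (1 / 2 : ℝ)) ^ 2 = s := by
    rw [← Real.rpow_mul_natCast hs.le]
    norm_num
  have hE1 : Real.exp (-(r ^ 2 / (4 * s))) ≤ 1 := Real.exp_le_one_iff.2 (by
    have : 0 ≤ r ^ 2 / (4 * s) := by positivity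
    linarith)
  have hAR : (4 * Real.pi * s) ^ (-(1 / 2) : ℝ) * s ^ (1 / 2 : ℝ) ≤ 1 := by
    refine (sq_le_one_iff₀ (by positivity)).1 ?_
    rw [mul_pow, hA, hR, mul_assoc, inv_mul_cancel₀ hs.ne', mul_one]
    exact inv_le_one_of_one_le₀ (by linarith [Real.pi_gt_three])
  have hcross : 2 * heatConst * ((4 * Real.pi * s) ^ (-(1 / 2) : ℝ) * s ^ (1 / 2 : ℝ) *
      Real.exp (-(r ^ 2 / (4 * s)))) ≤ 2 * heatConst :=
    mul_le_of_le_one_right (by positivity) (mul_le_one₀ hAR (by positivity) hE1)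
  unfold heatBound
  rw [add_sq, mul_pow, mul_pow, hA, hE, hR]
  linarith

lemma exp_mul_heatBound_sq_le {r s : ℝ} (hr : 0 < r) (hs : 0 < s) :
    Real.exp (-s) * heatBound s r ^ 2 ≤ logMajorant r s := by
  have hpi : (4 * Real.pi)⁻¹ ≤ 1 := inv_le_one_of_one_le₀ (by linarith [Real.pi_gt_three])
  calc Real.exp (-s) * heatBound s r ^ 2
      ≤ Real.exp (-s) * ((4 * Real.pi)⁻¹ * (s⁻¹ * Real.exp (-(r ^ 2 / (2 * s)))) +
          2 * heatConst + heatConst ^ 2 * s) := by gcongr; exact heatBound_sq_le hs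
    _ = (4 * Real.pi)⁻¹ * (Real.exp (-s) * (s⁻¹ * Real.exp (-(r ^ 2 / (2 * s))))) +
          (2 * heatConst * Real.exp (-s) + heatConst ^ 2 * (Real.exp (-s) * s)) := by ring
    _ ≤ (4 * Real.pi)⁻¹ * (truncInv r s + Real.exp (-s)) +
          (2 * heatConst * Real.exp (-s) + heatConst ^ 2 * (Real.exp (-s) * s)) := by
        gcongr
        exact exp_mul_inv_mul_exp_le hr hs
    _ ≤ logMajorant r s := by
        have hs1 : s ^ ((2 : ℝ) - 1) = s := by norm_num
        rw [logMajorant, hs1]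
        linarith [mul_le_of_le_one_left (Real.exp_pos (-s)).le hpi]

lemma integrableOn_inv_Ioc {a b : ℝ} (ha : 0 < a) :
    IntegrableOn (fun s : ℝ => s⁻¹) (Set.Ioc a b) :=
  ((continuousOn_inv₀.mono fun _ hx => (ha.trans_le hx.1).ne').integrableOn_Icc).mono_set
    Set.Ioc_subset_Icc_self

lemma integrable_truncInv {r : ℝ} (hr : r ≠ 0) : Integrable (truncInv r) :=
  ((integrableOn_const (by simp)).integrable_indicator measurableSet_Ioc).add
    ((integrableOn_inv_Ioc (by positivity)).integrable_indicator measurableSet_Ioc)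

lemma integral_truncInv {r : ℝ} (hr : 0 < r) (hr1 : r ≤ 1) :
    ∫ s in Set.Ioi 0, truncInv r s = 2 - 2 * Real.log r := by
  have hr2 : 0 < r ^ 2 := by positivity
  have hr21 : r ^ 2 ≤ 1 := pow_le_one₀ hr.le hr1
  have hIoc : Set.Ioc 0 (r ^ 2) ⊆ Set.Ioi 0 := fun _ h => h.1
  have hIoc' : Set.Ioc (r ^ 2) 1 ⊆ Set.Ioi 0 := fun _ h => hr2.trans h.1
  have hinv : IntegrableOn (fun s : ℝ => s⁻¹) (Set.Ioc (r ^ 2) 1) := integrableOn_inv_Ioc hr2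
  have hconst : IntegrableOn (fun _ : ℝ => 2 / r ^ 2) (Set.Ioc 0 (r ^ 2)) :=
    integrableOn_const (by simp)
  unfold truncInv
  rw [integral_add (hconst.integrable_indicator measurableSet_Ioc).integrableOn.integrable
      (hinv.integrable_indicator measurableSet_Ioc).integrableOn.integrable,
    setIntegral_indicator measurableSet_Ioc, setIntegral_indicator measurableSet_Ioc,
    Set.inter_eq_self_of_subset_right hIoc, Set.inter_eq_self_of_subset_right hIoc',
    setIntegral_const, ← intervalIntegral.integral_of_le hr21, integral_inv_of_pos hr2 one_pos,
    one_div, Real.log_inv, Real.log_pow, Real.volume_real_Ioc_of_le hr2.le, sub_zero,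
    smul_eq_mul, mul_div_cancel₀ _ hr2.ne']
  push_cast
  ring

lemma integrableOn_logMajorant {r : ℝ} (hr : r ≠ 0) :
    IntegrableOn (logMajorant r) (Set.Ioi 0) :=
  ((integrable_truncInv hr).integrableOn.const_mul _).add
    (((integrableOn_exp_neg_Ioi 0).const_mul _).add
      ((Real.GammaIntegral_convergent two_pos).const_mul _))

lemma integral_logMajorant {r : ℝ} (hr : 0 < r) (hr1 : r ≤ 1) :
    ∫ s in Set.Ioi 0, logMajorant r s =
      (4 * Real.pi)⁻¹ * (2 - 2 * Real.log r) + (1 + 2 * heatConst + heatConst ^ 2) := by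
  have hexp := integrableOn_exp_neg_Ioi 0
  have hΓ := Real.GammaIntegral_convergent two_pos
  have hlin : ∫ s in Set.Ioi 0, Real.exp (-s) * s ^ ((2 : ℝ) - 1) = 1 := by
    rw [← Real.Gamma_eq_integral two_pos, Real.Gamma_two]
  have htail : Integrable (fun s => (1 + 2 * heatConst) * Real.exp (-s) +
      heatConst ^ 2 * (Real.exp (-s) * s ^ ((2 : ℝ) - 1))) (volume.restrict (Set.Ioi 0)) :=
    (hexp.const_mul _).add (hΓ.const_mul _)
  unfold logMajorant
  rw [integral_add ((integrable_truncInv hr.ne').integrableOn.const_mul _) htail,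
    integral_add (hexp.const_mul _) (hΓ.const_mul _), integral_const_mul, integral_const_mul,
    integral_const_mul, integral_truncInv hr hr1, integral_exp_neg_Ioi_zero, hlin, mul_one, mul_one]

/-! ## The summability bound for the covariance of the chaos -/

section FourierSeries

variable {d : Type*} [Fintype d] {c : (d → ℤ) → ℝ}

lemma mFourierCoeff_fourierSeries (hc : Summable c) (m : d → ℤ) :
    mFourierCoeff (fourierSeries c) m = c m := by
  have hsum := (mFourierCoeffCLM m).hasSum (hasSum_fourierSeries hc)
  simp only [mFourierCoeffCLM_apply, mFourierCoeff_smul, mFourierCoeff_mFourier, mul_ite, mul_one,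
    mul_zero] at hsum
  rw [hsum.unique (hasSum_single m fun l hl => if_neg hl), if_pos rfl]

lemma hasSum_mul_mFourierCoeff (hc : Summable c) (f : C(UnitAddTorus d, ℂ)) :
    HasSum (fun m => c m * mFourierCoeff f (-m))
      (mFourierCoeff (fourierSeries c * f : C(UnitAddTorus d, ℂ)) 0) := by
  have hsum := (mFourierCoeffCLM 0).hasSum ((hasSum_fourierSeries hc).mul_right f)
  simpa only [mFourierCoeffCLM_apply, Function.comp_def, smul_mul_assoc, mFourierCoeff_smul,
    mFourierCoeff_mFourier_mul, zero_sub] using hsum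

end FourierSeries

lemma sum_exp_mul_mFourierCoeff_le {t : ℝ} (ht : 0 < t) {f : C(T2, ℂ)} (hf : f ∈ posCone (Fin 2))
    (B : Finset Freq) : ∑ m ∈ B, Real.exp (-(t * eigen m)) * (mFourierCoeff f m).re ≤
      (mFourierCoeff (heat t * f : C(T2, ℂ)) 0).re := by
  have hsum := Complex.hasSum_re (hasSum_mul_mFourierCoeff (summable_exp_neg_mul_eigen ht) f)
  rw [← (Equiv.neg Freq).hasSum_iff] at hsum
  simp only [Function.comp_def, Equiv.neg_apply, neg_neg, eigen_neg, Complex.re_ofReal_mul]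
    at hsum
  exact sum_le_hasSum B (fun m _ => mul_nonneg (Real.exp_pos _).le (Complex.le_def.1 (hf m)).1) hsum

/-- The truncated Green function `½ ∑_{m ∈ F} e_m / (1 + 4 π² |m|²)`, as a function of the
difference of its arguments. -/
def greenPoly (F : Finset Freq) : C(T2, ℂ) :=
  ∑ m ∈ F, ((1 / (2 * eigen m) : ℝ) : ℂ) • mFourier m

lemma greenPoly_mem_posCone (F : Finset Freq) : greenPoly F ∈ posCone (Fin 2) :=
  sum_mem fun m _ => smul_mFourier_mem_posCone (by have := eigen_pos m; positivity) m

lemma mFourierCoeff_greenPoly [DecidableEq Freq] (F : Finset Freq) (m : Freq) :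
    mFourierCoeff (greenPoly F) m = if m ∈ F then ((1 / (2 * eigen m) : ℝ) : ℂ) else 0 := by
  rw [← mFourierCoeffCLM_apply, greenPoly, map_sum]
  simp only [map_smul, mFourierCoeffCLM_apply, mFourierCoeff_mFourier, smul_eq_mul, mul_ite,
    mul_one, mul_zero, Finset.sum_ite_eq']

/-- The Green function `½ ∑_m e_m / (1 + 4 π² |m|²)` regularized by the heat semigroup at
time `ε`. -/
def greenReg (ε : ℝ) : C(T2, ℂ) :=
  fourierSeries fun m => Real.exp (-(ε * eigen m)) / (2 * eigen m)

lemma exp_div_eigen_nonneg (ε : ℝ) (m : Freq) : 0 ≤ Real.exp (-(ε * eigen m)) / (2 * eigen m) := by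
  have := eigen_pos m
  positivity

lemma summable_greenReg {ε : ℝ} (hε : 0 < ε) :
    Summable fun m => Real.exp (-(ε * eigen m)) / (2 * eigen m) :=
  (summable_exp_neg_mul_eigen hε).of_nonneg_of_le (exp_div_eigen_nonneg ε) fun m =>
    div_le_self (Real.exp_pos _).le (by linarith [one_le_eigen m])

lemma greenReg_mem_posCone {ε : ℝ} (hε : 0 < ε) : greenReg ε ∈ posCone (Fin 2) :=
  fourierSeries_mem_posCone (summable_greenReg hε) (exp_div_eigen_nonneg ε)

lemma greenReg_sub_greenPoly_mem_posCone {ε b c : ℝ} (hε : 0 < ε) (hc : 0 ≤ c) {F : Finset Freq}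
    (h : ∀ m ∈ F, b ≤ c * Real.exp (-(ε * eigen m))) :
    (c : ℂ) • greenReg ε - (b : ℂ) • greenPoly F ∈ posCone (Fin 2) := by
  classical
  intro m
  have hm := eigen_pos m
  rw [mFourierCoeff_sub, mFourierCoeff_smul, mFourierCoeff_smul, mFourierCoeff_greenPoly, greenReg,
    mFourierCoeff_fourierSeries (summable_greenReg hε)]
  split_ifs with hmF
  · have hcoeff : 0 ≤ (c * Real.exp (-(ε * eigen m)) - b) / (2 * eigen m) :=
      div_nonneg (sub_nonneg.2 (h m hmF)) (by positivity)
    calc (0 : ℂ) ≤ (((c * Real.exp (-(ε * eigen m)) - b) / (2 * eigen m) : ℝ) : ℂ) := by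
          exact_mod_cast hcoeff
      _ = _ := by push_cast; ring
  · rw [mul_zero, sub_zero]
    exact mul_nonneg (by exact_mod_cast hc) (by exact_mod_cast exp_div_eigen_nonneg ε m)

lemma integrableOn_exp_neg_mul_Ioi {c : ℝ} (hc : 0 < c) (ε : ℝ) :
    IntegrableOn (fun s => Real.exp (-(s * c))) (Set.Ioi ε) := by
  simpa only [neg_mul, mul_comm c] using integrableOn_exp_mul_Ioi (neg_neg_of_pos hc) ε

lemma integral_exp_neg_mul_Ioi {c : ℝ} (hc : 0 < c) (ε : ℝ) :
    ∫ s in Set.Ioi ε, Real.exp (-(s * c)) = Real.exp (-(ε * c)) / c := by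
  simpa only [neg_mul, mul_comm c, neg_div_neg_eq]
    using integral_exp_mul_Ioi (neg_neg_of_pos hc) ε

lemma greenReg_apply {ε : ℝ} (hε : 0 < ε) (x : T2) :
    greenReg ε x = ∫ s in Set.Ioi ε, (1 / 2 : ℂ) * heat s x := by
  let term (m : Freq) (s : ℝ) : ℂ :=
    (1 / 2 : ℂ) * (((Real.exp (-(s * eigen m)) : ℝ) : ℂ) * mFourier m x)
  have hnorm (m : Freq) (s : ℝ) : ‖term m s‖ = 1 / 2 * Real.exp (-(s * eigen m)) := by
    simp only [term, norm_mul, norm_mFourier_apply, Complex.norm_real,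
      Real.norm_of_nonneg (Real.exp_pos _).le]
    norm_num
  have hintegrable (m : Freq) : Integrable (term m) (volume.restrict (Set.Ioi ε)) :=
    (((integrableOn_exp_neg_mul_Ioi (eigen_pos m) ε).ofReal (𝕜 := ℂ)).mul_const _).const_mul _
  have hintegral (m : Freq) : ∫ s in Set.Ioi ε, term m s =
      ((Real.exp (-(ε * eigen m)) / (2 * eigen m) : ℝ) : ℂ) * mFourier m x := by
    rw [integral_const_mul, integral_mul_const, integral_complex_ofReal,
      integral_exp_neg_mul_Ioi (eigen_pos m)]
    push_cast
    ring
  have hsummable : Summable fun m => ∫ s in Set.Ioi ε, ‖term m s‖ := by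
    refine (summable_greenReg hε).congr fun m => ?_
    simp only [hnorm]
    rw [integral_const_mul, integral_exp_neg_mul_Ioi (eigen_pos m)]
    ring
  have hsum := hasSum_integral_of_summable_integral_norm hintegrable hsummable
  simp only [hintegral] at hsum
  rw [greenReg, (hasSum_fourierSeries_apply (summable_greenReg hε) x).unique hsum]
  exact setIntegral_congr_fun measurableSet_Ioi fun s hs => ((hasSum_fourierSeries_apply
    (summable_exp_neg_mul_eigen (hε.trans hs)) x).mul_left _).tsum_eq

/-- The constant in the logarithmic bound of the Green function. -/
def greenConst : ℝ := (4 * Real.pi)⁻¹ + (1 + 2 * heatConst + heatConst ^ 2) / 2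

lemma norm_circle_le_one (x : UnitAddCircle) : ‖x‖ ≤ 1 := by
  obtain ⟨y, -, hnorm, hy⟩ := exists_coe_eq_abs_eq_norm x
  linarith

lemma norm_half_mul_heat_le {s : ℝ} (hs : 0 < s) {x : T2} (hx : ∀ i, x i ≠ 0) :
    ‖(1 / 2 : ℂ) * heat s x‖ ≤ 1 / 4 * (logMajorant ‖x 0‖ s + logMajorant ‖x 1‖ s) := by
  have hlog (i : Fin 2) := exp_mul_heatBound_sq_le (norm_pos_iff.2 (hx i)) hs
  have hAMGM : Real.exp (-s) * (heatBound s ‖x 0‖ * heatBound s ‖x 1‖) ≤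
      1 / 2 * (Real.exp (-s) * heatBound s ‖x 0‖ ^ 2 +
        Real.exp (-s) * heatBound s ‖x 1‖ ^ 2) := by
    nlinarith [mul_nonneg (Real.exp_pos (-s)).le
      (sq_nonneg (heatBound s ‖x 0‖ - heatBound s ‖x 1‖))]
  rw [norm_mul, show ‖(1 / 2 : ℂ)‖ = 1 / 2 by norm_num]
  linarith [norm_heat_le hs x, hlog 0, hlog 1]

lemma norm_greenReg_le {ε : ℝ} (hε : 0 < ε) {x : T2} (hx : ∀ i, x i ≠ 0) :
    ‖greenReg ε x‖ ≤
      greenConst - (8 * Real.pi)⁻¹ * (Real.log ‖x 0‖ + Real.log ‖x 1‖) := by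
  have hpos (i : Fin 2) : 0 < ‖x i‖ := norm_pos_iff.2 (hx i)
  have hlog (i : Fin 2) := integrableOn_logMajorant (hpos i).ne'
  have hmajorant : IntegrableOn (fun s => 1 / 4 * (logMajorant ‖x 0‖ s + logMajorant ‖x 1‖ s))
      (Set.Ioi 0) := ((hlog 0).add (hlog 1)).const_mul _
  have hsubset := Set.Ioi_subset_Ioi hε.le
  rw [greenReg_apply hε]
  calc ‖∫ s in Set.Ioi ε, (1 / 2 : ℂ) * heat s x‖
      ≤ ∫ s in Set.Ioi ε, 1 / 4 * (logMajorant ‖x 0‖ s + logMajorant ‖x 1‖ s) := by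
        refine norm_integral_le_of_norm_le (hmajorant.mono_set hsubset) ?_
        filter_upwards [ae_restrict_mem measurableSet_Ioi] with s hs
          using norm_half_mul_heat_le (hε.trans hs) hx
    _ ≤ ∫ s in Set.Ioi 0, 1 / 4 * (logMajorant ‖x 0‖ s + logMajorant ‖x 1‖ s) := by
        refine setIntegral_mono_set hmajorant ?_ hsubset.eventuallyLE
        filter_upwards [ae_restrict_mem measurableSet_Ioi] with s hs
          using (norm_nonneg _).trans (norm_half_mul_heat_le hs hx)
    _ = _ := by
        rw [integral_const_mul, integral_add (hlog 0) (hlog 1),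
          integral_logMajorant (hpos 0) (norm_circle_le_one _),
          integral_logMajorant (hpos 1) (norm_circle_le_one _), greenConst]
        have := Real.pi_ne_zero
        field_simp
        ring

lemma norm_exp_greenReg_le {ε a : ℝ} (hε : 0 < ε) (ha : 0 ≤ a) {x : T2} (hx : ∀ i, x i ≠ 0) :
    ‖NormedSpace.exp (((8 * Real.pi * a : ℝ) : ℂ) • greenReg ε) x‖ ≤
      Real.exp (8 * Real.pi * a * greenConst) * (‖x 0‖ ^ (-a) * ‖x 1‖ ^ (-a)) := by
  have hpos (i : Fin 2) : 0 < ‖x i‖ := norm_pos_iff.2 (hx i)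
  rw [exp_apply, Complex.norm_exp, Real.rpow_def_of_pos (hpos 0), Real.rpow_def_of_pos (hpos 1),
    ← Real.exp_add, ← Real.exp_add, Real.exp_le_exp]
  calc ((((8 * Real.pi * a : ℝ) : ℂ) • greenReg ε) x).re
      ≤ ‖(((8 * Real.pi * a : ℝ) : ℂ) • greenReg ε) x‖ := Complex.re_le_norm _
    _ = 8 * Real.pi * a * ‖greenReg ε x‖ := by
        rw [ContinuousMap.smul_apply, norm_smul, Complex.norm_real,
          Real.norm_of_nonneg (by positivity)]
    _ ≤ 8 * Real.pi * a *
          (greenConst - (8 * Real.pi)⁻¹ * (Real.log ‖x 0‖ + Real.log ‖x 1‖)) := by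
        gcongr
        exact norm_greenReg_le hε hx
    _ = _ := by
        field_simp
        ring

lemma norm_mFourierCoeff_heat_mul_exp_greenReg_le {a ε t : ℝ} (ha : 0 ≤ a) (ha1 : a < 1)
    (hε : 0 < ε) (ht : 0 < t) : ‖mFourierCoeff (heat t *
        NormedSpace.exp (((8 * Real.pi * a : ℝ) : ℂ) • greenReg ε) : C(T2, ℂ)) 0‖ ≤
      Real.exp (-t) * Real.exp (8 * Real.pi * a * greenConst) *
        (∫ y : UnitAddCircle, heatBound t ‖y‖ * ‖y‖ ^ (-a) ∂AddCircle.haarAddCircle) ^ 2 := by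
  let f (y : UnitAddCircle) : ℝ := heatBound t ‖y‖ * ‖y‖ ^ (-a)
  have hf := integrable_circle_heatBound ha1 ht
  rw [mFourierCoeff_eq_integral_mul, sq, ← Fin.prod_univ_two
      (fun _ => ∫ y : UnitAddCircle, heatBound t ‖y‖ * ‖y‖ ^ (-a) ∂AddCircle.haarAddCircle),
    ← integral_fintype_prod_eq_prod (fun _ => f), ← integral_const_mul]
  refine norm_integral_le_of_norm_le
    ((Integrable.fintype_prod (f := fun _ => f) fun _ => hf).const_mul _) ?_
  filter_upwards [ae_torus_ne_zero (Fin 2)] with x hx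
  rw [norm_mul, norm_mFourier_apply, mul_one, ContinuousMap.mul_apply, norm_mul, Fin.prod_univ_two]
  calc _ ≤ (Real.exp (-t) * (heatBound t ‖x 0‖ * heatBound t ‖x 1‖)) *
        (Real.exp (8 * Real.pi * a * greenConst) * (‖x 0‖ ^ (-a) * ‖x 1‖ ^ (-a))) :=
        mul_le_mul (norm_heat_le ht x) (norm_exp_greenReg_le hε ha hx) (norm_nonneg _)
          (mul_nonneg (Real.exp_pos _).le
            (mul_nonneg (heatBound_nonneg ht.le _) (heatBound_nonneg ht.le _)))
    _ = _ := by ring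

lemma sq_rpow_add_rpow_le {t : ℝ} (ht : 0 ≤ t) (a : ℝ) :
    (t ^ (-(a / 2)) + t ^ (1 / 2 : ℝ)) ^ 2 ≤ 2 * (t ^ (-a) + t) := by
  refine add_sq_le.trans_eq ?_
  rw [← Real.rpow_mul_natCast ht, ← Real.rpow_mul_natCast ht]
  norm_num

lemma exists_norm_mFourierCoeff_heat_mul_le {a : ℝ} (ha : 0 ≤ a) (ha1 : a < 1) :
    ∃ K, ∀ ε t, 0 < ε → 0 < t →
      ‖mFourierCoeff (heat t *
        NormedSpace.exp (((8 * Real.pi * a : ℝ) : ℂ) • greenReg ε) : C(T2, ℂ)) 0‖ ≤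
        K * Real.exp (-t) * (t ^ (-a) + t) := by
  obtain ⟨K, hK⟩ := exists_integral_circle_heatBound_le ha ha1
  refine ⟨2 * Real.exp (8 * Real.pi * a * greenConst) * K ^ 2, fun ε t hε ht => ?_⟩
  have hJ : 0 ≤ ∫ y : UnitAddCircle, heatBound t ‖y‖ * ‖y‖ ^ (-a) ∂AddCircle.haarAddCircle :=
    integral_nonneg fun y => mul_nonneg (heatBound_nonneg ht.le _) (by positivity)
  calc _ ≤ Real.exp (-t) * Real.exp (8 * Real.pi * a * greenConst) *
        (K * (t ^ (-(a / 2)) + t ^ (1 / 2 : ℝ))) ^ 2 :=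
        (norm_mFourierCoeff_heat_mul_exp_greenReg_le ha ha1 hε ht).trans
          (by gcongr; exact hK t ht)
    _ ≤ Real.exp (-t) * Real.exp (8 * Real.pi * a * greenConst) *
          (K ^ 2 * (2 * (t ^ (-a) + t))) := by
        rw [mul_pow]
        gcongr
        exact sq_rpow_add_rpow_le ht.le a
    _ = _ := by ring

lemma integral_rpow_mul_exp_neg_mul_eigen {β : ℝ} (hβ : 0 < β) (m : Freq) :
    ∫ t in Set.Ioi (0 : ℝ), t ^ (β - 1) * Real.exp (-(eigen m * t)) =
      eigen m ^ (-β) * Real.Gamma β := by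
  rw [Real.integral_rpow_mul_exp_neg_mul_Ioi hβ (eigen_pos m), one_div,
    Real.inv_rpow (eigen_pos m).le, Real.rpow_neg (eigen_pos m).le]

lemma integrableOn_rpow_mul_exp_neg_mul_eigen {β : ℝ} (hβ : 0 < β) (m : Freq) :
    IntegrableOn (fun t : ℝ => t ^ (β - 1) * Real.exp (-(eigen m * t))) (Set.Ioi 0) := by
  refine Integrable.of_integral_ne_zero ?_
  rw [integral_rpow_mul_exp_neg_mul_eigen hβ]
  have := eigen_pos m
  have := Real.Gamma_pos_of_pos hβ
  positivity

lemma sum_eigen_rpow_mul_le_of_heat_le {a β K : ℝ} (hβ : 0 < β) (ha : a < β) {f : C(T2, ℂ)}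
    (hf : f ∈ posCone (Fin 2)) (hK : ∀ t, 0 < t →
      ‖mFourierCoeff (heat t * f : C(T2, ℂ)) 0‖ ≤ K * Real.exp (-t) * (t ^ (-a) + t))
    (B : Finset Freq) : Real.Gamma β * ∑ m ∈ B, eigen m ^ (-β) * (mFourierCoeff f m).re ≤
      K * (Real.Gamma (β - a) + Real.Gamma (β + 1)) := by
  have hΓ := Real.GammaIntegral_convergent (sub_pos.2 ha)
  have hΓ' := Real.GammaIntegral_convergent (add_pos hβ one_pos)
  have hterm (m : Freq) := (integrableOn_rpow_mul_exp_neg_mul_eigen hβ m).mul_const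
    (mFourierCoeff f m).re
  -- `Γ(β) λ⁻ᵝ` is the Mellin transform of `exp(-t λ)`.
  calc Real.Gamma β * ∑ m ∈ B, eigen m ^ (-β) * (mFourierCoeff f m).re
      = ∫ t in Set.Ioi (0 : ℝ), ∑ m ∈ B,
          t ^ (β - 1) * Real.exp (-(eigen m * t)) * (mFourierCoeff f m).re := by
        rw [integral_finsetSum _ fun m _ => hterm m, Finset.mul_sum]
        refine Finset.sum_congr rfl fun m _ => ?_
        rw [integral_mul_const, integral_rpow_mul_exp_neg_mul_eigen hβ]
        ring
    _ ≤ ∫ t in Set.Ioi (0 : ℝ), K * (Real.exp (-t) * t ^ (β - a - 1) +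
          Real.exp (-t) * t ^ (β + 1 - 1)) := by
        refine setIntegral_mono_on (integrable_finsetSum _ fun m _ => hterm m)
          ((hΓ.add hΓ').const_mul _) measurableSet_Ioi fun t (ht : 0 < t) => ?_
        calc _ = t ^ (β - 1) * ∑ m ∈ B, Real.exp (-(t * eigen m)) * (mFourierCoeff f m).re := by
              simp only [Finset.mul_sum, mul_comm (eigen _) t, mul_assoc]
          _ ≤ t ^ (β - 1) * (K * Real.exp (-t) * (t ^ (-a) + t)) := by
              gcongr
              exact (sum_exp_mul_mFourierCoeff_le ht hf B).trans
                ((Complex.re_le_norm _).trans (hK t ht))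
          _ = _ := by
              rw [show β - a - 1 = β - 1 + -a by ring, show β + 1 - 1 = β - 1 + 1 by ring,
                Real.rpow_add ht, Real.rpow_add_one ht.ne']
              ring
    _ = _ := by
        rw [integral_const_mul, integral_add hΓ hΓ', ← Real.Gamma_eq_integral (sub_pos.2 ha),
          ← Real.Gamma_eq_integral (add_pos hβ one_pos)]

lemma exists_pos_forall_le_mul_exp {b c : ℝ} (h : b < c) (F : Finset Freq) :
    ∃ ε, 0 < ε ∧ ∀ m ∈ F, b ≤ c * Real.exp (-(ε * eigen m)) := by
  have hlt : ∀ᶠ ε in 𝓝[>] (0 : ℝ), ∀ m ∈ F, b < c * Real.exp (-(ε * eigen m)) := by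
    refine (Finset.eventually_all F).2 fun m _ => ?_
    have hcont : ContinuousAt (fun ε : ℝ => c * Real.exp (-(ε * eigen m))) 0 := by fun_prop
    exact nhdsWithin_le_nhds (hcont.eventually (lt_mem_nhds (by simpa using h)))
  obtain ⟨ε, hεF, hε⟩ := (hlt.and self_mem_nhdsWithin).exists
  exact ⟨ε, hε, fun m hm => (hεF m hm).le⟩

/-- The Fourier coefficients of `exp(γ² ½ ∑_{m ∈ F} e_m / (1 + 4 π² |m|²))`, which are the second
moments of the Fourier coefficients of the truncated chaos. -/
def chaosCoef (γ : ℝ) (F : Finset Freq) (m : Freq) : ℝ :=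
  (mFourierCoeff ⇑(NormedSpace.exp (((γ ^ 2 : ℝ) : ℂ) • greenPoly F)) m).re

lemma smul_greenPoly_mem_posCone {r : ℝ} (hr : 0 ≤ r) (F : Finset Freq) :
    (r : ℂ) • greenPoly F ∈ posCone (Fin 2) :=
  smul_mem_posCone hr (greenPoly_mem_posCone F)

lemma exists_sum_chaosCoef_le {γ β : ℝ} (hγβ : γ ^ 2 / (8 * Real.pi) < β) (hβ1 : β < 1) :
    ∃ K, ∀ F B : Finset Freq, ∑ m ∈ B, eigen m ^ (-β) * chaosCoef γ F m ≤ K := by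
  obtain ⟨a, hγa, haβ⟩ := exists_between hγβ
  have ha : 0 ≤ a := le_trans (by positivity) hγa.le
  have hβ : 0 < β := ha.trans_lt haβ
  rw [div_lt_iff₀' (by positivity)] at hγa
  obtain ⟨K, hK⟩ := exists_norm_mFourierCoeff_heat_mul_le ha (haβ.trans hβ1)
  refine ⟨K * (Real.Gamma (β - a) + Real.Gamma (β + 1)) / Real.Gamma β, fun F B => ?_⟩
  obtain ⟨ε, hε, hεF⟩ := exists_pos_forall_le_mul_exp hγa F
  rw [le_div_iff₀' (Real.Gamma_pos_of_pos hβ)]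
  refine le_trans ?_ (sum_eigen_rpow_mul_le_of_heat_le hβ haβ (exp_mem_posCone
    (smul_mem_posCone (by positivity) (greenReg_mem_posCone hε))) (fun t ht => hK ε t hε ht) B)
  gcongr with m
  · exact Real.rpow_nonneg (eigen_pos m).le _
  · exact (Complex.le_def.1 (mFourierCoeff_exp_mono (smul_greenPoly_mem_posCone (sq_nonneg γ) F)
      (greenReg_sub_greenPoly_mem_posCone hε (by positivity) hεF) m)).1

/-! ## The Hartley basis -/

lemma sum_neg_freq {M : Type*} [AddCommMonoid M] {F : Finset Freq} (hF : ∀ m ∈ F, -m ∈ F)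
    (f : Freq → M) : ∑ m ∈ F, f (-m) = ∑ m ∈ F, f m :=
  Finset.sum_nbij' (fun m => -m) (fun m => -m) hF hF (fun _ _ => neg_neg _) (fun _ _ => neg_neg _)
    (fun _ _ => rfl)

/-- The coefficient of `e_m` in the Hartley function `cas m`. -/
def casCoeff : ℂ := (1 - Complex.I) / 2

/-- The coefficient of `e_{-m}` in the Hartley function `cas m`, the conjugate of `casCoeff`. -/
def casCoeffConj : ℂ := (1 + Complex.I) / 2

lemma casCoeff_mul_self : casCoeff * casCoeff = -(Complex.I / 2) := by
  unfold casCoeff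
  linear_combination (1 / 4 : ℂ) * Complex.I_sq

lemma casCoeffConj_mul_self : casCoeffConj * casCoeffConj = Complex.I / 2 := by
  unfold casCoeffConj
  linear_combination (1 / 4 : ℂ) * Complex.I_sq

lemma casCoeff_mul_casCoeffConj : casCoeff * casCoeffConj = 1 / 2 := by
  unfold casCoeff casCoeffConj
  linear_combination (-1 / 4 : ℂ) * Complex.I_sq

/-- The Hartley function `cos(2 π m · x) + sin(2 π m · x)`. These functions form a real orthonormal
basis of `L²` indexed by all frequencies, with no choice of a half-space of frequencies. -/
def cas (m : Freq) (x : T2) : ℝ := (mFourier m x).re + (mFourier m x).im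

lemma cas_eq (m : Freq) (x : T2) :
    (cas m x : ℂ) = casCoeff * mFourier m x + casCoeffConj * mFourier (-m) x := by
  rw [mFourier_neg, cas, casCoeff, casCoeffConj]
  apply Complex.ext <;> simp <;> ring

lemma continuous_cas (m : Freq) : Continuous (cas m) :=
  (Complex.continuous_re.comp (mFourier m).continuous).add
    (Complex.continuous_im.comp (mFourier m).continuous)

/-- The Hartley function `cas m` as a real test function. -/
def casTest (m : Freq) : RealTestFunction :=
  ⟨casCoeff • char m + casCoeffConj • char (-m), fun x => by
    change (casCoeff * mFourier m x + casCoeffConj * mFourier (-m) x).im = 0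
    rw [← cas_eq, Complex.ofReal_im]⟩

lemma casTest_apply (m : Freq) (x : T2) : (casTest m).1.1 x = cas m x :=
  (cas_eq m x).symm

lemma apply_casTest (u : Distr) (m : Freq) :
    u.1 (casTest m).1 = casCoeff * u.1 (char m) + casCoeffConj * u.1 (char (-m)) := by
  change u.1 (casCoeff • char m + casCoeffConj • char (-m)) = _
  rw [map_add, map_smul, map_smul, smul_eq_mul, smul_eq_mul]

lemma sum_cas_mul_cas {F : Finset Freq} (hF : ∀ m ∈ F, -m ∈ F) (U V : Freq → ℂ) :
    ∑ m ∈ F, (casCoeff * U m + casCoeffConj * U (-m)) * (casCoeff * V m + casCoeffConj * V (-m)) =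
      ∑ m ∈ F, U (-m) * V m := by
  have hsum_neg_neg : ∑ m ∈ F, U (-m) * V (-m) = ∑ m ∈ F, U m * V m :=
    sum_neg_freq hF fun m => U m * V m
  have hsum_neg : ∑ m ∈ F, U m * V (-m) = ∑ m ∈ F, U (-m) * V m := by
    simpa only [neg_neg] using sum_neg_freq hF fun m => U (-m) * V m
  calc _ = ∑ m ∈ F, (-(Complex.I / 2) * (U m * V m) + Complex.I / 2 * (U (-m) * V (-m)) +
        1 / 2 * (U m * V (-m)) + 1 / 2 * (U (-m) * V m)) := by
        refine Finset.sum_congr rfl fun m _ => ?_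
        linear_combination (U m * V m) * casCoeff_mul_self +
          (U (-m) * V (-m)) * casCoeffConj_mul_self +
          (U m * V (-m) + U (-m) * V m) * casCoeff_mul_casCoeffConj
    _ = _ := by
        simp only [Finset.sum_add_distrib, ← Finset.mul_sum, hsum_neg_neg, hsum_neg]
        ring

lemma mem_freqBall {n : ℕ} {m : Freq} : m ∈ freqBall n ↔
    (∀ i, -(n : ℤ) ≤ m i ∧ m i ≤ n) ∧ freqSq m ≤ (n : ℤ) ^ 2 := by
  simp only [freqBall, Finset.mem_filter, Fintype.mem_piFinset, Finset.mem_Icc]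

lemma neg_mem_freqBall {n : ℕ} {m : Freq} (hm : m ∈ freqBall n) : -m ∈ freqBall n := by
  rw [mem_freqBall] at hm ⊢
  refine ⟨fun i => ⟨?_, ?_⟩, by simpa [freqSq] using hm.2⟩
  · simpa using (hm.1 i).2
  · simpa [neg_le] using (hm.1 i).1

lemma truncate_eq_sum_cas (n : ℕ) (u : Distr) (x : T2) :
    truncate n u x = ∑ m ∈ freqBall n, u.1 (casTest m).1 * cas m x := by
  simp only [apply_casTest, cas_eq]
  rw [sum_cas_mul_cas (fun _ => neg_mem_freqBall) (fun m => u.1 (char m)) fun m => mFourier m x]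
  simp [truncate, fourierCoeff]

lemma integral_cas_mul_cas (m l : Freq) :
    ∫ x, (cas m x * cas l x : ℂ) ∂torusMeasure = if m = l then 1 else 0 := by
  have hprod (x : T2) : (cas m x * cas l x : ℂ) =
      (casCoeff * casCoeff) * mFourier (m + l) x + (casCoeff * casCoeffConj) * mFourier (m - l) x +
        (casCoeff * casCoeffConj) * mFourier (l - m) x +
          (casCoeffConj * casCoeffConj) * mFourier (-(m + l)) x := by
    simp only [cas_eq, sub_eq_add_neg, neg_add, mFourier_add]
    ring
  have hint (c : ℂ) (k : Freq) : Integrable (fun x => c * mFourier k x) torusMeasure :=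
    (integrable_haarTorus (mFourier k)).const_mul c
  simp only [hprod]
  rw [integral_add (((hint _ _).fun_add (hint _ _)).fun_add (hint _ _)) (hint _ _),
    integral_add ((hint _ _).fun_add (hint _ _)) (hint _ _), integral_add (hint _ _) (hint _ _)]
  simp only [integral_const_mul, integral_mFourier, casCoeff_mul_self, casCoeffConj_mul_self,
    casCoeff_mul_casCoeffConj, neg_eq_zero, sub_eq_zero, eq_comm (a := l)]
  split_ifs <;> ring

/-! ## The covariance of the Gaussian free field in the Hartley basis -/

lemma mFourierCoeff_greenFunction (m : Freq) :
    mFourierCoeff greenFunction m = ((1 / (2 * eigen m) : ℝ) : ℂ) := by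
  rw [← mFourierBasis_repr, greenFunction, LinearIsometryEquiv.apply_symm_apply]

instance : (AddCircle.haarAddCircle (T := 1)).IsNegInvariant :=
  Measure.IsAddHaarMeasure.isNegInvariant_of_regular _

lemma integrable_greenKernel_mul (x : T2) (f : C(T2, ℂ)) :
    Integrable (fun y => greenKernel x y * f y) torusMeasure :=
  (((Lp.memLp greenFunction).integrable one_le_two).comp_sub_left x).mul_bdd (c := ‖f‖)
    f.continuous.aestronglyMeasurable (.of_forall f.norm_coe_le_norm)

lemma integral_greenKernel_mul_mFourier (l : Freq) (x : T2) :
    ∫ y, greenKernel x y * mFourier l y ∂torusMeasure =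
      ((1 / (2 * eigen l) : ℝ) : ℂ) * mFourier l x := by
  calc ∫ y, greenKernel x y * mFourier l y ∂torusMeasure
      = ∫ w, greenFunction w * mFourier l (x - w) ∂torusMeasure := by
        rw [← integral_sub_left_eq_self (fun w => greenFunction w * mFourier l (x - w)) _ x]
        simp only [greenKernel, sub_sub_cancel]
    _ = ∫ w, mFourier l x * (mFourier (-l) w • greenFunction w) ∂torusMeasure := by
        refine integral_congr_ae (.of_forall fun w => ?_)
        simp only [sub_eq_add_neg, mFourier_apply_add, mFourier_apply_neg, smul_eq_mul]
        ring
    _ = mFourier l x * mFourierCoeff greenFunction l := integral_const_mul _ _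
    _ = _ := by rw [mFourierCoeff_greenFunction, mul_comm]

lemma integral_greenKernel_mul_cas (l : Freq) (x : T2) :
    ∫ y, greenKernel x y * cas l y ∂torusMeasure = ((1 / (2 * eigen l) : ℝ) : ℂ) * cas l x := by
  have hcas (y : T2) : greenKernel x y * cas l y = casCoeff * (greenKernel x y * mFourier l y) +
      casCoeffConj * (greenKernel x y * mFourier (-l) y) := by
    rw [cas_eq]
    ring
  simp only [hcas]
  rw [integral_add ((integrable_greenKernel_mul x _).const_mul _)
    ((integrable_greenKernel_mul x _).const_mul _), integral_const_mul, integral_const_mul,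
    integral_greenKernel_mul_mFourier, integral_greenKernel_mul_mFourier, eigen_neg, cas_eq]
  ring

lemma integral_greenKernel_mul_casTest (m l : Freq) :
    ∫ x, ∫ y, greenKernel x y * (casTest m).1.1 x * (casTest l).1.1 y ∂torusMeasure ∂torusMeasure =
      ((if m = l then 1 / (2 * eigen l) else 0 : ℝ) : ℂ) := by
  have hinner (x : T2) :
      ∫ y, greenKernel x y * cas m x * cas l y ∂torusMeasure =
        ((1 / (2 * eigen l) : ℝ) : ℂ) * (cas m x * cas l x) := by
    simp only [mul_right_comm _ (cas m x : ℂ)]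
    rw [integral_mul_const, integral_greenKernel_mul_cas]
    ring
  simp only [casTest_apply, hinner]
  rw [integral_const_mul, integral_cas_mul_cas]
  split_ifs <;> simp

/-! ## The Gaussian free field as a random Hartley series -/

/-- The variance `1 / (2 (1 + 4 π² |m|²))` of the Hartley coefficients of the massive Gaussian free
field. -/
def greenVar (m : Freq) : NNReal := ⟨1 / (2 * eigen m), by have := eigen_pos m; positivity⟩

/-- The real random variables `ξ_m`, `m ∈ ℤ²`, are independent and centered Gaussian with the
variances of the Hartley coefficients of the massive Gaussian free field. -/
structure IsGaussianCoeffs {Ω : Type*} [MeasurableSpace Ω] (P : Measure Ω) (ξ : Freq → Ω → ℝ) :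
    Prop where
  measurable : ∀ m, Measurable (ξ m)
  indep : iIndepFun ξ P
  law : ∀ m, P.map (ξ m) = gaussianReal 0 (greenVar m)

/-- The (real part of the) coefficient of a distribution in the Hartley basis. -/
def hartleyCoeff (u : Distr) (m : Freq) : ℝ := (u.1 (casTest m).1).re

lemma truncate_eq_sum_hartleyCoeff {u : Distr} (hu : ∀ m, (u.1 (casTest m).1).im = 0) (n : ℕ)
    (x : T2) :
    truncate n u x = ((∑ m ∈ freqBall n, hartleyCoeff u m * cas m x : ℝ) : ℂ) := by
  rw [truncate_eq_sum_cas]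
  push_cast
  refine Finset.sum_congr rfl fun m _ => ?_
  rw [show u.1 (casTest m).1 = (hartleyCoeff u m : ℂ) from Complex.ext rfl (hu m)]

section HartleyCoeff

variable {Ω : Type*} [MeasurableSpace Ω] {P : Measure Ω} {X : Ω → Distr}

lemma isGaussianProcess_hartleyCoeff (hX : IsMassiveGFF X P) :
    IsGaussianProcess (fun m ω => hartleyCoeff (X ω) m) P :=
  hX.gaussian.comp_right casTest

lemma integral_hartleyCoeff (hX : IsMassiveGFF X P) (m : Freq) :
    ∫ ω, hartleyCoeff (X ω) m ∂P = 0 :=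
  hX.centered (casTest m)

lemma covariance_hartleyCoeff (hX : IsMassiveGFF X P) (m l : Freq) :
    cov[fun ω => hartleyCoeff (X ω) m, fun ω => hartleyCoeff (X ω) l; P] =
      if m = l then 1 / (2 * eigen l) else 0 := by
  have hgauss := isGaussianProcess_hartleyCoeff hX
  have := hgauss.isProbabilityMeasure
  rw [covariance_eq_sub (hgauss.hasGaussianLaw_eval m).memLp_two
    (hgauss.hasGaussianLaw_eval l).memLp_two, integral_hartleyCoeff hX, zero_mul, sub_zero]
  have hcov := hX.covariance (casTest m) (casTest l)
  rw [integral_greenKernel_mul_casTest] at hcov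
  exact_mod_cast hcov

lemma iIndepFun_hartleyCoeff (hX : IsMassiveGFF X P) :
    iIndepFun (fun m ω => hartleyCoeff (X ω) m) P := by
  have hgauss := isGaussianProcess_hartleyCoeff hX
  have hindep := IsGaussianProcess.iIndepFun_of_covariance_eq_zero (S := fun _ => Unit)
    (X := fun m _ ω => hartleyCoeff (X ω) m) (hgauss.comp_right (fun p : (_ : Freq) × Unit => p.1))
    (fun m _ => hgauss.aemeasurable m)
    (fun m l hml _ _ => by rw [covariance_hartleyCoeff hX, if_neg hml])
  exact hindep.comp (fun _ f => f ()) fun _ => measurable_pi_apply ()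

lemma map_hartleyCoeff (hX : IsMassiveGFF X P) (m : Freq) :
    P.map (fun ω => hartleyCoeff (X ω) m) = gaussianReal 0 (greenVar m) := by
  have hgauss := isGaussianProcess_hartleyCoeff hX
  rw [(hgauss.hasGaussianLaw_eval m).map_eq_gaussianReal,
    integral_hartleyCoeff hX, ← covariance_self (hgauss.aemeasurable m),
    covariance_hartleyCoeff hX, if_pos rfl]
  congr 1
  exact Real.toNNReal_of_nonneg _

lemma exists_isGaussianCoeffs (hX : IsMassiveGFF X P) : ∃ ξ : Freq → Ω → ℝ, IsGaussianCoeffs P ξ ∧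
    ∀ᵐ ω ∂P, ∀ n x, truncate n (X ω) x = ((∑ m ∈ freqBall n, ξ m ω * cas m x : ℝ) : ℂ) := by
  have hmeas (m : Freq) : AEMeasurable (fun ω => hartleyCoeff (X ω) m) P :=
    (isGaussianProcess_hartleyCoeff hX).aemeasurable m
  refine ⟨fun m => (hmeas m).mk _, ⟨fun m => (hmeas m).measurable_mk,
    (iIndepFun_hartleyCoeff hX).congr fun m => (hmeas m).ae_eq_mk, fun m => ?_⟩, ?_⟩
  · rw [← Measure.map_congr (hmeas m).ae_eq_mk, map_hartleyCoeff hX]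
  · filter_upwards [ae_all_iff.2 fun m => (hmeas m).ae_eq_mk,
      ae_all_iff.2 fun m => hX.isReal (casTest m)] with ω hmk him n x
    simp only [truncate_eq_sum_hartleyCoeff him, hmk]

end HartleyCoeff

/-! ## The truncated chaos as a function of the Hartley coefficients -/

/-- The density `exp(γ ∑_{m ∈ F} z_m cas_m - (γ² / 2) ∑_{m ∈ F} Var(ξ_m))` of the truncated chaos
whose Hartley coefficients take the values `z`. -/
def chaosDensity (γ : ℝ) (F : Finset Freq) (z : Freq → ℝ) (x : T2) : ℝ :=
  Real.exp (γ * ∑ m ∈ F, z m * cas m x - γ ^ 2 / 2 * ∑ m ∈ F, (greenVar m : ℝ))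

/-- The real trigonometric polynomial `∑_{m ∈ F} b_m cas_m`, as a complex-valued function. -/
def casPoly (F : Finset Freq) (b : Freq → ℝ) : C(T2, ℂ) := ∑ m ∈ F, (b m : ℂ) • (casTest m).1.1

lemma casPoly_apply (F : Finset Freq) (b : Freq → ℝ) (x : T2) :
    casPoly F b x = ((∑ m ∈ F, b m * cas m x : ℝ) : ℂ) := by
  simp only [casPoly, ContinuousMap.coe_sum, Finset.sum_apply, ContinuousMap.smul_apply,
    smul_eq_mul, casTest_apply]
  push_cast
  rfl

/-- `chaosDensity` as a continuous function of the space variable. -/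
def chaosTrunc (γ : ℝ) (F : Finset Freq) (z : Freq → ℝ) : C(T2, ℂ) :=
  NormedSpace.exp
    (casPoly F (γ • z) - ((γ ^ 2 / 2 * ∑ m ∈ F, (greenVar m : ℝ) : ℝ) : ℂ) • 1)

lemma chaosTrunc_apply (γ : ℝ) (F : Finset Freq) (z : Freq → ℝ) (x : T2) :
    chaosTrunc γ F z x = (chaosDensity γ F z x : ℂ) := by
  rw [chaosTrunc, chaosDensity, exp_apply, Complex.ofReal_exp, ContinuousMap.sub_apply,
    casPoly_apply, ContinuousMap.smul_apply, ContinuousMap.one_apply, smul_eq_mul, mul_one,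
    ← Complex.ofReal_sub]
  simp only [Finset.mul_sum, Pi.smul_apply, smul_eq_mul, mul_assoc]

lemma chaosTrunc_empty (γ : ℝ) (z : Freq → ℝ) : chaosTrunc γ ∅ z = 1 := by
  ext x
  simp [chaosTrunc_apply, chaosDensity]

lemma chaosDensity_pos (γ : ℝ) (F : Finset Freq) (z : Freq → ℝ) (x : T2) :
    0 < chaosDensity γ F z x :=
  Real.exp_pos _

lemma continuous_chaosDensity (γ : ℝ) (F : Finset Freq) :
    Continuous fun p : (Freq → ℝ) × T2 => chaosDensity γ F p.1 p.2 := by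
  have := continuous_cas
  unfold chaosDensity
  fun_prop

lemma continuous_casPoly (F : Finset Freq) : Continuous (casPoly F) :=
  continuous_finsetSum _ fun m _ =>
    (Complex.continuous_ofReal.comp (continuous_apply m)).smul continuous_const

lemma continuous_chaosTrunc (γ : ℝ) (F : Finset Freq) : Continuous (chaosTrunc γ F) :=
  NormedSpace.exp_continuous.comp
    (((continuous_casPoly F).comp (continuous_const_smul γ)).sub continuous_const)

/-! ## Second moments of the truncated chaos -/

lemma sum_greenVar_mul_cas_mul_cas {F : Finset Freq} (hF : ∀ m ∈ F, -m ∈ F) (x y : T2) :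
    ((∑ m ∈ F, (greenVar m : ℝ) * (cas m x * cas m y) : ℝ) : ℂ) = greenPoly F (x - y) := by
  have hvar (m : Freq) : (greenVar m : ℝ) = 1 / (2 * eigen m) := rfl
  have hcas := sum_cas_mul_cas hF (fun m => mFourier m y)
    (fun m => ((1 / (2 * eigen m) : ℝ) : ℂ) * mFourier m x)
  calc _ = ∑ m ∈ F, (casCoeff * mFourier m y + casCoeffConj * mFourier (-m) y) *
        (casCoeff * (((1 / (2 * eigen m) : ℝ) : ℂ) * mFourier m x) +
          casCoeffConj * (((1 / (2 * eigen (-m)) : ℝ) : ℂ) * mFourier (-m) x)) := by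
        push_cast
        refine Finset.sum_congr rfl fun m _ => ?_
        rw [cas_eq, cas_eq, hvar, eigen_neg]
        push_cast
        ring
    _ = _ := by
        rw [hcas]
        simp only [greenPoly, ContinuousMap.coe_sum, Finset.sum_apply, ContinuousMap.smul_apply,
          smul_eq_mul, sub_eq_add_neg, mFourier_apply_add, mFourier_apply_neg]
        exact Finset.sum_congr rfl fun m _ => by ring

lemma sum_greenVar_mul_cas_sq {F : Finset Freq} (hF : ∀ m ∈ F, -m ∈ F) (x : T2) :
    ∑ m ∈ F, (greenVar m : ℝ) * cas m x ^ 2 = ∑ m ∈ F, (greenVar m : ℝ) := by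
  have hone (m : Freq) : mFourier m (0 : T2) = 1 := by simp [mFourier]
  have hdiag := sum_greenVar_mul_cas_mul_cas hF x x
  simp only [greenPoly, sub_self, ContinuousMap.coe_sum, Finset.sum_apply,
    ContinuousMap.smul_apply, hone, smul_eq_mul, mul_one, ← Complex.ofReal_sum, ← sq] at hdiag
  exact Complex.ofReal_injective hdiag

lemma mFourierCoeff_exp_greenPoly (γ : ℝ) (F : Finset Freq) (m : Freq) :
    mFourierCoeff ⇑(NormedSpace.exp (((γ ^ 2 : ℝ) : ℂ) • greenPoly F)) m = chaosCoef γ F m :=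
  Complex.ext rfl (Complex.le_def.1
    (exp_mem_posCone (smul_greenPoly_mem_posCone (sq_nonneg γ) F) m)).2.symm

lemma chaosCoef_nonneg (γ : ℝ) (F : Finset Freq) (m : Freq) : 0 ≤ chaosCoef γ F m :=
  (Complex.le_def.1 (exp_mem_posCone (smul_greenPoly_mem_posCone (sq_nonneg γ) F) m)).1

lemma integral_comp_sub_mul_mFourier {d : Type*} [Fintype d] (f : C(UnitAddTorus d, ℂ))
    (m : d → ℤ) :
    ∫ p : UnitAddTorus d × UnitAddTorus d, f (p.1 - p.2) * (mFourier (-m) p.1 * mFourier m p.2)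
      ∂(haarTorus d).prod (haarTorus d) = mFourierCoeff f m := by
  have hcont : Continuous fun p : UnitAddTorus d × UnitAddTorus d =>
      f (p.1 - p.2) * (mFourier (-m) p.1 * mFourier m p.2) := by fun_prop
  have hchar (x y : UnitAddTorus d) : mFourier (-m) x * mFourier m y = mFourier (-m) (x - y) := by
    rw [sub_eq_add_neg x y, mFourier_apply_add, mFourier_apply_neg, neg_neg]
  rw [integral_prod_symm _
    (hcont.integrable_of_hasCompactSupport (HasCompactSupport.of_compactSpace _))]
  simp only [hchar, integral_sub_right_eq_self (fun w => f w * mFourier (-m) w),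
    ← mFourierCoeff_eq_integral_mul, integral_const, probReal_univ, one_smul]

lemma norm_sq_mFourierCoeff {d : Type*} [Fintype d] {f : C(UnitAddTorus d, ℂ)}
    (hf : ∀ x, (f x).im = 0) (m : d → ℤ) :
    ((‖mFourierCoeff f m‖ ^ 2 : ℝ) : ℂ) = mFourierCoeff f m * mFourierCoeff f (-m) := by
  have hstar : star f = f := ContinuousMap.ext fun x => Complex.conj_eq_iff_im.2 (hf x)
  have hconj := mFourierCoeff_star f (-m)
  rw [hstar, neg_neg, ← starRingEnd_apply] at hconj
  rw [hconj, Complex.mul_conj, Complex.normSq_eq_norm_sq]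

lemma mFourierCoeff_chaosTrunc_mul (γ : ℝ) (F F' : Finset Freq) (z : Freq → ℝ) (m : Freq) :
    mFourierCoeff (chaosTrunc γ F z) m * mFourierCoeff (chaosTrunc γ F' z) (-m) =
      ∫ p : T2 × T2, ((chaosDensity γ F z p.1 * chaosDensity γ F' z p.2 : ℝ) : ℂ) *
        (mFourier (-m) p.1 * mFourier m p.2) ∂torusMeasure.prod torusMeasure := by
  rw [mFourierCoeff_eq_integral_mul, mFourierCoeff_eq_integral_mul, ← integral_prod_mul]
  refine integral_congr_ae (.of_forall fun p => ?_)
  simp only [chaosTrunc_apply, neg_neg]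
  push_cast
  ring

lemma norm_sq_mFourierCoeff_chaosTrunc_sub (γ : ℝ) (F F' : Finset Freq) (z : Freq → ℝ)
    (m : Freq) :
    ((‖mFourierCoeff (chaosTrunc γ F' z - chaosTrunc γ F z : C(T2, ℂ)) m‖ ^ 2 : ℝ) : ℂ) =
      (mFourierCoeff (chaosTrunc γ F' z) m * mFourierCoeff (chaosTrunc γ F' z) (-m) -
        mFourierCoeff (chaosTrunc γ F' z) m * mFourierCoeff (chaosTrunc γ F z) (-m)) -
      (mFourierCoeff (chaosTrunc γ F z) m * mFourierCoeff (chaosTrunc γ F' z) (-m) -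
        mFourierCoeff (chaosTrunc γ F z) m * mFourierCoeff (chaosTrunc γ F z) (-m)) := by
  rw [norm_sq_mFourierCoeff (fun x => by
    rw [ContinuousMap.sub_apply, chaosTrunc_apply, chaosTrunc_apply, ← Complex.ofReal_sub,
      Complex.ofReal_im]), mFourierCoeff_sub, mFourierCoeff_sub]
  ring

namespace IsGaussianCoeffs

variable {Ω : Type*} [MeasurableSpace Ω] {P : Measure Ω} {ξ : Freq → Ω → ℝ}

lemma isProbabilityMeasure (hξ : IsGaussianCoeffs P ξ) : IsProbabilityMeasure P :=
  hξ.indep.isProbabilityMeasure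

lemma measurable_pi (hξ : IsGaussianCoeffs P ξ) : Measurable fun ω m => ξ m ω :=
  measurable_pi_lambda _ hξ.measurable

lemma stronglyMeasurable_chaosTrunc (hξ : IsGaussianCoeffs P ξ) (γ : ℝ) (F : Finset Freq) :
    StronglyMeasurable fun ω => chaosTrunc γ F (ξ · ω) :=
  (continuous_chaosTrunc γ F).stronglyMeasurable.comp_measurable hξ.measurable_pi

lemma integral_exp_sum (hξ : IsGaussianCoeffs P ξ) (F : Finset Freq) (b : Freq → ℝ) :
    ∫ ω, Real.exp (∑ m ∈ F, b m * ξ m ω) ∂P = Real.exp (∑ m ∈ F, greenVar m * b m ^ 2 / 2) := by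
  have hterm (m : Freq) : mgf ((b m * ·) ∘ ξ m) P 1 = Real.exp (greenVar m * b m ^ 2 / 2) := by
    simpa [mgf] using mgf_gaussianReal (hξ.law m) (b m)
  have hsum := (hξ.indep.comp (fun m y => b m * y) fun m => measurable_const_mul _).mgf_sum
    (t := 1) (fun m => (hξ.measurable m).const_mul (b m)) F
  rw [Finset.prod_congr rfl fun m _ => hterm m, ← Real.exp_sum] at hsum
  simpa [mgf] using hsum

lemma integral_exp_sum_mul_exp_sum (hξ : IsGaussianCoeffs P ξ)
    (F F' : Finset Freq) (b b' : Freq → ℝ) :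
    ∫ ω, Real.exp (∑ m ∈ F, b m * ξ m ω) * Real.exp (∑ m ∈ F', b' m * ξ m ω) ∂P =
      Real.exp (∑ m ∈ F, greenVar m * b m ^ 2 / 2 + ∑ m ∈ F', greenVar m * b' m ^ 2 / 2 +
        ∑ m ∈ F ∩ F', greenVar m * (b m * b' m)) := by
  have hF (f : Freq → ℝ) : ∑ m ∈ F, f m = ∑ m ∈ F ∪ F', if m ∈ F then f m else 0 := by
    rw [Finset.sum_ite_mem, Finset.union_inter_cancel_left]
  have hF' (f : Freq → ℝ) : ∑ m ∈ F', f m = ∑ m ∈ F ∪ F', if m ∈ F' then f m else 0 := by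
    rw [Finset.sum_ite_mem, Finset.union_inter_cancel_right]
  have hFF' (f : Freq → ℝ) :
      ∑ m ∈ F ∩ F', f m = ∑ m ∈ F ∪ F', if m ∈ F ∩ F' then f m else 0 := by
    rw [Finset.sum_ite_mem, Finset.inter_eq_right.2 (Finset.inter_subset_left.trans
      Finset.subset_union_left)]
  simp only [← Real.exp_add, hF, hF', hFF', ← Finset.sum_add_distrib]
  convert hξ.integral_exp_sum (F ∪ F')
    (fun m => (if m ∈ F then b m else 0) + if m ∈ F' then b' m else 0) using 5
  · split_ifs <;> ring
  · simp only [Finset.mem_inter, ite_and]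
    split_ifs <;> ring

variable {F F' : Finset Freq}

lemma integral_chaosDensity_mul (hξ : IsGaussianCoeffs P ξ) (γ : ℝ)
    (hF : ∀ m ∈ F, -m ∈ F) (hF' : ∀ m ∈ F', -m ∈ F') (x y : T2) :
    ∫ ω, chaosDensity γ F (ξ · ω) x * chaosDensity γ F' (ξ · ω) y ∂P =
      Real.exp (γ ^ 2 * ∑ m ∈ F ∩ F', (greenVar m : ℝ) * (cas m x * cas m y)) := by
  have hdensity (F : Finset Freq) (x : T2) (ω : Ω) : chaosDensity γ F (ξ · ω) x =
      Real.exp (∑ m ∈ F, γ * cas m x * ξ m ω) *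
        Real.exp (-(γ ^ 2 / 2 * ∑ m ∈ F, (greenVar m : ℝ))) := by
    rw [chaosDensity, sub_eq_add_neg, Real.exp_add, Finset.mul_sum]
    congr 2
    exact Finset.sum_congr rfl fun m _ => by ring
  have hvar {F : Finset Freq} (hF : ∀ m ∈ F, -m ∈ F) (x : T2) :
      ∑ m ∈ F, greenVar m * (γ * cas m x) ^ 2 / 2 = γ ^ 2 / 2 * ∑ m ∈ F, (greenVar m : ℝ) := by
    rw [← sum_greenVar_mul_cas_sq hF x, Finset.mul_sum]
    exact Finset.sum_congr rfl fun m _ => by ring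
  have hcovar : ∑ m ∈ F ∩ F', (greenVar m : ℝ) * (γ * cas m x * (γ * cas m y)) =
      γ ^ 2 * ∑ m ∈ F ∩ F', (greenVar m : ℝ) * (cas m x * cas m y) := by
    rw [Finset.mul_sum]
    exact Finset.sum_congr rfl fun m _ => by ring
  simp only [hdensity, mul_mul_mul_comm (Real.exp _)]
  rw [integral_mul_const, hξ.integral_exp_sum_mul_exp_sum, hvar hF, hvar hF', hcovar,
    ← Real.exp_add, ← Real.exp_add]
  congr 1
  ring

lemma integrable_chaosDensity_mul (hξ : IsGaussianCoeffs P ξ) (γ : ℝ) (hF : ∀ m ∈ F, -m ∈ F)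
    (hF' : ∀ m ∈ F', -m ∈ F') :
    Integrable (fun q : Ω × T2 × T2 =>
      chaosDensity γ F (ξ · q.1) q.2.1 * chaosDensity γ F' (ξ · q.1) q.2.2)
      (P.prod (torusMeasure.prod torusMeasure)) := by
  have := hξ.isProbabilityMeasure
  have hmeas (F : Finset Freq) {g : T2 × T2 → T2} (hg : Continuous g) :
      Measurable fun q : Ω × T2 × T2 => chaosDensity γ F (ξ · q.1) (g q.2) :=
    (continuous_chaosDensity γ F).measurable.comp
      ((hξ.measurable_pi.comp measurable_fst).prodMk (hg.measurable.comp measurable_snd))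
  have hpos (q : Ω × T2 × T2) :
      0 ≤ chaosDensity γ F (ξ · q.1) q.2.1 * chaosDensity γ F' (ξ · q.1) q.2.2 :=
    mul_nonneg (chaosDensity_pos _ _ _ _).le (chaosDensity_pos _ _ _ _).le
  rw [integrable_prod_iff' ((hmeas F continuous_fst).fun_mul
    (hmeas F' continuous_snd)).aestronglyMeasurable]
  simp only [Real.norm_of_nonneg (hpos (_, _)), hξ.integral_chaosDensity_mul γ hF hF']
  refine ⟨.of_forall fun p => .of_integral_ne_zero ?_, ?_⟩
  · rw [hξ.integral_chaosDensity_mul γ hF hF']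
    exact (Real.exp_pos _).ne'
  · refine Continuous.integrable_of_hasCompactSupport ?_ (HasCompactSupport.of_compactSpace _)
    have := continuous_cas
    fun_prop

lemma integrable_chaosDensity_mul_mFourier (hξ : IsGaussianCoeffs P ξ) (γ : ℝ)
    (hF : ∀ m ∈ F, -m ∈ F) (hF' : ∀ m ∈ F', -m ∈ F') (m : Freq) :
    Integrable (fun q : Ω × T2 × T2 =>
      ((chaosDensity γ F (ξ · q.1) q.2.1 * chaosDensity γ F' (ξ · q.1) q.2.2 : ℝ) : ℂ) *
        (mFourier (-m) q.2.1 * mFourier m q.2.2))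
      (P.prod (torusMeasure.prod torusMeasure)) :=
  (hξ.integrable_chaosDensity_mul γ hF hF').ofReal.mul_bdd (c := 1)
    (Measurable.aestronglyMeasurable (by fun_prop)) (.of_forall fun q => by
      rw [norm_mul, norm_mFourier_apply, norm_mFourier_apply, one_mul])

lemma integrable_mFourierCoeff_mul (hξ : IsGaussianCoeffs P ξ) (γ : ℝ)
    (hF : ∀ m ∈ F, -m ∈ F) (hF' : ∀ m ∈ F', -m ∈ F') (m : Freq) :
    Integrable (fun ω => mFourierCoeff (chaosTrunc γ F (ξ · ω)) m *
      mFourierCoeff (chaosTrunc γ F' (ξ · ω)) (-m)) P := by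
  simp only [mFourierCoeff_chaosTrunc_mul]
  exact (hξ.integrable_chaosDensity_mul_mFourier γ hF hF' m).integral_prod_left

lemma integral_mFourierCoeff_mul (hξ : IsGaussianCoeffs P ξ) (γ : ℝ)
    (hF : ∀ m ∈ F, -m ∈ F) (hF' : ∀ m ∈ F', -m ∈ F') (m : Freq) :
    ∫ ω, mFourierCoeff (chaosTrunc γ F (ξ · ω)) m *
      mFourierCoeff (chaosTrunc γ F' (ξ · ω)) (-m) ∂P = chaosCoef γ (F ∩ F') m := by
  have := hξ.isProbabilityMeasure
  have hFF' : ∀ m ∈ F ∩ F', -m ∈ F ∩ F' := fun m hm =>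
    Finset.mem_inter.2 ((Finset.mem_inter.1 hm).imp (hF m) (hF' m))
  simp only [mFourierCoeff_chaosTrunc_mul]
  rw [integral_integral_swap (hξ.integrable_chaosDensity_mul_mFourier γ hF hF' m),
    ← mFourierCoeff_exp_greenPoly, ← integral_comp_sub_mul_mFourier]
  refine integral_congr_ae (.of_forall fun p => ?_)
  simp only [integral_mul_const, integral_complex_ofReal, hξ.integral_chaosDensity_mul γ hF hF',
    exp_apply, ContinuousMap.smul_apply, ← sum_greenVar_mul_cas_mul_cas hFF', smul_eq_mul]
  push_cast
  rfl

lemma integrable_norm_sq_mFourierCoeff_sub (hξ : IsGaussianCoeffs P ξ) (γ : ℝ)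
    (hF : ∀ m ∈ F, -m ∈ F) (hF' : ∀ m ∈ F', -m ∈ F') (m : Freq) :
    Integrable (fun ω => ‖mFourierCoeff (chaosTrunc γ F' (ξ · ω) - chaosTrunc γ F (ξ · ω) :
      C(T2, ℂ)) m‖ ^ 2) P := by
  have hcomplex : Integrable (fun ω => ((‖mFourierCoeff (chaosTrunc γ F' (ξ · ω) -
      chaosTrunc γ F (ξ · ω) : C(T2, ℂ)) m‖ ^ 2 : ℝ) : ℂ)) P := by
    simp only [norm_sq_mFourierCoeff_chaosTrunc_sub]
    exact ((hξ.integrable_mFourierCoeff_mul γ hF' hF' m).sub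
      (hξ.integrable_mFourierCoeff_mul γ hF' hF m)).sub
      ((hξ.integrable_mFourierCoeff_mul γ hF hF' m).sub
        (hξ.integrable_mFourierCoeff_mul γ hF hF m))
  exact hcomplex.re.congr (.of_forall fun ω => Complex.ofReal_re _)

lemma integral_norm_sq_mFourierCoeff_sub (hξ : IsGaussianCoeffs P ξ) (γ : ℝ)
    (hF : ∀ m ∈ F, -m ∈ F) (hF' : ∀ m ∈ F', -m ∈ F') (hFF' : F ⊆ F') (m : Freq) :
    ∫ ω, ‖mFourierCoeff (chaosTrunc γ F' (ξ · ω) - chaosTrunc γ F (ξ · ω) : C(T2, ℂ)) m‖ ^ 2 ∂P =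
      chaosCoef γ F' m - chaosCoef γ F m := by
  have hi {F F' : Finset Freq} (hF : ∀ m ∈ F, -m ∈ F) (hF' : ∀ m ∈ F', -m ∈ F') :=
    hξ.integrable_mFourierCoeff_mul γ hF hF' m
  apply Complex.ofReal_injective
  rw [← integral_complex_ofReal]
  simp only [norm_sq_mFourierCoeff_chaosTrunc_sub]
  refine (integral_sub ((hi hF' hF').sub (hi hF' hF)) ((hi hF hF').sub (hi hF hF))).trans ?_
  rw [integral_sub' (hi hF' hF') (hi hF' hF), integral_sub' (hi hF hF') (hi hF hF)]
  rw [hξ.integral_mFourierCoeff_mul γ hF' hF', hξ.integral_mFourierCoeff_mul γ hF' hF,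
    hξ.integral_mFourierCoeff_mul γ hF hF', hξ.integral_mFourierCoeff_mul γ hF hF,
    Finset.inter_self, Finset.inter_self, Finset.inter_eq_right.2 hFF',
    Finset.inter_eq_left.2 hFF']
  push_cast
  ring

end IsGaussianCoeffs

/-! ## The second moment of the chaos in Sobolev norm -/

/-- The second moment `∑_m (1 + 4 π² |m|²)^s 𝔼|M̂_F(m)|²` in `H^s` of the chaos truncated to the
frequencies in `F`; the value is the junk value `0` when the series diverges. -/
def chaosMass (γ s : ℝ) (F : Finset Freq) : ℝ := ∑' m, eigen m ^ s * chaosCoef γ F m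

lemma smul_greenPoly_add (c : ℂ) {F F' : Finset Freq} (h : F ⊆ F') :
    c • greenPoly F + c • greenPoly (F' \ F) = c • greenPoly F' :=
  (smul_add c (greenPoly F) (greenPoly (F' \ F))).symm.trans
    (congrArg (c • ·) ((add_comm _ _).trans (Finset.sum_sdiff h)))

lemma chaosCoef_sdiff_sub_le (γ : ℝ) {F F' : Finset Freq} (h : F ⊆ F') (m : Freq) :
    chaosCoef γ (F' \ F) m - chaosCoef γ ∅ m ≤ chaosCoef γ F' m - chaosCoef γ F m := by
  have hmem (F : Finset Freq) := smul_greenPoly_mem_posCone (sq_nonneg γ) F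
  have hone : NormedSpace.exp (((γ ^ 2 : ℝ) : ℂ) • greenPoly ∅) = 1 := by
    simp [greenPoly, NormedSpace.exp_zero]
  have hle := mFourierCoeff_exp_sub_one_le (hmem F) (hmem (F' \ F)) m
  rw [smul_greenPoly_add _ h, ← hone, mFourierCoeff_sub, mFourierCoeff_sub] at hle
  simp only [mFourierCoeff_exp_greenPoly] at hle
  exact_mod_cast hle

lemma chaosCoef_mono (γ : ℝ) {F F' : Finset Freq} (h : F ⊆ F') (m : Freq) :
    chaosCoef γ F m ≤ chaosCoef γ F' m := by
  have hmem (F : Finset Freq) := smul_greenPoly_mem_posCone (sq_nonneg γ) F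
  have hle := mFourierCoeff_exp_mono (hmem F) (g := ((γ ^ 2 : ℝ) : ℂ) • greenPoly F')
    (by rw [← smul_greenPoly_add _ h, add_sub_cancel_left]; exact hmem _) m
  rw [mFourierCoeff_exp_greenPoly, mFourierCoeff_exp_greenPoly] at hle
  exact_mod_cast hle

section ChaosMass

variable {γ s K : ℝ}

lemma summable_chaosCoef (hK : ∀ F B : Finset Freq, ∑ m ∈ B, eigen m ^ s * chaosCoef γ F m ≤ K)
    (F : Finset Freq) : Summable fun m => eigen m ^ s * chaosCoef γ F m :=
  summable_of_sum_le (fun m => mul_nonneg (Real.rpow_nonneg (eigen_pos m).le _)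
    (chaosCoef_nonneg γ F m)) (hK F)

lemma chaosMass_le (hK : ∀ F B : Finset Freq, ∑ m ∈ B, eigen m ^ s * chaosCoef γ F m ≤ K)
    (F : Finset Freq) : chaosMass γ s F ≤ K :=
  (summable_chaosCoef hK F).tsum_le_of_sum_le (hK F)

lemma chaosMass_mono (hK : ∀ F B : Finset Freq, ∑ m ∈ B, eigen m ^ s * chaosCoef γ F m ≤ K)
    {F F' : Finset Freq} (h : F ⊆ F') : chaosMass γ s F ≤ chaosMass γ s F' :=
  (summable_chaosCoef hK F).tsum_le_tsum (fun m => mul_le_mul_of_nonneg_left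
    (chaosCoef_mono γ h m) (Real.rpow_nonneg (eigen_pos m).le _)) (summable_chaosCoef hK F')

lemma hasSum_chaosMass_sub (hK : ∀ F B : Finset Freq, ∑ m ∈ B, eigen m ^ s * chaosCoef γ F m ≤ K)
    (F F' : Finset Freq) :
    HasSum (fun m => eigen m ^ s * (chaosCoef γ F' m - chaosCoef γ F m))
      (chaosMass γ s F' - chaosMass γ s F) := by
  simp only [mul_sub]
  exact (summable_chaosCoef hK F').hasSum.sub (summable_chaosCoef hK F).hasSum

lemma chaosMass_sdiff_sub_le (hK : ∀ F B : Finset Freq, ∑ m ∈ B, eigen m ^ s * chaosCoef γ F m ≤ K)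
    {F F' : Finset Freq} (h : F ⊆ F') :
    chaosMass γ s (F' \ F) - chaosMass γ s ∅ ≤ chaosMass γ s F' - chaosMass γ s F :=
  hasSum_le (fun m => mul_le_mul_of_nonneg_left (chaosCoef_sdiff_sub_le γ h m)
    (Real.rpow_nonneg (eigen_pos m).le _)) (hasSum_chaosMass_sub hK _ _)
    (hasSum_chaosMass_sub hK _ _)

end ChaosMass

lemma eLpNorm_two_sq {α ε : Type*} [MeasurableSpace α] {μ : Measure α} [ENorm ε] (f : α → ε) :
    eLpNorm f 2 μ ^ 2 = ∫⁻ x, ‖f x‖ₑ ^ 2 ∂μ := by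
  simpa using eLpNorm_nnreal_pow_eq_lintegral (p := 2) (μ := μ) (f := f) two_ne_zero

lemma memLp_of_sub_const {α S : Type*} [MeasurableSpace α] {μ : Measure α} [IsFiniteMeasure μ]
    [SeminormedAddCommGroup S] {p : ℝ≥0∞} {f : α → S} {c : S}
    (h : MemLp (fun x => f x - c) p μ) : MemLp f p μ := by
  have hnorm : MemLp (fun x => ‖f x - c‖) p μ :=
    ⟨h.1.norm, (eLpNorm_congr_enorm_ae (.of_forall fun x => by simp)).trans_lt h.2⟩
  refine ⟨by simpa only [sub_add_cancel] using h.1.add_const c, lt_of_le_of_lt ?_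
    (hnorm.add (memLp_const ‖c‖)).2⟩
  refine eLpNorm_mono_enorm fun x => ?_
  rw [← ofReal_norm, ← ofReal_norm]
  exact ENNReal.ofReal_le_ofReal ((norm_le_norm_sub_add (f x) c).trans (le_abs_self _))

lemma enorm_toSobolev_sq {s : ℝ} (hs : s ≤ 0) (f : C(T2, ℂ)) :
    ‖toSobolev hs f‖ₑ ^ 2 = ∑' m, ENNReal.ofReal (eigen m ^ s * ‖mFourierCoeff f m‖ ^ 2) := by
  have hsum := hasSum_norm_toSobolev_sq hs f
  rw [← ENNReal.ofReal_tsum_of_nonneg (fun m => mul_nonneg (Real.rpow_nonneg (eigen_pos m).le _)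
    (sq_nonneg _)) hsum.summable, hsum.tsum_eq, ENNReal.ofReal_pow (norm_nonneg _), ofReal_norm]

namespace IsGaussianCoeffs

variable {Ω : Type*} [MeasurableSpace Ω] {P : Measure Ω} {ξ : Freq → Ω → ℝ} {γ s K : ℝ}

lemma lintegral_norm_sq_mFourierCoeff_sub (hξ : IsGaussianCoeffs P ξ) (γ : ℝ) {F F' : Finset Freq}
    (hF : ∀ m ∈ F, -m ∈ F) (hF' : ∀ m ∈ F', -m ∈ F') (hFF' : F ⊆ F') (s : ℝ) (m : Freq) :
    ∫⁻ ω, ENNReal.ofReal (eigen m ^ s * ‖mFourierCoeff (chaosTrunc γ F' (ξ · ω) -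
      chaosTrunc γ F (ξ · ω) : C(T2, ℂ)) m‖ ^ 2) ∂P =
      ENNReal.ofReal (eigen m ^ s * (chaosCoef γ F' m - chaosCoef γ F m)) := by
  rw [← hξ.integral_norm_sq_mFourierCoeff_sub γ hF hF' hFF', ← integral_const_mul,
    ofReal_integral_eq_lintegral_ofReal
      ((hξ.integrable_norm_sq_mFourierCoeff_sub γ hF hF' m).const_mul _)]
  exact .of_forall fun ω => mul_nonneg (Real.rpow_nonneg (eigen_pos m).le _) (sq_nonneg _)

lemma eLpNorm_toSobolev_sub_sq
    (hK : ∀ F B : Finset Freq, ∑ m ∈ B, eigen m ^ s * chaosCoef γ F m ≤ K)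
    (hξ : IsGaussianCoeffs P ξ) (hs : s ≤ 0) {F F' : Finset Freq}
    (hF : ∀ m ∈ F, -m ∈ F) (hF' : ∀ m ∈ F', -m ∈ F') (hFF' : F ⊆ F') :
    eLpNorm (fun ω => toSobolev hs (chaosTrunc γ F' (ξ · ω) - chaosTrunc γ F (ξ · ω))) 2 P ^ 2 =
      ENNReal.ofReal (chaosMass γ s F' - chaosMass γ s F) := by
  have hsum := hasSum_chaosMass_sub hK F F'
  rw [eLpNorm_two_sq]
  simp only [enorm_toSobolev_sq]
  rw [lintegral_tsum fun m => ((hξ.integrable_norm_sq_mFourierCoeff_sub γ hF hF'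
    m).aestronglyMeasurable.aemeasurable.const_mul _).ennreal_ofReal]
  simp only [hξ.lintegral_norm_sq_mFourierCoeff_sub γ hF hF' hFF']
  rw [← ENNReal.ofReal_tsum_of_nonneg (fun m => mul_nonneg (Real.rpow_nonneg (eigen_pos m).le _)
    (sub_nonneg.2 (chaosCoef_mono γ hFF' m))) hsum.summable, hsum.tsum_eq]

lemma memLp_toSobolev (hK : ∀ F B : Finset Freq, ∑ m ∈ B, eigen m ^ s * chaosCoef γ F m ≤ K)
    (hξ : IsGaussianCoeffs P ξ) (hs : s ≤ 0) {F : Finset Freq} (hF : ∀ m ∈ F, -m ∈ F) :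
    MemLp (fun ω => toSobolev hs (chaosTrunc γ F (ξ · ω))) 2 P := by
  have := hξ.isProbabilityMeasure
  have hsub : MemLp (fun ω => toSobolev hs (chaosTrunc γ F (ξ · ω) - 1)) 2 P := by
    refine ⟨((toSobolev hs).continuous.comp_stronglyMeasurable
      ((hξ.stronglyMeasurable_chaosTrunc γ F).sub stronglyMeasurable_const)).aestronglyMeasurable,
      lt_top_iff_ne_top.2 fun htop => ?_⟩
    have hsq := eLpNorm_toSobolev_sub_sq hK hξ hs (F := ∅) (by simp) hF (Finset.empty_subset F)
    simp only [chaosTrunc_empty] at hsq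
    rw [htop, ENNReal.top_pow two_ne_zero] at hsq
    exact ENNReal.ofReal_ne_top hsq.symm
  simp only [map_sub] at hsub
  exact memLp_of_sub_const hsub

end IsGaussianCoeffs

lemma freqBall_mono : Monotone freqBall := by
  intro n k hnk m hm
  rw [mem_freqBall] at hm ⊢
  have hnk' : (n : ℤ) ≤ k := by exact_mod_cast hnk
  exact ⟨fun i => ⟨(neg_le_neg hnk').trans (hm.1 i).1, (hm.1 i).2.trans hnk'⟩,
    hm.2.trans (pow_le_pow_left₀ n.cast_nonneg hnk' 2)⟩

/-! ## Completeness of `L²(P; H^s)` -/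

section Isometry

variable {Ω S E : Type*} [MeasurableSpace Ω] {P : Measure Ω} [SeminormedAddCommGroup S]
  [NormedAddCommGroup E] {T : S →+ E}

lemma eLpNorm_comp_of_norm_map_eq (hT : ∀ u, ‖T u‖ = ‖u‖) (U : Ω → S) (p : ℝ≥0∞) :
    eLpNorm (fun ω => T (U ω)) p P = eLpNorm U p P :=
  eLpNorm_congr_enorm_ae (.of_forall fun ω => by rw [← ofReal_norm, ← ofReal_norm, hT])

lemma exists_memLp_tendsto_of_isometry [CompleteSpace E] {R : E → S} (hT : ∀ u, ‖T u‖ = ‖u‖)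
    (hTR : Function.LeftInverse T R) {W : ℕ → Ω → S} (hW : ∀ n, MemLp (W n) 2 P) {b : ℕ → ℝ}
    (hb : Tendsto b atTop (𝓝 0))
    (h : ∀ N n, N ≤ n → eLpNorm (W n - W N) 2 P ≤ ENNReal.ofReal (b N)) :
    ∃ M : Ω → S, MemLp M 2 P ∧ Tendsto (fun n => eLpNorm (W n - M) 2 P) atTop (𝓝 0) := by
  have hTi : Isometry T := AddMonoidHomClass.isometry_of_norm T hT
  have hRi : Isometry R := fun a b => by rw [← hTi.edist_eq, hTR, hTR]
  have hsub (U V : Ω → S) : eLpNorm ((fun ω => T (U ω)) - fun ω => T (V ω)) 2 P =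
      eLpNorm (U - V) 2 P := by
    rw [← eLpNorm_comp_of_norm_map_eq hT (U - V)]
    simp only [Pi.sub_apply, map_sub, Pi.sub_def]
  have hTW (n : ℕ) : MemLp (fun ω => T (W n ω)) 2 P :=
    ⟨hTi.continuous.comp_aestronglyMeasurable (hW n).1,
      (eLpNorm_comp_of_norm_map_eq hT (W n) 2).trans_lt (hW n).2⟩
  have hdist (N n : ℕ) (hn : N ≤ n) : dist (hTW N).toLp (hTW n).toLp ≤ max (b N) 0 := by
    rw [dist_comm, dist_eq_norm, ← MemLp.toLp_sub, Lp.norm_toLp, hsub]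
    exact ENNReal.toReal_le_of_le_ofReal (le_max_right _ _)
      ((h N n hn).trans (ENNReal.ofReal_le_ofReal (le_max_left _ _)))
  have hb' : Tendsto (fun N => max (b N) 0) atTop (𝓝 0) := by
    simpa using hb.max (tendsto_const_nhds (x := (0 : ℝ)))
  obtain ⟨g, hg⟩ := cauchySeq_tendsto_of_complete (cauchySeq_of_le_tendsto_0' _ hdist hb')
  refine ⟨fun ω => R (g ω), ⟨hRi.continuous.comp_aestronglyMeasurable (Lp.memLp g).1, ?_⟩,
    ((Lp.tendsto_Lp_iff_tendsto_eLpNorm' _ g).1 hg).congr fun n => ?_⟩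
  · simpa only [← eLpNorm_comp_of_norm_map_eq hT, hTR _] using (Lp.memLp g).2
  · rw [← hsub]
    simp only [hTR _]
    exact eLpNorm_congr_ae ((hTW n).coeFn_toLp.sub (.refl _ _))

lemma exists_memLp_tendsto_sobolev {s : ℝ} {W : ℕ → Ω → Sobolev s} (hW : ∀ n, MemLp (W n) 2 P)
    {b : ℕ → ℝ} (hb : Tendsto b atTop (𝓝 0))
    (h : ∀ N n, N ≤ n → eLpNorm (W n - W N) 2 P ≤ ENNReal.ofReal (b N)) :
    ∃ M : Ω → Sobolev s, MemLp M 2 P ∧ Tendsto (fun n => eLpNorm (W n - M) 2 P) atTop (𝓝 0) :=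
  exists_memLp_tendsto_of_isometry (T := (Sobolev.toEll2 s).toAddMonoidHom) norm_toEll2
    (toEll2_ofEll2 s) hW hb h

end Isometry

/-! ## The truncated Wick exponentials -/

namespace IsGaussianCoeffs

variable {Ω : Type*} [MeasurableSpace Ω] {P : Measure Ω} {ξ : Freq → Ω → ℝ}

lemma hasLaw (hξ : IsGaussianCoeffs P ξ) (m : Freq) :
    HasLaw (ξ m) (gaussianReal 0 (greenVar m)) P :=
  ⟨(hξ.measurable m).aemeasurable, hξ.law m⟩

lemma memLp_two (hξ : IsGaussianCoeffs P ξ) (m : Freq) : MemLp (ξ m) 2 P :=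
  (memLp_id_gaussianReal 2).comp_measurePreserving ⟨hξ.measurable m, hξ.law m⟩

lemma integral_sum_sq (hξ : IsGaussianCoeffs P ξ) (F : Finset Freq) :
    ∫ ω, (∑ m ∈ F, ξ m ω) ^ 2 ∂P = ∑ m ∈ F, (greenVar m : ℝ) := by
  have := hξ.isProbabilityMeasure
  have hmean : ∫ ω, ∑ m ∈ F, ξ m ω ∂P = 0 := by
    rw [integral_finsetSum _ fun m _ => (hξ.memLp_two m).integrable one_le_two]
    exact Finset.sum_eq_zero fun m _ => (hξ.hasLaw m).integral_eq.trans integral_id_gaussianReal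
  have hvar := variance_of_integral_eq_zero
    (Finset.measurable_fun_sum F fun m _ => hξ.measurable m).aemeasurable hmean
  rw [show (fun ω => ∑ m ∈ F, ξ m ω) = ∑ m ∈ F, ξ m by ext; simp,
    IndepFun.variance_sum (fun m _ => hξ.memLp_two m)
    (fun m _ l _ hml => hξ.indep.indepFun hml)] at hvar
  simpa only [(hξ.hasLaw _).variance_eq, variance_id_gaussianReal, Finset.sum_apply]
    using hvar.symm

lemma wickExp_eq {X : Ω → Distr} (hξ : IsGaussianCoeffs P ξ)
    (hX : ∀ᵐ ω ∂P, ∀ n x, truncate n (X ω) x = ((∑ m ∈ freqBall n, ξ m ω * cas m x : ℝ) : ℂ))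
    (γ : ℝ) : ∀ᵐ ω ∂P, ∀ n, wickExp X P γ n ω = chaosTrunc γ (freqBall n) (ξ · ω) := by
  have hcas (m : Freq) : cas m 0 = 1 := by simp [cas, mFourier]
  have hvar (n : ℕ) :
      truncVariance X P n = ((∑ m ∈ freqBall n, (greenVar m : ℝ) : ℝ) : ℂ) := by
    rw [truncVariance, ← hξ.integral_sum_sq, ← integral_complex_ofReal]
    refine integral_congr_ae ?_
    filter_upwards [hX] with ω hω
    simp [hω n 0, hcas]
  filter_upwards [hX] with ω hω n
  ext x
  rw [chaosTrunc_apply, chaosDensity]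
  change Complex.exp _ = _
  rw [hω n x, hvar n]
  push_cast
  rfl

end IsGaussianCoeffs

/-! ## Supports of limits in measure -/

section SupportLimit

variable {Ω S : Type*} [MeasurableSpace Ω] {P : Measure Ω} [PseudoMetricSpace S]
  [MeasurableSpace S] [OpensMeasurableSpace S] {W : ℕ → Ω → S} {M : Ω → S}

lemma support_map_subset_of_tendstoInMeasure (hM : AEMeasurable M P)
    (h : TendstoInMeasure P W atTop M) {C : Set S} (hC : IsClosed C)
    (hWC : ∀ n, ∀ᵐ ω ∂P, W n ω ∈ C) : (P.map M).support ⊆ C := by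
  intro f hf
  by_contra hfC
  obtain ⟨ε, hε, hball⟩ := Metric.isOpen_iff.1 hC.isOpen_compl f hfC
  have hpos := (Measure.mem_support_iff_forall f).1 hf _ (Metric.ball_mem_nhds f (half_pos hε))
  rw [Measure.map_apply_of_aemeasurable hM Metric.isOpen_ball.measurableSet] at hpos
  refine hpos.ne' (le_antisymm (ge_of_tendsto' (tendstoInMeasure_iff_dist.1 h _ (half_pos hε))
    fun n => measure_mono_ae ?_) zero_le)
  filter_upwards [hWC n] with ω hω (hMω : M ω ∈ Metric.ball f (ε / 2))
  change ε / 2 ≤ dist (W n ω) (M ω)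
  by_contra! hlt
  refine hball (a := W n ω) ?_ hω
  calc dist (W n ω) f ≤ dist (W n ω) (M ω) + dist (M ω) f := dist_triangle _ _ _
    _ < ε / 2 + ε / 2 := add_lt_add hlt hMω
    _ = ε := add_halves ε

lemma mem_support_map_of_tendstoInMeasure (hM : AEMeasurable M P)
    (h : TendstoInMeasure P W atTop M) {f : S}
    (hf : ∀ ε > 0, ∃ c > 0, ∀ᶠ n in atTop, c ≤ P {ω | dist (W n ω) f ≤ ε}) :
    f ∈ (P.map M).support := by
  refine (Measure.mem_support_iff_forall f).2 fun U hU => ?_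
  obtain ⟨ε, hε, hball⟩ := Metric.mem_nhds_iff.1 hU
  refine lt_of_lt_of_le ?_ (measure_mono hball)
  rw [Measure.map_apply_of_aemeasurable hM Metric.isOpen_ball.measurableSet]
  obtain ⟨c, hc, hev⟩ := hf (ε / 2) (half_pos hε)
  obtain ⟨n, hWf, hWM⟩ := (hev.and
    ((tendstoInMeasure_iff_dist.1 h _ (half_pos hε)).eventually (gt_mem_nhds hc))).exists
  refine pos_iff_ne_zero.2 fun hzero => ?_
  have hcover : {ω | dist (W n ω) f ≤ ε / 2} ⊆
      M ⁻¹' Metric.ball f ε ∪ {ω | ε / 2 ≤ dist (W n ω) (M ω)} := by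
    intro ω (hω : dist (W n ω) f ≤ ε / 2)
    refine or_iff_not_imp_right.2 fun hlt => ?_
    calc dist (M ω) f ≤ dist (W n ω) (M ω) + dist (W n ω) f := dist_triangle_left _ _ _
      _ < ε / 2 + ε / 2 := add_lt_add_of_lt_of_le (not_le.1 hlt) hω
      _ = ε := add_halves ε
  have hle := (measure_mono (μ := P) hcover).trans (measure_union_le _ _)
  rw [hzero, zero_add] at hle
  exact absurd (hWf.trans hle) (not_le.2 hWM)

end SupportLimit

/-! ## Small balls -/

lemma casPoly_sub (F : Finset Freq) (b c : Freq → ℝ) :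
    casPoly F (b - c) = casPoly F b - casPoly F c := by
  ext x
  simp only [casPoly_apply, ContinuousMap.sub_apply, ← Complex.ofReal_sub, Pi.sub_apply, sub_mul,
    Finset.sum_sub_distrib]

lemma exists_casPoly_eq {F F' : Finset Freq} (h : F ⊆ F') (b κ : Freq → ℝ) :
    ∃ b' : Freq → ℝ, casPoly F b = casPoly F' b' ∧
      ∑ m ∈ F', |b' m| * κ m = ∑ m ∈ F, |b m| * κ m := by
  refine ⟨(F : Set Freq).indicator b, ?_, ?_⟩
  · ext x
    rw [casPoly_apply, casPoly_apply]
    exact congrArg _ (Finset.sum_indicator_subset_of_eq_zero b (fun m r => r * cas m x) h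
      fun m => zero_mul _).symm
  · exact Finset.sum_indicator_subset_of_eq_zero b (fun m r => |r| * κ m) h
      fun m => by rw [abs_zero, zero_mul]

lemma casPoly_single_zero {F : Finset Freq} (h0 : 0 ∈ F) (r : ℝ) :
    casPoly F (Pi.single 0 r) = (r : ℂ) • 1 := by
  ext x
  have hcas : cas 0 x = 1 := by simp [cas, mFourier_zero]
  rw [casPoly_apply, Finset.sum_eq_single_of_mem 0 h0
    fun m _ hm => by rw [Pi.single_eq_of_ne hm, zero_mul], Pi.single_eq_same, hcas, mul_one]
  exact (mul_one _).symm

/-- The Wick constant `(γ² / 2) ∑_{m ∈ F} Var(ξ_m)` as a coefficient vector, through `cas_0 = 1`. -/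
def wickShift (γ : ℝ) (F : Finset Freq) : Freq → ℝ :=
  Pi.single 0 (γ ^ 2 / 2 * ∑ m ∈ F, (greenVar m : ℝ))

lemma chaosTrunc_eq_exp_casPoly (γ : ℝ) {F : Finset Freq} (h0 : 0 ∈ F) (z : Freq → ℝ) :
    chaosTrunc γ F z = NormedSpace.exp (casPoly F (γ • z - wickShift γ F)) := by
  rw [casPoly_sub, wickShift, casPoly_single_zero h0, chaosTrunc]

lemma dependsOn_chaosTrunc (γ : ℝ) (F : Finset Freq) : DependsOn (chaosTrunc γ F) F :=
  fun z z' h => by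
    ext x
    rw [chaosTrunc_apply, chaosTrunc_apply, chaosDensity, chaosDensity,
      Finset.sum_congr rfl fun m hm => by rw [h m hm]]

lemma chaosTrunc_mul_sdiff (γ : ℝ) {F F' : Finset Freq} (h : F ⊆ F') (z : Freq → ℝ) :
    chaosTrunc γ F z * chaosTrunc γ (F' \ F) z = chaosTrunc γ F' z := by
  ext x
  rw [ContinuousMap.mul_apply, chaosTrunc_apply, chaosTrunc_apply, chaosTrunc_apply,
    ← Complex.ofReal_mul, chaosDensity, chaosDensity, ← Real.exp_add, chaosDensity,
    ← Finset.sum_sdiff h, ← Finset.sum_sdiff h]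
  ring_nf

/-- The weight with which a coefficient of the mode `m` enters the `𝓗^s` multiplier bound of a
trigonometric polynomial. -/
def casWeight (s : ℝ) (m : Freq) : ℝ := 2 * (2 * eigen m) ^ (-s / 2)

lemma casWeight_nonneg (s : ℝ) (m : Freq) : 0 ≤ casWeight s m := by
  have := eigen_pos m
  unfold casWeight
  positivity

lemma norm_casCoeff_le_one : ‖casCoeff‖ ≤ 1 := by
  have h : ‖(1 : ℂ) - Complex.I‖ ≤ 2 := (norm_sub_le _ _).trans (by norm_num)
  rw [casCoeff, norm_div, Complex.norm_ofNat]
  linarith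

lemma norm_casCoeffConj_le_one : ‖casCoeffConj‖ ≤ 1 := by
  have h : ‖(1 : ℂ) + Complex.I‖ ≤ 2 := (norm_add_le _ _).trans (by norm_num)
  rw [casCoeffConj, norm_div, Complex.norm_ofNat]
  linarith

lemma casTest_eq (m : Freq) :
    (casTest m).1.1 = casCoeff • mFourier m + casCoeffConj • mFourier (-m) := by
  ext x
  simp only [ContinuousMap.add_apply, ContinuousMap.smul_apply, casTest_apply, cas_eq, smul_eq_mul]

section Multiplier

variable {A E : Type*} [NormedRing A] [NormedAlgebra ℂ A] [SeminormedAddCommGroup E]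
  [NormedSpace ℂ E] (T : A →L[ℂ] E)

lemma norm_map_smul_add_smul_mul_le (a b : ℂ) (f g w : A) :
    ‖T ((a • f + b • g) * w)‖ ≤ ‖a‖ * ‖T (f * w)‖ + ‖b‖ * ‖T (g * w)‖ := by
  rw [add_mul, smul_mul_assoc, smul_mul_assoc, map_add, map_smul, map_smul, ← norm_smul,
    ← norm_smul]
  exact norm_add_le _ _

lemma norm_map_sum_smul_mul_le {ι : Type*} (F : Finset ι) (b : ι → ℂ) {f : ι → A} {κ : ι → ℝ}
    {w : A} (hf : ∀ i, ‖T (f i * w)‖ ≤ κ i * ‖T w‖) :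
    ‖T ((∑ i ∈ F, b i • f i) * w)‖ ≤ (∑ i ∈ F, ‖b i‖ * κ i) * ‖T w‖ := by
  rw [Finset.sum_mul, map_sum, Finset.sum_mul]
  refine (norm_sum_le _ _).trans (Finset.sum_le_sum fun i _ => ?_)
  rw [smul_mul_assoc, map_smul, norm_smul, mul_assoc]
  exact mul_le_mul_of_nonneg_left (hf i) (norm_nonneg _)

end Multiplier

lemma norm_toSobolev_casTest_mul_le {s : ℝ} (hs : s ≤ 0) (m : Freq) (w : C(T2, ℂ)) :
    ‖toSobolev hs ((casTest m).1.1 * w)‖ ≤ casWeight s m * ‖toSobolev hs w‖ := by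
  have hneg := norm_toSobolev_mFourier_mul_le hs (-m) w
  rw [eigen_neg] at hneg
  rw [casTest_eq]
  calc _ ≤ ‖casCoeff‖ * ‖toSobolev hs (mFourier m * w)‖ +
          ‖casCoeffConj‖ * ‖toSobolev hs (mFourier (-m) * w)‖ :=
        norm_map_smul_add_smul_mul_le (toSobolev hs) _ _ _ _ _
    _ ≤ 1 * ((2 * eigen m) ^ (-s / 2) * ‖toSobolev hs w‖) +
          1 * ((2 * eigen m) ^ (-s / 2) * ‖toSobolev hs w‖) := by
        gcongr
        exacts [norm_casCoeff_le_one, norm_toSobolev_mFourier_mul_le hs m w,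
          norm_casCoeffConj_le_one]
    _ = casWeight s m * ‖toSobolev hs w‖ := by
        rw [casWeight]
        ring

lemma norm_toSobolev_casPoly_mul_le {s : ℝ} (hs : s ≤ 0) (F : Finset Freq) (b : Freq → ℝ)
    (w : C(T2, ℂ)) :
    ‖toSobolev hs (casPoly F b * w)‖ ≤ (∑ m ∈ F, |b m| * casWeight s m) * ‖toSobolev hs w‖ := by
  rw [casPoly]
  simpa only [Complex.norm_real, Real.norm_eq_abs] using norm_map_sum_smul_mul_le (toSobolev hs) F
    (fun m => (b m : ℂ)) (norm_toSobolev_casTest_mul_le hs · w)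

lemma norm_map_exp_mul_mul_sub_le {A E : Type*} [NormedCommRing A] [NormedAlgebra ℂ A]
    [CompleteSpace A] [SeminormedAddCommGroup E] [NormedSpace ℂ E] (T : A →L[ℂ] E)
    {g w Z : A} {C δ η : ℝ} (hT : ‖T 1‖ ≤ 1) (hC : 0 ≤ C) (hw : ∀ v, ‖T (w * v)‖ ≤ C * ‖T v‖)
    (hδ : 0 ≤ δ) (hg : ∀ v, ‖T (g * v)‖ ≤ δ * ‖T v‖) (hZ : ‖T (Z - 1)‖ ≤ η) :
    ‖T (NormedSpace.exp g * w * Z) - T w‖ ≤ (Real.exp δ - 1) * (C * (1 + η)) + C * η := by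
  have hTZ : ‖T Z‖ ≤ 1 + η := by
    calc ‖T Z‖ = ‖T 1 + T (Z - 1)‖ := by rw [← map_add, add_sub_cancel]
      _ ≤ 1 + η := (norm_add_le _ _).trans (add_le_add hT hZ)
  calc ‖T (NormedSpace.exp g * w * Z) - T w‖
      = ‖T ((NormedSpace.exp g - 1) * (w * Z)) + T (w * (Z - 1))‖ := by
        rw [← map_sub, ← map_add]
        ring_nf
    _ ≤ (Real.exp δ - 1) * ‖T (w * Z)‖ + C * ‖T (Z - 1)‖ :=
        (norm_add_le _ _).trans
          (add_le_add (norm_map_exp_sub_one_mul_le T hδ hg _) (hw _))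
    _ ≤ (Real.exp δ - 1) * (C * (1 + η)) + C * η := by
        have hexp : 0 ≤ Real.exp δ - 1 := sub_nonneg.2 (Real.one_le_exp hδ)
        gcongr
        exact (hw Z).trans (mul_le_mul_of_nonneg_left hTZ hC)

lemma indepFun_comp_of_dependsOn {ι Ω 𝓧 β β' : Type*} [MeasurableSpace Ω] {P : Measure Ω}
    [MeasurableSpace 𝓧] [Nonempty 𝓧] [MeasurableSpace β] [MeasurableSpace β'] {X : ι → Ω → 𝓧}
    (hX : iIndepFun X P) (hXm : ∀ i, Measurable (X i)) {F G : Finset ι} (hFG : Disjoint F G)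
    {f : (ι → 𝓧) → β} {g : (ι → 𝓧) → β'} (hf : Measurable f) (hg : Measurable g)
    (hfF : DependsOn f F) (hgG : DependsOn g G) :
    IndepFun (fun ω => f (X · ω)) (fun ω => g (X · ω)) P := by
  classical
  obtain ⟨x₀⟩ := ‹Nonempty 𝓧›
  let extend (K : Finset ι) (y : K → 𝓧) (i : ι) : 𝓧 := if h : i ∈ K then y ⟨i, h⟩ else x₀
  have hextend (K : Finset ι) : Measurable (extend K) := measurable_pi_lambda _ fun i => by
    by_cases h : i ∈ K
    · simpa only [extend, h, dif_pos] using measurable_pi_apply _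
    · simpa only [extend, h, dif_neg, not_false_iff] using measurable_const
  have hrestrict (K : Finset ι) (ω : Ω) :
      ∀ i ∈ (K : Set ι), extend K (fun j => X j ω) i = X i ω := fun i hi => dif_pos hi
  have h := (hX.indepFun_finset F G hFG hXm).comp (hf.comp (hextend F)) (hg.comp (hextend G))
  convert h using 2 with ω ω
  · exact (hfF (hrestrict F ω)).symm
  · exact (hgG (hrestrict G ω)).symm

lemma half_le_measure_norm_le {Ω S : Type*} [MeasurableSpace Ω] {P : Measure Ω}
    [IsProbabilityMeasure P] [SeminormedAddCommGroup S] {U : Ω → S} (hU : StronglyMeasurable U)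
    {η : ℝ} (hη : 0 < η) (h : eLpNorm U 2 P ^ 2 ≤ ENNReal.ofReal (η ^ 2 / 2)) :
    1 / 2 ≤ P {ω | ‖U ω‖ ≤ η} := by
  have hchebyshev : P {ω | ‖U ω‖ ≤ η}ᶜ ≤ 1 / 2 := by
    have hmarkov := meas_ge_le_lintegral_div (μ := P) (hU.enorm.pow_const 2).aemeasurable
      (ε := ENNReal.ofReal (η ^ 2)) (by simpa using hη.ne') ENNReal.ofReal_ne_top
    rw [← eLpNorm_two_sq] at hmarkov
    refine (measure_mono fun ω (hω : ¬ ‖U ω‖ ≤ η) => ?_).trans (hmarkov.trans ?_)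
    · change ENNReal.ofReal (η ^ 2) ≤ ‖U ω‖ₑ ^ 2
      rw [← ofReal_norm, ← ENNReal.ofReal_pow (norm_nonneg _)]
      exact ENNReal.ofReal_le_ofReal (pow_le_pow_left₀ hη.le (not_le.1 hω).le 2)
    · refine ENNReal.div_le_of_le_mul (h.trans (le_of_eq ?_))
      rw [div_eq_inv_mul, ENNReal.ofReal_mul (by norm_num), one_div,
        ENNReal.ofReal_inv_of_pos two_pos, ENNReal.ofReal_ofNat]
  have hmeas : MeasurableSet {ω | ‖U ω‖ ≤ η} := hU.norm.measurable measurableSet_Iic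
  rw [← compl_compl {ω | ‖U ω‖ ≤ η}, prob_compl_eq_one_sub hmeas.compl, one_div,
    ← ENNReal.one_sub_inv_two, ← one_div]
  exact tsub_le_tsub_left hchebyshev 1

lemma tendsto_freqBall : Tendsto freqBall atTop atTop := by
  refine tendsto_atTop_finset_of_monotone freqBall_mono fun m => ⟨(m 0).natAbs + (m 1).natAbs, ?_⟩
  have habs_zero := abs_nonneg (m 0)
  have habs_one := abs_nonneg (m 1)
  rw [mem_freqBall, Fin.forall_fin_two, freqSq, ← sq_abs (m 0), ← sq_abs (m 1)]
  push_cast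
  refine ⟨⟨abs_le.1 (by linarith), abs_le.1 (by linarith)⟩, by nlinarith⟩

lemma zero_mem_freqBall (n : ℕ) : (0 : Freq) ∈ freqBall n :=
  mem_freqBall.2 ⟨fun i => by simp, by simp [freqSq]⟩

lemma exists_tendsto_chaosMass {γ s K : ℝ}
    (hK : ∀ F B : Finset Freq, ∑ m ∈ B, eigen m ^ s * chaosCoef γ F m ≤ K) :
    ∃ L, (∀ n, chaosMass γ s (freqBall n) ≤ L) ∧
      Tendsto (fun n => chaosMass γ s (freqBall n)) atTop (𝓝 L) := by
  have hmono : Monotone fun n => chaosMass γ s (freqBall n) := fun n k hnk =>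
    chaosMass_mono hK (freqBall_mono hnk)
  have hbdd : BddAbove (Set.range fun n => chaosMass γ s (freqBall n)) :=
    ⟨K, Set.forall_mem_range.2 fun n => chaosMass_le hK _⟩
  exact ⟨_, fun n => le_ciSup hbdd n, tendsto_atTop_ciSup hmono hbdd⟩

lemma isOpenPosMeasure_gaussianReal {v : NNReal} (hv : v ≠ 0) (μ : ℝ) :
    (gaussianReal μ v).IsOpenPosMeasure :=
  (gaussianReal_absolutelyContinuous' μ hv).isOpenPosMeasure

lemma greenVar_ne_zero (m : Freq) : greenVar m ≠ 0 := by
  have hpos : (0 : ℝ) < greenVar m := one_div_pos.2 (mul_pos two_pos (eigen_pos m))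
  exact_mod_cast hpos.ne'

namespace IsGaussianCoeffs

variable {Ω : Type*} [MeasurableSpace Ω] {P : Measure Ω} {ξ : Freq → Ω → ℝ} {γ s K : ℝ}

lemma map_restrict (hξ : IsGaussianCoeffs P ξ) (F : Finset Freq) :
    P.map (fun ω (m : F) => ξ m ω) = Measure.pi fun m : F => gaussianReal 0 (greenVar m) := by
  have := hξ.isProbabilityMeasure
  have hindep : iIndepFun (fun m : F => ξ m) P := hξ.indep.precomp Subtype.val_injective
  rw [(iIndepFun_iff_map_fun_eq_pi_map fun m : F => (hξ.measurable m).aemeasurable).1 hindep]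
  simp only [hξ.law]

lemma measure_preimage_pos (hξ : IsGaussianCoeffs P ξ) {F : Finset Freq} {U : Set (F → ℝ)}
    (hU : IsOpen U) (hU' : U.Nonempty) : 0 < P ((fun ω (m : F) => ξ m ω) ⁻¹' U) := by
  have (m : F) := isOpenPosMeasure_gaussianReal (greenVar_ne_zero m) 0
  rw [← Measure.map_apply (measurable_pi_lambda _ fun m : F => hξ.measurable m) hU.measurableSet,
    hξ.map_restrict]
  exact hU.measure_pos _ hU'

lemma measure_sum_abs_sub_lt_pos (hξ : IsGaussianCoeffs P ξ) (hγ : γ ≠ 0) (F : Finset Freq)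
    (c κ : Freq → ℝ) {δ : ℝ} (hδ : 0 < δ) :
    0 < P {ω | ∑ m ∈ F, |γ * ξ m ω - c m| * κ m < δ} := by
  simp only [← Finset.sum_coe_sort F]
  refine hξ.measure_preimage_pos (U := {y | ∑ m : F, |γ * y m - c m| * κ m < δ})
    (isOpen_lt (by fun_prop) continuous_const) ⟨fun m => γ⁻¹ * c m, ?_⟩
  simpa [mul_inv_cancel_left₀ hγ] using hδ

lemma half_le_measure_chaosTrunc_sdiff
    (hK : ∀ F B : Finset Freq, ∑ m ∈ B, eigen m ^ s * chaosCoef γ F m ≤ K)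
    (hξ : IsGaussianCoeffs P ξ) (hs : s ≤ 0) {F F' : Finset Freq}
    (hF : ∀ m ∈ F, -m ∈ F) (hF' : ∀ m ∈ F', -m ∈ F') (hFF' : F ⊆ F') {η : ℝ} (hη : 0 < η)
    (h : chaosMass γ s F' - chaosMass γ s F ≤ η ^ 2 / 2) :
    1 / 2 ≤ P {ω | ‖toSobolev hs (chaosTrunc γ (F' \ F) (ξ · ω) - 1)‖ ≤ η} := by
  have := hξ.isProbabilityMeasure
  have hsymm : ∀ m ∈ F' \ F, -m ∈ F' \ F := fun m hm => by
    rw [Finset.mem_sdiff] at hm ⊢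
    exact ⟨hF' m hm.1, fun hn => hm.2 (by simpa using hF _ hn)⟩
  have hsq := eLpNorm_toSobolev_sub_sq hK hξ hs (F := ∅) (by simp) hsymm (Finset.empty_subset _)
  simp only [chaosTrunc_empty] at hsq
  exact half_le_measure_norm_le ((toSobolev hs).continuous.comp_stronglyMeasurable
    ((hξ.stronglyMeasurable_chaosTrunc γ _).sub stronglyMeasurable_const)) hη
    (hsq.trans_le (ENNReal.ofReal_le_ofReal ((chaosMass_sdiff_sub_le hK hFF').trans h)))

lemma measure_inter_chaosTrunc (hξ : IsGaussianCoeffs P ξ) (hs : s ≤ 0) {F G : Finset Freq}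
    (hFG : Disjoint F G) (c κ : Freq → ℝ) (δ η : ℝ) :
    P ({ω | ∑ m ∈ F, |γ * ξ m ω - c m| * κ m < δ} ∩
        {ω | ‖toSobolev hs (chaosTrunc γ G (ξ · ω) - 1)‖ ≤ η}) =
      P {ω | ∑ m ∈ F, |γ * ξ m ω - c m| * κ m < δ} *
        P {ω | ‖toSobolev hs (chaosTrunc γ G (ξ · ω) - 1)‖ ≤ η} := by
  have hf : Measurable fun z : Freq → ℝ => ∑ m ∈ F, |γ * z m - c m| * κ m := by fun_prop
  have hg : Continuous fun z : Freq → ℝ => ‖toSobolev hs (chaosTrunc γ G z - 1)‖ :=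
    continuous_norm.comp ((toSobolev hs).continuous.comp
      ((continuous_chaosTrunc γ G).sub continuous_const))
  exact (indepFun_comp_of_dependsOn hξ.indep hξ.measurable hFG hf hg.measurable
    (fun z z' h => Finset.sum_congr rfl fun m hm => by rw [h m hm])
    (fun z z' h => by rw [dependsOn_chaosTrunc γ G h])).measure_inter_preimage_eq_mul _ _
    measurableSet_Iio measurableSet_Iic

end IsGaussianCoeffs

lemma norm_toSobolev_chaosTrunc_sub_exp_casPoly_le {γ s : ℝ} (hs : s ≤ 0) {F F' : Finset Freq}
    (hFF' : F ⊆ F') (h0 : 0 ∈ F) {z b : Freq → ℝ} {C δ η : ℝ}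
    (hC : ∑ m ∈ F, |b m| * casWeight s m ≤ C) (hδ : 0 ≤ δ)
    (hz : ∑ m ∈ F, |γ * z m - (b + wickShift γ F) m| * casWeight s m ≤ δ)
    (hZ : ‖toSobolev hs (chaosTrunc γ (F' \ F) z - 1)‖ ≤ η) :
    ‖toSobolev hs (chaosTrunc γ F' z) - toSobolev hs (NormedSpace.exp (casPoly F b))‖ ≤
      (Real.exp δ - 1) * (Real.exp C * (1 + η)) + Real.exp C * η := by
  have hC0 : 0 ≤ C := (Finset.sum_nonneg fun m _ =>
    mul_nonneg (abs_nonneg _) (casWeight_nonneg s m)).trans hC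
  have hone : ‖toSobolev hs 1‖ ≤ 1 := (norm_mk_ofContinuous_le hs 1).trans_eq norm_one
  have hexp : chaosTrunc γ F z = NormedSpace.exp (casPoly F (γ • z - (b + wickShift γ F))) *
      NormedSpace.exp (casPoly F b) := by
    rw [← NormedSpace.exp_add, chaosTrunc_eq_exp_casPoly γ h0, ← sub_sub, sub_right_comm,
      casPoly_sub _ _ b, sub_add_cancel]
  rw [← chaosTrunc_mul_sdiff γ hFF', hexp]
  exact norm_map_exp_mul_mul_sub_le (toSobolev hs) hone (Real.exp_pos C).le
    (norm_map_exp_mul_le (toSobolev hs) hC0 fun v =>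
      (norm_toSobolev_casPoly_mul_le hs F b v).trans (by gcongr)) hδ
    (fun v => (norm_toSobolev_casPoly_mul_le hs F _ v).trans (by gcongr; exact hz)) hZ

lemma exists_pos_exp_sub_one_mul_add_mul_le {C ε : ℝ} (hC : 0 < C) (hε : 0 < ε) :
    ∃ δ > 0, ∃ η > 0, (Real.exp δ - 1) * (C * (1 + η)) + C * η ≤ ε := by
  have hη : 0 < ε / (2 * C) := by positivity
  have hρ : 0 < ε / (2 * C * (1 + ε / (2 * C))) := by positivity
  refine ⟨Real.log (1 + ε / (2 * C * (1 + ε / (2 * C)))), Real.log_pos (by linarith),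
    ε / (2 * C), hη, le_of_eq ?_⟩
  rw [Real.exp_log (by linarith)]
  field_simp
  ring

namespace IsGaussianCoeffs

variable {Ω : Type*} [MeasurableSpace Ω] {P : Measure Ω} {ξ : Freq → Ω → ℝ} {γ s K : ℝ}

lemma mul_half_le_measure_norm_sub_le
    (hK : ∀ F B : Finset Freq, ∑ m ∈ B, eigen m ^ s * chaosCoef γ F m ≤ K)
    (hξ : IsGaussianCoeffs P ξ) (hs : s ≤ 0) {F F' : Finset Freq} (hF : ∀ m ∈ F, -m ∈ F)
    (hF' : ∀ m ∈ F', -m ∈ F') (hFF' : F ⊆ F') (h0 : 0 ∈ F) {b : Freq → ℝ} {C δ η ε : ℝ}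
    (hC : ∑ m ∈ F, |b m| * casWeight s m ≤ C) (hδ : 0 ≤ δ) (hη : 0 < η)
    (hmass : chaosMass γ s F' - chaosMass γ s F ≤ η ^ 2 / 2)
    (hε : (Real.exp δ - 1) * (Real.exp C * (1 + η)) + Real.exp C * η ≤ ε) :
    P {ω | ∑ m ∈ F, |γ * ξ m ω - (b + wickShift γ F) m| * casWeight s m < δ} * (1 / 2) ≤
      P {ω | ‖toSobolev hs (chaosTrunc γ F' (ξ · ω)) -
        toSobolev hs (NormedSpace.exp (casPoly F b))‖ ≤ ε} := by
  refine (mul_le_mul_right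
    (half_le_measure_chaosTrunc_sdiff hK hξ hs hF hF' hFF' hη hmass) _).trans ?_
  rw [← hξ.measure_inter_chaosTrunc hs Finset.disjoint_sdiff]
  refine measure_mono fun ω hω => ?_
  exact (norm_toSobolev_chaosTrunc_sub_exp_casPoly_le hs hFF' h0 hC hδ
    (le_of_lt (Set.mem_ofPred.1 hω.1)) (Set.mem_ofPred.1 hω.2)).trans hε

lemma exists_le_measure_norm_sub_le
    (hK : ∀ F B : Finset Freq, ∑ m ∈ B, eigen m ^ s * chaosCoef γ F m ≤ K)
    (hξ : IsGaussianCoeffs P ξ) (hγ : γ ≠ 0) (hs : s ≤ 0) (F : Finset Freq) (b : Freq → ℝ)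
    {ε : ℝ} (hε : 0 < ε) :
    ∃ c > 0, ∀ᶠ k in atTop, c ≤ P {ω | ‖toSobolev hs (chaosTrunc γ (freqBall k) (ξ · ω)) -
      toSobolev hs (NormedSpace.exp (casPoly F b))‖ ≤ ε} := by
  obtain ⟨L, hL, hLt⟩ := exists_tendsto_chaosMass hK
  obtain ⟨δ, hδ, η, hη, hbound⟩ := exists_pos_exp_sub_one_mul_add_mul_le
    (Real.exp_pos (∑ m ∈ F, |b m| * casWeight s m)) hε
  obtain ⟨n, hn, hFn⟩ := ((hLt.eventually (lt_mem_nhds (sub_lt_self L (b := η ^ 2 / 2)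
    (by positivity)))).and (tendsto_freqBall.eventually_ge_atTop F)).exists
  obtain ⟨b', hb', hC⟩ := exists_casPoly_eq hFn b (casWeight s)
  simp only [hb']
  have hlow := hξ.measure_sum_abs_sub_lt_pos hγ (freqBall n) (b' + wickShift γ (freqBall n))
    (casWeight s) hδ
  refine ⟨_, ENNReal.mul_pos hlow.ne' (ENNReal.half_pos one_ne_zero).ne',
    (eventually_ge_atTop n).mono fun k hk => ?_⟩
  exact hξ.mul_half_le_measure_norm_sub_le hK hs (fun _ => neg_mem_freqBall)
    (fun _ => neg_mem_freqBall) (freqBall_mono hk) (zero_mem_freqBall n) hC.le hδ.le hη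
    (by linarith [hL k]) hbound

end IsGaussianCoeffs

/-! ## Fejér means -/

section FejerWeight

variable {d : Type*} [Fintype d] [DecidableEq d]

/-- The box `{0, …, N - 1}ᵈ` of frequencies, over which the Dirichlet kernel defining the Fejér
kernel is taken. -/
def freqBox (d : Type*) [Fintype d] [DecidableEq d] (N : ℕ) : Finset (d → ℤ) :=
  Fintype.piFinset fun _ => Finset.Ico 0 (N : ℤ)

/-- The multiplier of the `N`-th Fejér mean at the frequency `p`: the proportion of the `m` in the
box for which `m - p` is in the box. -/
def fejerWeight (N : ℕ) (p : d → ℤ) : ℝ :=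
  ((freqBox d N).filter fun m => m - p ∈ freqBox d N).card / (freqBox d N).card

lemma fejerWeight_nonneg (N : ℕ) (p : d → ℤ) : 0 ≤ fejerWeight N p := by
  unfold fejerWeight
  positivity

lemma fejerWeight_le_one (N : ℕ) (p : d → ℤ) : fejerWeight N p ≤ 1 :=
  div_le_one_of_le₀ (by exact_mod_cast Finset.card_filter_le _ _) (by positivity)

lemma filter_freqBox (N : ℕ) (p : d → ℤ) :
    ((freqBox d N).filter fun m => m - p ∈ freqBox d N) =
      Fintype.piFinset fun i => Finset.Ico (max 0 (p i)) (min (N : ℤ) (N + p i)) := by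
  ext m
  simp only [freqBox, Finset.mem_filter, Fintype.mem_piFinset, ← forall_and]
  refine forall_congr' fun i => ?_
  rw [Finset.mem_Ico, Finset.mem_Ico, Finset.mem_Ico, Pi.sub_apply]
  omega

lemma fejerWeight_eq_prod {N : ℕ} (hN : 0 < N) {p : d → ℤ} (hp : ∀ i, (p i).natAbs ≤ N) :
    fejerWeight N p = ∏ i, (1 - |(p i : ℝ)| / N) := by
  have hN' : (N : ℝ) ≠ 0 := by exact_mod_cast hN.ne'
  have hcard (i : d) :
      ((Finset.Ico (max 0 (p i)) (min (N : ℤ) (N + p i))).card : ℝ) = N - |(p i : ℝ)| := by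
    have h : ((Finset.Ico (max 0 (p i)) (min (N : ℤ) (N + p i))).card : ℤ) = N - |p i| := by
      have := hp i
      rw [Int.card_Ico, Int.abs_eq_natAbs]
      omega
    exact_mod_cast congrArg (Int.cast : ℤ → ℝ) h
  rw [fejerWeight, filter_freqBox, freqBox, Fintype.card_piFinset, Fintype.card_piFinset,
    Nat.cast_prod, Nat.cast_prod, ← Finset.prod_div_distrib]
  refine Finset.prod_congr rfl fun i _ => ?_
  rw [hcard, Int.card_Ico, sub_zero, Int.toNat_natCast, sub_div, div_self hN']

lemma tendsto_fejerWeight (p : d → ℤ) : Tendsto (fun N => fejerWeight N p) atTop (𝓝 1) := by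
  have hprod : Tendsto (fun N : ℕ => ∏ i, (1 - |(p i : ℝ)| / N)) atTop (𝓝 (∏ _ : d, (1 - 0))) :=
    tendsto_finsetProd _ fun i _ => (tendsto_const_div_atTop_nhds_zero_nat _).const_sub 1
  simp only [sub_zero, Finset.prod_const_one] at hprod
  refine hprod.congr' ?_
  filter_upwards [eventually_gt_atTop 0,
    eventually_all.2 fun i => eventually_ge_atTop (p i).natAbs] with N hN hp
  exact (fejerWeight_eq_prod hN hp).symm

end FejerWeight

/-- The Fejér mean `∑_p w_N(p) û(p) e_p` of a distribution `u`, where `w_N` is `fejerWeight N`. -/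
def fejer (N : ℕ) (u : Distr) : C(T2, ℂ) :=
  ((freqBox (Fin 2) N).card : ℂ)⁻¹ • ∑ m ∈ freqBox (Fin 2) N, ∑ l ∈ freqBox (Fin 2) N,
    fourierCoeff u (m - l) • mFourier (m - l)

lemma mFourierCoeff_fejer (N : ℕ) (u : Distr) (p : Freq) :
    mFourierCoeff (fejer N u) p = fejerWeight N p * fourierCoeff u p := by
  have hinner (m : Freq) : ∑ l ∈ freqBox (Fin 2) N,
      fourierCoeff u (m - l) * mFourierCoeff (mFourier (m - l)) p =
        if m - p ∈ freqBox (Fin 2) N then fourierCoeff u p else 0 := by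
    rw [← Finset.sum_ite_eq (freqBox (Fin 2) N) (m - p) fun _ => fourierCoeff u p]
    refine Finset.sum_congr rfl fun l _ => ?_
    rw [mFourierCoeff_mFourier]
    by_cases h : m - l = p
    · rw [if_pos h, if_pos (sub_eq_of_eq_add (sub_eq_iff_eq_add'.1 h)), h, mul_one]
    · rw [if_neg h, if_neg fun h' => h (by rw [← h', sub_sub_cancel]), mul_zero]
  rw [← mFourierCoeffCLM_apply, fejer]
  simp only [map_smul, map_sum, mFourierCoeffCLM_apply, smul_eq_mul, hinner]
  rw [← Finset.sum_filter, Finset.sum_const, nsmul_eq_mul, fejerWeight]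
  push_cast
  ring

lemma tendsto_of_fourierCoeff_eq_mul {ι : Type*} {l : Filter ι} {s : ℝ} {u : Sobolev s}
    {v : ι → Sobolev s} {w : ι → Freq → ℝ}
    (hv : ∀ n p, fourierCoeff (v n) p = w n p * fourierCoeff u p)
    (hw : ∀ p, Tendsto (w · p) l (𝓝 1)) (hbound : ∀ n p, |w n p - 1| ≤ 1) :
    Tendsto v l (𝓝 u) := by
  have hcoeff (n : ι) (p : Freq) :
      Sobolev.toEll2 s (v n - u) p = ((w n p - 1 : ℝ) : ℂ) * Sobolev.toEll2 s u p := by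
    have hsub : fourierCoeff (v n - u : Sobolev s) p = fourierCoeff (v n) p - fourierCoeff u p :=
      rfl
    rw [toEll2_apply, hsub, hv, toEll2_apply]
    push_cast
    ring
  have hnorm (n : ι) :
      ∑' p, (w n p - 1) ^ 2 * ‖Sobolev.toEll2 s u p‖ ^ 2 = ‖v n - u‖ ^ 2 := by
    rw [← norm_toEll2, ← (hasSum_sq_norm_ell2 _).tsum_eq]
    refine tsum_congr fun p => ?_
    rw [hcoeff, norm_mul, mul_pow, Complex.norm_real, Real.norm_eq_abs, sq_abs]
  have htsum : Tendsto (fun n => ∑' p, (w n p - 1) ^ 2 * ‖Sobolev.toEll2 s u p‖ ^ 2) l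
      (𝓝 (∑' p, (1 - 1) ^ 2 * ‖Sobolev.toEll2 s u p‖ ^ 2)) := by
    refine tendsto_tsum_of_dominated_convergence (hasSum_sq_norm_ell2 (Sobolev.toEll2 s u)).summable
      (fun p => (((hw p).sub_const 1).pow 2).mul_const _) (.of_forall fun n p => ?_)
    rw [Real.norm_of_nonneg (by positivity)]
    exact mul_le_of_le_one_left (by positivity) ((sq_le_one_iff_abs_le_one _).2 (hbound n p))
  simp only [hnorm, sub_self, zero_pow two_ne_zero, zero_mul, tsum_zero] at htsum
  rw [tendsto_iff_norm_sub_tendsto_zero]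
  simpa [Real.sqrt_sq] using htsum.sqrt

lemma tendsto_fejer {s : ℝ} (hs : s ≤ 0) (u : Sobolev s) :
    Tendsto (fun N => toSobolev hs (fejer N u)) atTop (𝓝 u) :=
  tendsto_of_fourierCoeff_eq_mul
    (fun N p => by rw [coe_toSobolev, fourierCoeff_ofContinuous, mFourierCoeff_fejer])
    tendsto_fejerWeight
    fun N p => abs_le.2 ⟨by linarith [fejerWeight_nonneg N p],
      by linarith [fejerWeight_le_one N p]⟩

/-- The unnormalised Fejér kernel `y ↦ |∑_m e_m(x - y)|²` as a test function. -/
def fejerKernel (N : ℕ) (x : T2) : TestFunction :=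
  ∑ m ∈ freqBox (Fin 2) N, ∑ l ∈ freqBox (Fin 2) N, mFourier (m - l) x • char (-(m - l))

lemma fejer_apply (N : ℕ) (u : Distr) (x : T2) :
    fejer N u x = ((freqBox (Fin 2) N).card : ℂ)⁻¹ * u.1 (fejerKernel N x) := by
  simp only [fejerKernel, map_sum, map_smul, fejer, ContinuousMap.smul_apply,
    ContinuousMap.coe_sum, Finset.sum_apply, smul_eq_mul, fourierCoeff,
    mul_comm (mFourier _ x)]

lemma fejerKernel_apply (N : ℕ) (x y : T2) :
    (fejerKernel N x).1 y = (∑ m ∈ freqBox (Fin 2) N, mFourier m (x - y)) *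
      star (∑ m ∈ freqBox (Fin 2) N, mFourier m (x - y)) := by
  have hcoe : (fejerKernel N x).1 = ∑ m ∈ freqBox (Fin 2) N, ∑ l ∈ freqBox (Fin 2) N,
      mFourier (m - l) x • mFourier (-(m - l)) := by
    simp only [fejerKernel, Submodule.coe_sum, Submodule.coe_smul]
    rfl
  rw [hcoe, star_sum, Finset.sum_mul_sum]
  simp only [ContinuousMap.coe_sum, Finset.sum_apply, ContinuousMap.smul_apply, smul_eq_mul]
  refine Finset.sum_congr rfl fun m _ => Finset.sum_congr rfl fun l _ => ?_
  rw [← starRingEnd_apply, ← mFourier_neg, ← mFourier_add, ← sub_eq_add_neg m l,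
    sub_eq_add_neg x y, mFourier_apply_add, mFourier_apply_neg]

lemma fejer_nonneg {u : Distr} (hu : IsNonneg u) (N : ℕ) (x : T2) : 0 ≤ fejer N u x := by
  rw [fejer_apply]
  refine mul_nonneg (inv_nonneg.2 (Nat.cast_nonneg _)) (hu _ fun y => ?_)
  rw [fejerKernel_apply]
  exact mul_star_self_nonneg _

/-! ## Density of the exponentials of real trigonometric polynomials -/

lemma mFourier_eq_smul_casTest (m : Freq) :
    mFourier m = casCoeffConj • (casTest m).1.1 + casCoeff • (casTest (-m)).1.1 := by
  rw [casTest_eq, casTest_eq, neg_neg]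
  ext x
  simp only [ContinuousMap.add_apply, ContinuousMap.smul_apply, smul_eq_mul]
  linear_combination (-2 * mFourier m x) * casCoeff_mul_casCoeffConj -
    mFourier (-m) x * casCoeff_mul_self - mFourier (-m) x * casCoeffConj_mul_self

lemma span_casTest_closure_eq_top :
    (Submodule.span ℂ (Set.range fun m => (casTest m).1.1)).topologicalClosure = ⊤ := by
  rw [eq_top_iff, ← span_mFourier_closure_eq_top]
  refine Submodule.topologicalClosure_mono (Submodule.span_le.2 ?_)
  rintro _ ⟨m, rfl⟩
  rw [mFourier_eq_smul_casTest]
  exact add_mem (Submodule.smul_mem _ _ (Submodule.subset_span ⟨m, rfl⟩))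
    (Submodule.smul_mem _ _ (Submodule.subset_span ⟨-m, rfl⟩))

lemma mem_closure_range_casPoly {u : C(T2, ℂ)} (hu : ∀ x, (u x).im = 0) :
    u ∈ closure (Set.range (Function.uncurry casPoly)) := by
  let reC : C(ℂ, ℂ) := ⟨fun z => (z.re : ℂ), by fun_prop⟩
  have hre : reC.comp u = u := ContinuousMap.ext fun x => Complex.ext rfl (hu x).symm
  have hspan : u ∈ closure (Submodule.span ℂ (Set.range fun m => (casTest m).1.1) :
      Set C(T2, ℂ)) := by
    rw [← Submodule.topologicalClosure_coe, span_casTest_closure_eq_top]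
    trivial
  rw [← hre]
  refine map_mem_closure (ContinuousMap.continuous_postcomp reC) hspan fun p hp => ?_
  obtain ⟨c, rfl⟩ := Finsupp.mem_span_range_iff_exists_finsupp.1 hp
  refine ⟨(c.support, fun m => (c m).re), ContinuousMap.ext fun x => ?_⟩
  simp only [Function.uncurry_apply_pair, casPoly_apply, reC, ContinuousMap.comp_apply,
    ContinuousMap.coe_mk, Finsupp.sum, ContinuousMap.coe_sum, Finset.sum_apply,
    ContinuousMap.smul_apply, smul_eq_mul, casTest_apply, Complex.re_sum, Complex.re_mul_ofReal]

lemma mem_closure_range_exp_casPoly {w : C(T2, ℂ)} (hw : ∀ x, 0 < w x) :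
    w ∈ closure (Set.range fun q => NormedSpace.exp (Function.uncurry casPoly q)) := by
  have hre (x : T2) : 0 < (w x).re := (Complex.lt_def.1 (hw x)).1
  let u : C(T2, ℂ) := ⟨fun x => (Real.log (w x).re : ℂ), Complex.continuous_ofReal.comp
    ((Complex.continuous_re.comp w.continuous).log fun x => (hre x).ne')⟩
  have hexp : NormedSpace.exp u = w := ContinuousMap.ext fun x => by
    rw [exp_apply, ContinuousMap.coe_mk, ← Complex.ofReal_exp, Real.exp_log (hre x)]
    exact Complex.ext rfl (Complex.lt_def.1 (hw x)).2
  rw [← hexp]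
  refine map_mem_closure NormedSpace.exp_continuous
    (mem_closure_range_casPoly (u := u) fun x => Complex.ofReal_im _) ?_
  rintro _ ⟨q, rfl⟩
  exact ⟨q, rfl⟩

lemma mem_closure_range_toSobolev_exp_casPoly {s : ℝ} (hs : s ≤ 0) {f : Sobolev s}
    (hf : IsNonneg f) : f ∈ closure
      (Set.range fun q => toSobolev hs (NormedSpace.exp (Function.uncurry casPoly q))) := by
  have hone : Tendsto (fun N : ℕ => toSobolev hs ((1 / ((N : ℂ) + 1)) • 1)) atTop (𝓝 0) := by
    have h := ((toSobolev hs).continuous.tendsto _).comp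
      ((tendsto_one_div_add_atTop_nhds_zero_nat (𝕜 := ℂ)).smul_const (1 : C(T2, ℂ)))
    rwa [zero_smul ℂ (1 : C(T2, ℂ)), map_zero] at h
  have hfejer := (tendsto_fejer hs f).add hone
  rw [add_zero] at hfejer
  simp only [← map_add] at hfejer
  refine isClosed_closure.mem_of_tendsto hfejer (.of_forall fun N => ?_)
  have hpos (x : T2) : 0 < (fejer N f + (1 / ((N : ℂ) + 1)) • 1) x := by
    refine add_pos_of_nonneg_of_pos (fejer_nonneg hf N x) ?_
    rw [ContinuousMap.smul_apply, ContinuousMap.one_apply, smul_eq_mul, mul_one]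
    positivity
  refine map_mem_closure (toSobolev hs).continuous (mem_closure_range_exp_casPoly hpos) ?_
  rintro _ ⟨q, rfl⟩
  exact ⟨q, rfl⟩

/-! ## Existence and support of the Gaussian multiplicative chaos -/

lemma isNonneg_ofContinuous {w : C(T2, ℂ)} (hw : ∀ x, 0 ≤ w x) : IsNonneg (ofContinuous w) :=
  fun _ hφ => integral_nonneg fun x => mul_nonneg (hw x) (hφ x)

namespace IsGaussianCoeffs

variable {Ω : Type*} [MeasurableSpace Ω] {P : Measure Ω} {ξ : Freq → Ω → ℝ} {X : Ω → Distr}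
  {γ s K : ℝ}

lemma exists_isGMC (hK : ∀ F B : Finset Freq, ∑ m ∈ B, eigen m ^ s * chaosCoef γ F m ≤ K)
    (hξ : IsGaussianCoeffs P ξ) (hs : s ≤ 0)
    (hX : ∀ᵐ ω ∂P, ∀ n, wickExp X P γ n ω = chaosTrunc γ (freqBall n) (ξ · ω)) :
    ∃ M : Ω → Sobolev s, IsGMC X P γ s M := by
  let W (n : ℕ) (ω : Ω) : Sobolev s := toSobolev hs (wickExp X P γ n ω)
  have hWξ (n : ℕ) : W n =ᵐ[P] fun ω => toSobolev hs (chaosTrunc γ (freqBall n) (ξ · ω)) :=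
    hX.mono fun ω hω => congrArg (toSobolev hs) (hω n)
  have hmem (n : ℕ) : MemLp (W n) 2 P :=
    (hξ.memLp_toSobolev hK hs fun _ => neg_mem_freqBall).ae_eq (hWξ n).symm
  obtain ⟨L, hL, hLt⟩ := exists_tendsto_chaosMass hK
  have hrate : Tendsto (fun n => √(L - chaosMass γ s (freqBall n))) atTop (𝓝 0) := by
    simpa using (hLt.const_sub L).sqrt
  have hcauchy (N n : ℕ) (hNn : N ≤ n) :
      eLpNorm (W n - W N) 2 P ≤ ENNReal.ofReal √(L - chaosMass γ s (freqBall N)) := by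
    have hsub : W n - W N =ᵐ[P] fun ω => toSobolev hs
        (chaosTrunc γ (freqBall n) (ξ · ω) - chaosTrunc γ (freqBall N) (ξ · ω)) := by
      filter_upwards [hWξ n, hWξ N] with ω hn hN
      rw [Pi.sub_apply, hn, hN, map_sub]
    rw [eLpNorm_congr_ae hsub, ← ENNReal.pow_le_pow_left_iff two_ne_zero,
      hξ.eLpNorm_toSobolev_sub_sq hK hs (fun _ => neg_mem_freqBall) (fun _ => neg_mem_freqBall)
        (freqBall_mono hNn), ← ENNReal.ofReal_pow (Real.sqrt_nonneg _),
      Real.sq_sqrt (sub_nonneg.2 (hL N))]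
    exact ENNReal.ofReal_le_ofReal (by linarith [hL n])
  obtain ⟨M, hM, hWM⟩ := exists_memLp_tendsto_sobolev hmem hrate hcauchy
  exact ⟨M, hM, W, fun n ω => rfl, hmem, hWM⟩

lemma support_eq (hK : ∀ F B : Finset Freq, ∑ m ∈ B, eigen m ^ s * chaosCoef γ F m ≤ K)
    (hξ : IsGaussianCoeffs P ξ) (hγ : γ ≠ 0) (hs : s ≤ 0)
    (hX : ∀ᵐ ω ∂P, ∀ n, wickExp X P γ n ω = chaosTrunc γ (freqBall n) (ξ · ω))
    {M : Ω → Sobolev s} (hM : IsGMC X P γ s M) :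
    (P.map M).support = {f : Sobolev s | IsNonneg f} := by
  obtain ⟨hM2, W, hWX, hW2, hWM⟩ := hM
  have hmeas : AEMeasurable M P := hM2.1.aemeasurable
  have hlim : TendstoInMeasure P W atTop M := tendstoInMeasure_of_tendsto_eLpNorm_of_ne_top
    two_ne_zero ENNReal.ofNat_ne_top (fun n => (hW2 n).1) hM2.1 hWM
  have hW : ∀ᵐ ω ∂P, ∀ n, W n ω = toSobolev hs (chaosTrunc γ (freqBall n) (ξ · ω)) :=
    hX.mono fun ω hω n => Subtype.ext (by rw [hWX, hω, coe_toSobolev])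
  refine Set.Subset.antisymm ?_ fun f hf => ?_
  · refine support_map_subset_of_tendstoInMeasure hmeas hlim (isClosed_isNonneg s)
      fun n => hW.mono fun ω hω => ?_
    rw [hω n]
    exact isNonneg_ofContinuous fun x => by
      rw [chaosTrunc_apply]
      exact_mod_cast (chaosDensity_pos _ _ _ _).le
  · refine closure_minimal ?_ Measure.isClosed_support
      (mem_closure_range_toSobolev_exp_casPoly hs hf)
    rintro _ ⟨⟨F, b⟩, rfl⟩
    refine mem_support_map_of_tendstoInMeasure hmeas hlim fun ε hε => ?_
    obtain ⟨c, hc, hev⟩ := hξ.exists_le_measure_norm_sub_le hK hγ hs F b hε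
    refine ⟨c, hc, hev.mono fun n hn => hn.trans (measure_mono_ae ?_)⟩
    filter_upwards [hW] with ω hω hclose
    change dist (W n ω) _ ≤ ε
    rw [hω n, dist_eq_norm]
    exact hclose

end IsGaussianCoeffs

end TorusGMC

end

theorem mainTheorem4 {Ω : Type*} [MeasurableSpace Ω] (P : Measure Ω) [IsProbabilityMeasure P]
    (X : Ω → TorusGMC.Distr) (hX : TorusGMC.IsMassiveGFF X P)
    (γ : ℝ) (hγ : |γ| < Real.sqrt (8 * Real.pi)) (hγ0 : γ ≠ 0)
    (β : ℝ) (hβ : β ∈ Set.Ioo (γ ^ 2 / (8 * Real.pi)) 1) :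
    (∃ M : Ω → TorusGMC.Sobolev (-β), TorusGMC.IsGMC X P γ (-β) M) ∧
    ∀ M : Ω → TorusGMC.Sobolev (-β), TorusGMC.IsGMC X P γ (-β) M →
      (P.map M).support = {f : TorusGMC.Sobolev (-β) | TorusGMC.IsNonneg f} := by
  have hβ_nonpos : -β ≤ 0 := by
    have : 0 ≤ γ ^ 2 / (8 * Real.pi) := by positivity
    linarith [hβ.1]
  obtain ⟨K, hK⟩ := TorusGMC.exists_sum_chaosCoef_le hβ.1 hβ.2
  obtain ⟨ξ, hξ, hXξ⟩ := TorusGMC.exists_isGaussianCoeffs hX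
  have hwick := hξ.wickExp_eq hXξ γ
  exact ⟨hξ.exists_isGMC hK hβ_nonpos hwick,
    fun M hM => hξ.support_eq hK hγ0 hβ_nonpos hwick hM⟩
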